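/- **Setting.** For $\beta>1$ let $T_\beta:[0,1)\to[0,1)$, $T_\beta(x)=\beta x-\lfloor\beta x\rfloor$, and for $t\in[0,1)$ let $K_\beta(t)=\{x\in[0,1): T_\beta^n(x)\ge t\ \text{for all } n\ge 0\}$. The critical value is $\tau(\beta)=\min\{t\in(0,1): \dim_H K_\beta(t)=0\}$. For a bounded sequence $(c_i)_{i\ge1}$ of non-negative integers write $((c_i))_\beta=\sum_{i\ge1}c_i\beta^{-i}$. The quasi-greedy expansion $\alpha(\beta)$ of $1$ in base $\beta$ is the lexicographically largest sequence over $\{0,1,\dots,\lceil\beta\rceil-1\}$ that does not end in $0^\infty$ and has value $1$ in base $\beta$. *Words.* For a finite word $w=w_1\dots w_m$ put $w^{+}=w_1\dots w_{m-1}(w_m+1)$, put $w^{-}=w_1\dots w_{m-1}(w_m-1)$ if $w_m>0$, and let $\mathbb L(w)$ be the lexicographically largest cyclic permutation of $w$. Let $F_0=(0,1)$, and obtain the ordered list $F_{n+1}$ from $F_n$ by inserting, between each two neighbours $v,w$, the concatenation $vw$. Let $\mathcal F=\bigcup_{n\ge1}F_n\setminus\{0,1\}$, and let $\mathcal F_e=\{\theta^k(w):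 w\in\mathcal F\cup\{1\},\,k\ge0\}$, where $\theta$ adds $1$ to each digit. For a word $s$ in $\mathcal F_e$, or obtained from such words as below, the map $\Phi_s$ on finite or infinite $0$-$1$ words $r=r_1r_2\dots$ replaces each letter $r_i$ by a block: for $i\ge2$ the block is $\mathbb L(s)$, $\mathbb L(s)^+$, $s^-$, $s$ according as $r_{i-1}r_i$ is $00$, $01$, $10$, $11$; for $i=1$ it is $s^-$ if $r_1=0$ and $\mathbb L(s)^+$ if $r_1=1$. Put $s\bullet r=\Phi_s(r)$ for finite $r$. Let $\Lambda_e(m)$ be the set of words $s_1\bullet s_2\bullet\cdots\bullet s_m$ (bracketed from the left) with $s_1\in\mathcal F_e$ and $s_2,\dots,s_m\in\mathcal F$, and $\Lambda_e=\bigcup_{m\ge1}\Lambda_e(m)$. *Intervals and sets.* For $S\in\Lambda_e$ let $\beta_\ell^S,\beta_*^S,\beta_r^S>1$ be the bases given by $$(\mathbb L(S)^\infty)_{\beta_\ell^S}=(\mathbb L(S)^+S^-\mathbb L(S)^\infty)_{\beta_*^S}=(\mathbb L(S)^+S^\infty)_{\beta_r^S}=1,$$ and let $I^S=[\beta_\ell^S,\beta_*^S]$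 (a basic interval) and $J^S=[\beta_\ell^S,\beta_r^S]$. Put $$E=(1,\infty)\setminus\bigcup_{s\in\mathcal F_e}J^s,\qquad E_L=E\cup\{\beta_\ell^s:s\in\mathcal F_e\},$$ $$E^S=(J^S\setminus I^S)\setminus\bigcup_{r\in\mathcal F}J^{S\bullet r}\quad(S\in\Lambda_e),\qquad E_\infty=\bigcap_{m\ge1}\ \bigcup_{S\in\Lambda_e(m)}J^S.$$ A coding of $\beta$ is a sequence $(s_k)_{k\ge1}$ with $s_1\in\mathcal F_e$, $s_k\in\mathcal F$ for $k\ge2$, and $\beta\in J^{s_1\bullet\cdots\bullet s_n}$ for every $n\ge1$. For $\hat\beta\in(1,2]$ and $\beta>1$ write $\beta=\Psi_S(\hat\beta)$ if $\alpha(\beta)=\Phi_S(\alpha(\hat\beta))$. **Theorem.** For every $\beta>1$ the minimum defining $\tau(\beta)$ exists. Moreover: (i) If $S\in\Lambda_e$, then $\tau(\beta)=(S^-\,\mathbb L(S)^\infty)_\beta$ for every $\beta\in I^S$. (ii) For every $\beta>1$, $\tau(\beta)\le 1-\frac1\beta$, and $\tau(\beta)=1-\frac1\beta$ if and only if $\beta\in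 E_L$. (iii) If $S\in\Lambda_e$ and $\beta\in E^S$, then there is exactly one $\hat\beta\in(1,2]$ with $\beta=\Psi_S(\hat\beta)$, and, writing $\alpha(\hat\beta)=1\hat\alpha_2\hat\alpha_3\dots$, $$\tau(\beta)=\big(\Phi_S(0\,\hat\alpha_2\hat\alpha_3\dots)\big)_\beta .$$ (iv) Every $\beta\in E_\infty$ has a coding, and for every coding $(s_k)$ of $\beta$ $$\tau(\beta)=\lim_{n\to\infty}\big(s_1\bullet s_2\bullet\cdots\bullet s_n\,0^\infty\big)_\beta .$$ -/

import Mathlib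

namespace BetaHole

/-! ### Beta-transformation, survivor set, critical value -/

/-- The transformation `T_β x = βx - ⌊βx⌋`. -/
noncomputable def betaMap (β x : ℝ) : ℝ := Int.fract (β * x)

/-- `K_β(t)`: the points of `[0,1)` whose forward orbit under `T_β` never enters `[0,t)`. -/
def survivorSet (β t : ℝ) : Set ℝ :=
  {x | x ∈ Set.Ico (0 : ℝ) 1 ∧ ∀ n : ℕ, t ≤ (betaMap β)^[n] x}

/-- The parameters `t ∈ (0,1)` for which the survivor set has Hausdorff dimension zero. -/
def zeroDimParams (β : ℝ) : Set ℝ :=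
  {t | 0 < t ∧ t < 1 ∧ dimH (survivorSet β t) = 0}

/-- The critical value `τ(β)`, the minimum of `zeroDimParams β`; it is written as an infimum here,
and that it is attained is part of the theorem. -/
noncomputable def criticalValue (β : ℝ) : ℝ := sInf (zeroDimParams β)

/-! ### Expansions in base `β`

A digit sequence `c₁c₂c₃…` is a function `c : ℕ → ℕ`, with `c i` the digit at position `i + 1`. -/

/-- `(c)_β = ∑_{i ≥ 1} c_i β^{-i}`. -/
noncomputable def value (β : ℝ) (c : ℕ → ℕ) : ℝ := ∑' i : ℕ, (c i : ℝ) / β ^ (i + 1)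

/-- `c` is a sequence over `{0, …, ⌈β⌉ - 1}` which does not end in `0^∞` and has value `x`. -/
def IsInfiniteExpansion (β x : ℝ) (c : ℕ → ℕ) : Prop :=
  (∀ i, c i < ⌈β⌉₊) ∧ (∀ N, ∃ n, N ≤ n ∧ c n ≠ 0) ∧ value β c = x

/-- `c` is the quasi-greedy expansion of `x` in base `β`: the lexicographically largest
expansion not ending in `0^∞`. -/
def IsQuasiGreedy (β x : ℝ) (c : ℕ → ℕ) : Prop :=
  IsInfiniteExpansion β x c ∧ ∀ d, IsInfiniteExpansion β x d → toLex d ≤ toLex c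

/-! ### Words -/

/-- `w⁺`: the last digit is increased by one. -/
def plus (w : List ℕ) : List ℕ := w.dropLast ++ [w.getLastD 0 + 1]

/-- `w⁻`: the last digit (positive whenever this is used) is decreased by one. -/
def minus (w : List ℕ) : List ℕ := w.dropLast ++ [w.getLastD 0 - 1]

/-- `𝕃(w)`: the lexicographically largest cyclic permutation of `w`. -/
def maxRot (w : List ℕ) : List ℕ := w.cyclicPermutations.foldr max []

/-- The infinite sequence `u v^∞`. -/
def evPer (u v : List ℕ) : ℕ → ℕ := fun n =>
  if n < u.length then u.getD n 0 else v.getD ((n - u.length) % v.length) 0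

/-- `θ^k`: every digit is increased by `k`. -/
def shiftDigits (k : ℕ) (w : List ℕ) : List ℕ := w.map (· + k)

/-! ### Farey words -/

/-- Inserts `vw` between any two neighbours `v`, `w` of a list of words. -/
def fareyRefine : List (List ℕ) → List (List ℕ)
  | v :: w :: l => v :: (v ++ w) :: fareyRefine (w :: l)
  | l => l

/-- The ordered sets `F_n`. -/
def fareyList : ℕ → List (List ℕ)
  | 0 => [[0], [1]]
  | n + 1 => fareyRefine (fareyList n)

/-- The Farey words of length at least two. -/
def farey : Set (List ℕ) := {w | ∃ n, 1 ≤ n ∧ w ∈ fareyList n ∧ w ≠ [0] ∧ w ≠ [1]}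

/-- The extended Farey words `θ^k(w)`, `k ≥ 0`, where `w` is the word `1` or a Farey word of
length at least two. -/
def fareyExt : Set (List ℕ) := {w | ∃ k v, (v ∈ farey ∨ v = [1]) ∧ w = shiftDigits k v}

/-! ### Substitutions -/

/-- The block of `Φ_s` that is written for a letter `d` preceded by the letter `p` (letters are
`0` or `1`): `00 ↦ 𝕃(s)`, `01 ↦ 𝕃(s)⁺`, `10 ↦ s⁻`, `11 ↦ s`. -/
def block (s : List ℕ) : ℕ → ℕ → List ℕ
  | 0, 0 => maxRot s
  | 0, _ + 1 => plus (maxRot s)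
  | _ + 1, 0 => minus s
  | _ + 1, _ + 1 => s

/-- The concatenation of the blocks for the letters of a word preceded by the letter `p`. -/
def blocks (s : List ℕ) : ℕ → List ℕ → List ℕ
  | _, [] => []
  | p, d :: r => block s p d ++ blocks s d r

/-- `s • r = Φ_s(r)` for a word `r` over `{0,1}`. An initial `0` gives `s⁻` and an initial `1`
gives `𝕃(s)⁺`, as if it were preceded by the opposite letter. -/
def subst (s r : List ℕ) : List ℕ := blocks s (1 - r.headD 0) r

/-- `Φ_s(c)` for a sequence `c` over `{0,1}`. All blocks have length `|s|`. -/
def substSeq (s : List ℕ) (c : ℕ → ℕ) : ℕ → ℕ := fun n =>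
  let i := n / s.length
  (block s (if i = 0 then 1 - c 0 else c (i - 1)) (c i)).getD (n % s.length) 0

/-- `s₁ • s₂ • ⋯ • s_{n+1}`, where `s_{i+1}` is `s i`. -/
def chain (s : ℕ → List ℕ) : ℕ → List ℕ
  | 0 => s 0
  | n + 1 => subst (chain s n) (s (n + 1))

/-- `s₁` is an extended Farey word and `s₂, s₃, …` are Farey words of length at least two. -/
def IsFareySeq (s : ℕ → List ℕ) : Prop := s 0 ∈ fareyExt ∧ ∀ k, 1 ≤ k → s k ∈ farey

/-- `Λ_e(m)`, the words `s₁ • ⋯ • s_m` with `s₁` extended Farey and `s₂, …, s_m` Farey words of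
length at least two, for `m ≥ 1`. -/
def lambdaLevel (m : ℕ) : Set (List ℕ) :=
  {S | 1 ≤ m ∧ ∃ s, IsFareySeq s ∧ S = chain s (m - 1)}

/-- `Λ_e`. -/
def lambdaExt : Set (List ℕ) := {S | ∃ m, S ∈ lambdaLevel m}

/-! ### Intervals and exceptional sets -/

/-- The base `β > 1` in which `c` has value `1`; it is unique for a bounded sequence `c` with
infinitely many nonzero digits, the only case that is used. -/
noncomputable def baseOf (c : ℕ → ℕ) : ℝ := sInf {β | 1 < β ∧ value β c = 1}

/-- `β_ℓ^S`, given by `(𝕃(S)^∞)_β = 1`. -/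
noncomputable def betaL (S : List ℕ) : ℝ := baseOf (evPer [] (maxRot S))

/-- `β_*^S`, given by `(𝕃(S)⁺ S⁻ 𝕃(S)^∞)_β = 1`. -/
noncomputable def betaStar (S : List ℕ) : ℝ :=
  baseOf (evPer (plus (maxRot S) ++ minus S) (maxRot S))

/-- `β_r^S`, given by `(𝕃(S)⁺ S^∞)_β = 1`. -/
noncomputable def betaR (S : List ℕ) : ℝ := baseOf (evPer (plus (maxRot S)) S)

/-- The basic interval `I^S = [β_ℓ^S, β_*^S]`. -/
def basicInterval (S : List ℕ) : Set ℝ := Set.Icc (betaL S) (betaStar S)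

/-- The interval `J^S = [β_ℓ^S, β_r^S]`. -/
def outerInterval (S : List ℕ) : Set ℝ := Set.Icc (betaL S) (betaR S)

/-- The exceptional set `E`. -/
def exceptional : Set ℝ := Set.Ioi 1 \ ⋃ s ∈ fareyExt, outerInterval s

/-- `E_L = E ∪ {β_ℓ^s : s ∈ F_e}`. -/
def exceptionalL : Set ℝ := exceptional ∪ {β | ∃ s ∈ fareyExt, β = betaL s}

/-- The relative exceptional set `E^S`. -/
def relExceptional (S : List ℕ) : Set ℝ :=
  (outerInterval S \ basicInterval S) \ ⋃ r ∈ farey, outerInterval (subst S r)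

/-- The infinitely renormalizable set `E_∞`. -/
def infRenorm : Set ℝ := ⋂ m ∈ Set.Ici (1 : ℕ), ⋃ S ∈ lambdaLevel m, outerInterval S

/-- `(s_k)` is a coding of `β`: `β ∈ J^{s₁ • ⋯ • s_n}` for all `n ≥ 1`, with `s₁` an extended
Farey word and the other `s_k` Farey words of length at least two. -/
def IsCoding (s : ℕ → List ℕ) (β : ℝ) : Prop :=
  IsFareySeq s ∧ ∀ n, β ∈ outerInterval (chain s n)

/-- `β = Ψ_S(β')`: here `β' ∈ (1,2]`, `β > 1`, and the quasi-greedy expansions of `1` satisfy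
`α(β) = Φ_S(α(β'))`. -/
def IsPsi (S : List ℕ) (β' β : ℝ) : Prop :=
  β' ∈ Set.Ioc (1 : ℝ) 2 ∧ 1 < β ∧
    ∃ a : ℕ → ℕ, IsQuasiGreedy β' 1 a ∧ IsQuasiGreedy β 1 (substSeq S a)

end BetaHole

open BetaHole

namespace BetaHole
open Set

/-! ### Digit sequences and the lexicographic order -/

-- The problem is moved to digit sequences. Greedy digits of a point surviving the hole `[0,t)` with
-- `t = (c)_β` have all their shifts between `c` and `α(β)`, so the survivor set lies in the set of
-- values of the lexicographic subshift `shiftsBetween c (alpha β)`. Taking values is Hölder, and it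
-- has a Hölder inverse once the upper bound is replaced by some `f < α(β)`, because values then
-- stay a fixed distance below `1` (`exists_gap`). Hence `τ(β) = (c)_β` as soon as the subshift of
-- `c` has dimension zero, while bounds `e` agreeing with `c` for arbitrarily long and some `f <
-- α(β)` give positive dimension (`Rich`). This criterion is `isLeast_zeroDimParams`.
--
-- Dimension zero has one source: between `ay` and `(a+1)y` almost every word has at most one left
-- extension, so there are at most `n + 1` words of length `n` (`seqDim_injective_type`). Lowering
-- the first digit of `α(β)` gives value `1 - 1/β`, whence the general upper bound. The result is
-- carried to deeper levels by renormalization (`seqDim_renorm_ext`): a sequence with shifts between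
-- `Φ_s(c₀)` and `Φ_s(c₁)` is either in such a zero-dimensional set or, after a finite prefix, a
-- `Φ_s`-image of a sequence between `c₀` and `c₁`. The dimension is thus divided by at least `|s|`,
-- and this iterates along `s₁ • ⋯ • s_m`.
--
-- Positive dimension also has one source, the full binary shift. Farey words are the images of `01`
-- under compositions of `λ : 0 ↦ 0, 1 ↦ 01` and `ρ : 0 ↦ 01, 1 ↦ 1`. These maps and all `Φ_S`
-- preserve order and positive dimension, so richness passes from `(01^∞, 1^∞)` to every interval
-- end point.
--
-- Finally the bases are classified. Binary search in the Farey tree (`exists_limit_of_gap`) shows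
-- that an `α(β)` in a gap and in none of the intervals is a limit of left end points, from which it
-- inherits richness; this settles `E` and `E^S`. Repeating the search inside the intervals stops in
-- `E`, in a basic interval or in some `E^S`, or never stops and gives a coding. In the last case
-- the dimension is at most `1/|s₁ • ⋯ • s_n|` for all `n`, hence zero.

notation:50 c:51 " ≤ₗ " d:51 => toLex c ≤ toLex d
notation:50 c:51 " <ₗ " d:51 => toLex c < toLex d

/-- The sequence `c` without its first `n` digits. -/
def shift (n : ℕ) (c : ℕ → ℕ) : ℕ → ℕ := fun i => c (i + n)

/-- The word `w` followed by the sequence `c`. -/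
def app (w : List ℕ) (c : ℕ → ℕ) : ℕ → ℕ := fun n =>
  if n < w.length then w.getD n 0 else c (n - w.length)

/-- The first `n` digits of `c`. -/
def initial (n : ℕ) (c : ℕ → ℕ) : List ℕ := List.ofFn fun i : Fin n => c i

/-- The first `n` digits of `c` and `d` agree. -/
def Agree (n : ℕ) (c d : ℕ → ℕ) : Prop := ∀ i < n, c i = d i

/-- The first `n` digits of `c` form a word smaller than that of `d`. -/
def LtTo (n : ℕ) (c d : ℕ → ℕ) : Prop := ∃ k < n, Agree k c d ∧ c k < d k

/-- The first `n` digits of `c` form a word at most that of `d`. -/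
def LeTo (n : ℕ) (c d : ℕ → ℕ) : Prop := LtTo n c d ∨ Agree n c d

/-- The sequence `w^∞`. -/
def per (w : List ℕ) : ℕ → ℕ := evPer [] w

/-- The sequences all of whose shifts lie between `c` and `d`. -/
def shiftsBetween (c d : ℕ → ℕ) : Set (ℕ → ℕ) := {z | ∀ n, c ≤ₗ shift n z ∧ shift n z ≤ₗ d}

/-- All digits are at most one. -/
def IsBin (c : ℕ → ℕ) : Prop := ∀ i, c i ≤ 1

/-- The digits of `c` are bounded. -/
def BddDigits (c : ℕ → ℕ) : Prop := ∃ M, ∀ i, c i ≤ M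

/-! ### Shifts, concatenation and periodic sequences -/

@[simp] lemma shift_apply (n : ℕ) (c : ℕ → ℕ) (i : ℕ) : shift n c i = c (i + n) := rfl

@[simp] lemma shift_zero (c : ℕ → ℕ) : shift 0 c = c := rfl

lemma shift_shift (a b : ℕ) (c : ℕ → ℕ) : shift a (shift b c) = shift (a + b) c := by
  funext i; simp only [shift_apply]; congr 1; omega

@[simp] lemma app_nil (c : ℕ → ℕ) : app [] c = c := by funext i; simp [app]

lemma app_apply_lt {w : List ℕ} {n : ℕ} (h : n < w.length) (c : ℕ → ℕ) :
    app w c n = w.getD n 0 := by simp [app, h]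

lemma app_apply_add (w : List ℕ) (c : ℕ → ℕ) (n : ℕ) : app w c (n + w.length) = c n := by
  simp [app]

@[simp] lemma app_cons_zero (a : ℕ) (w : List ℕ) (c : ℕ → ℕ) : app (a :: w) c 0 = a := by
  simp [app]

@[simp] lemma shift_one_app_cons (a : ℕ) (w : List ℕ) (c : ℕ → ℕ) :
    shift 1 (app (a :: w) c) = app w c := by
  funext i; simp [app]

lemma app_append (u v : List ℕ) (c : ℕ → ℕ) : app (u ++ v) c = app u (app v c) := by
  funext n
  simp only [app, List.length_append]
  by_cases h1 : n < u.length
  · simp [h1, show n < u.length + v.length by omega]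
  · by_cases h2 : n < u.length + v.length
    · rw [if_pos h2, if_neg h1, if_pos (by omega)]
      simp [List.getElem?_append_right (by omega : u.length ≤ n)]
    · rw [if_neg h2, if_neg h1, if_neg (by omega)]; congr 1; omega

lemma app_cons (a : ℕ) (w : List ℕ) (c : ℕ → ℕ) : app (a :: w) c = app [a] (app w c) :=
  app_append [a] w c

@[simp] lemma shift_app (w : List ℕ) (c : ℕ → ℕ) : shift w.length (app w c) = c := by
  funext i; simp [app_apply_add]

lemma shift_app_add (n : ℕ) (w : List ℕ) (c : ℕ → ℕ) :
    shift (n + w.length) (app w c) = shift n c := by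
  rw [← shift_shift, shift_app]

@[simp] lemma initial_length (n : ℕ) (c : ℕ → ℕ) : (initial n c).length = n := by simp [initial]

lemma app_initial (n : ℕ) (c : ℕ → ℕ) : app (initial n c) (shift n c) = c := by
  funext i
  by_cases h : i < n
  · rw [app_apply_lt (by simpa using h)]; simp [initial, h]
  · simp only [app, initial_length, if_neg h, shift_apply]; congr 1; omega

lemma cons_shift (c : ℕ → ℕ) : app [c 0] (shift 1 c) = c := app_initial 1 c

lemma eq_app_of_agree {w : List ℕ} {c d : ℕ → ℕ} (h : Agree w.length c (app w d)) :
    c = app w (shift w.length c) := by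
  funext i
  by_cases hi : i < w.length
  · rw [h i hi, app_apply_lt hi, app_apply_lt hi]
  · simp only [app, if_neg hi, shift_apply]; congr 1; omega

@[simp] lemma app_ne {w : List ℕ} {c d : ℕ → ℕ} : app w c = app w d ↔ c = d := by
  constructor
  · intro h; rw [← shift_app w c, h, shift_app]
  · rintro rfl; rfl

lemma per_apply (w : List ℕ) (n : ℕ) : per w n = w.getD (n % w.length) 0 := by
  simp [per, evPer]

lemma per_eq (w : List ℕ) : per w = app w (per w) := by
  funext n
  by_cases h : n < w.length
  · rw [app_apply_lt h, per_apply, Nat.mod_eq_of_lt h]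
  · simp only [app, if_neg h, per_apply]
    rw [Nat.mod_eq_sub_mod (by omega)]

lemma shift_per (w : List ℕ) : shift w.length (per w) = per w := by
  conv_lhs => rw [per_eq w, shift_app]

lemma shift_mul_per (w : List ℕ) (k : ℕ) : shift (k * w.length) (per w) = per w := by
  induction k with
  | zero => simp
  | succ k ih => rw [Nat.succ_mul, ← shift_shift, shift_per, ih]

lemma shift_mod_per (w : List ℕ) (n : ℕ) : shift n (per w) = shift (n % w.length) (per w) := by
  conv_lhs => rw [← Nat.mod_add_div n w.length, mul_comm, ← shift_shift, shift_mul_per]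

/-- Prepending a nonempty word has a single fixed point. Images of periodic sequences under the
substitutions are identified through this. -/
lemma eq_per {w : List ℕ} (hw : w ≠ []) {c : ℕ → ℕ} (h : c = app w c) : c = per w := by
  have hl : 0 < w.length := List.length_pos_iff.2 hw
  funext n
  induction n using Nat.strong_induction_on with
  | _ n ih =>
    rw [h, per_eq w]
    by_cases hn : n < w.length
    · rw [app_apply_lt hn, app_apply_lt hn]
    · simp only [app, if_neg hn]; exact ih _ (by omega)

lemma per_injective {u v : List ℕ} (hl : u.length = v.length) (h : per u = per v) : u = v := by
  apply List.ext_getElem hl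
  intro i h1 h2
  have := congrFun h i
  simpa [per_apply, Nat.mod_eq_of_lt h1, Nat.mod_eq_of_lt h2, h1, h2] using this

lemma evPer_eq (u v : List ℕ) : evPer u v = app u (per v) := by
  funext n; simp [evPer, app, per_apply]

@[simp] lemma per_singleton (a : ℕ) : per [a] = fun _ => a := by
  funext n; simp [per_apply, Nat.mod_one]

/-! #### Agreement -/

lemma Agree.symm {n : ℕ} {c d : ℕ → ℕ} (h : Agree n c d) : Agree n d c := fun i hi => (h i hi).symm

lemma Agree.trans {n : ℕ} {c d e : ℕ → ℕ} (h : Agree n c d) (h' : Agree n d e) : Agree n c e :=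
  fun i hi => (h i hi).trans (h' i hi)

lemma Agree.mono {n m : ℕ} {c d : ℕ → ℕ} (h : Agree n c d) (hm : m ≤ n) : Agree m c d :=
  fun i hi => h i (hi.trans_le hm)

lemma Agree.shift {n : ℕ} {c d : ℕ → ℕ} (h : Agree n c d) (m : ℕ) :
    Agree (n - m) (shift m c) (shift m d) := fun i hi => h _ (by omega)

lemma Agree.of_add {a b : ℕ} {c d : ℕ → ℕ} (h : Agree a c d)
    (h' : Agree b (BetaHole.shift a c) (BetaHole.shift a d)) : Agree (a + b) c d := by
  intro i hi
  by_cases hia : i < a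
  · exact h i hia
  · have := h' (i - a) (by omega)
    simpa [show i - a + a = i by omega] using this

lemma agree_app (w : List ℕ) (c d : ℕ → ℕ) : Agree w.length (app w c) (app w d) :=
  fun i hi => by rw [app_apply_lt hi, app_apply_lt hi]

lemma Agree.app {n : ℕ} {c d : ℕ → ℕ} (h : Agree n c d) (w : List ℕ) :
    Agree (w.length + n) (app w c) (app w d) :=
  Agree.of_add (agree_app w c d) (by simpa using h)

lemma eq_of_agree {c d : ℕ → ℕ} (h : ∀ n, Agree n c d) : c = d :=
  funext fun i => h (i + 1) i (Nat.lt_succ_self i)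

/-! #### The order -/

lemma lexlt_iff {c d : ℕ → ℕ} : c <ₗ d ↔ ∃ n, Agree n c d ∧ c n < d n := Iff.rfl

lemma LtTo.lt {n : ℕ} {c d : ℕ → ℕ} (h : LtTo n c d) : c <ₗ d :=
  let ⟨k, _, h1, h2⟩ := h; ⟨k, h1, h2⟩

lemma leTo_of_le {c d : ℕ → ℕ} (h : c ≤ₗ d) (n : ℕ) : LeTo n c d := by
  rcases h.lt_or_eq with h | h
  · obtain ⟨k, h1, h2⟩ := lexlt_iff.1 h
    by_cases hk : k < n
    · exact Or.inl ⟨k, hk, h1, h2⟩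
    · exact Or.inr (h1.mono (by omega))
  · rw [toLex_inj] at h; subst h; exact Or.inr fun _ _ => rfl

lemma LtTo.leTo {n : ℕ} {c d : ℕ → ℕ} (h : LtTo n c d) : LeTo n c d := Or.inl h

lemma Agree.leTo {n : ℕ} {c d : ℕ → ℕ} (h : Agree n c d) : LeTo n c d := Or.inr h

lemma LtTo.mono {n m : ℕ} {c d : ℕ → ℕ} (h : LtTo n c d) (hm : n ≤ m) : LtTo m c d :=
  let ⟨k, hk, h1⟩ := h; ⟨k, hk.trans_le hm, h1⟩

lemma LtTo.of_add {a b : ℕ} {c d : ℕ → ℕ} (h : Agree a c d) (h' : LtTo b (shift a c) (shift a d)) :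
    LtTo (a + b) c d := by
  obtain ⟨k, hk, h1, h2⟩ := h'
  exact ⟨a + k, by omega, h.of_add h1, by simpa [add_comm] using h2⟩

lemma LeTo.of_add {a b : ℕ} {c d : ℕ → ℕ} (h : LeTo a c d) (h' : LeTo b (shift a c) (shift a d)) :
    LeTo (a + b) c d := by
  rcases h with h | h
  · exact (h.mono (by omega)).leTo
  · rcases h' with h' | h'
    · exact (LtTo.of_add h h').leTo
    · exact (h.of_add h').leTo

/-- Comparison within a window ignores the tails. Blocks are therefore compared with `LtTo` and
`LeTo`, and whatever follows them may be exchanged. -/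
lemma LtTo.congr {n : ℕ} {c d c' d' : ℕ → ℕ} (h : LtTo n c d) (hc : Agree n c c')
    (hd : Agree n d d') : LtTo n c' d' := by
  obtain ⟨k, hk, h1, h2⟩ := h
  exact ⟨k, hk, ((hc.mono hk.le).symm.trans h1).trans (hd.mono hk.le),
    by rw [← hc k hk, ← hd k hk]; exact h2⟩

lemma LeTo.congr {n : ℕ} {c d c' d' : ℕ → ℕ} (h : LeTo n c d) (hc : Agree n c c')
    (hd : Agree n d d') : LeTo n c' d' := by
  rcases h with h | h
  · exact (h.congr hc hd).leTo
  · exact ((hc.symm.trans h).trans hd).leTo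

lemma LtTo.trans {n : ℕ} {c d e : ℕ → ℕ} (h : LtTo n c d) (h' : LtTo n d e) : LtTo n c e := by
  obtain ⟨k, hk, h1, h2⟩ := h
  obtain ⟨l, hl, h3, h4⟩ := h'
  rcases lt_trichotomy k l with hkl | rfl | hkl
  · exact ⟨k, hk, h1.trans (h3.mono hkl.le), by rw [← h3 k hkl]; exact h2⟩
  · exact ⟨k, hk, h1.trans h3, h2.trans h4⟩
  · exact ⟨l, hl, (h1.mono hkl.le).trans h3, by rw [h1 l hkl]; exact h4⟩

lemma LtTo.trans_le {n : ℕ} {c d e : ℕ → ℕ} (h : LtTo n c d) (h' : LeTo n d e) : LtTo n c e := by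
  rcases h' with h' | h'
  · exact h.trans h'
  · exact h.congr (fun _ _ => rfl) h'

lemma LeTo.trans_lt {n : ℕ} {c d e : ℕ → ℕ} (h : LeTo n c d) (h' : LtTo n d e) : LtTo n c e := by
  rcases h with h | h
  · exact h.trans h'
  · exact h'.congr h.symm (fun _ _ => rfl)

lemma LeTo.not_lt {n : ℕ} {c d : ℕ → ℕ} (h : LeTo n c d) : ¬ LtTo n d c := by
  rintro ⟨k, hk, h1, h2⟩
  rcases h with ⟨l, hl, h3, h4⟩ | h
  · rcases lt_trichotomy k l with hkl | rfl | hkl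
    · rw [h3 k hkl] at h2; exact lt_irrefl _ h2
    · exact lt_asymm h2 h4
    · rw [h1 l hkl] at h4; exact lt_irrefl _ h4
  · rw [h k hk] at h2; exact lt_irrefl _ h2

lemma ltTo_or_leTo (n : ℕ) (c d : ℕ → ℕ) : LtTo n c d ∨ LeTo n d c := by
  rcases lt_or_ge (toLex c) (toLex d) with h | h
  · rcases leTo_of_le h.le n with h | h
    · exact Or.inl h
    · exact Or.inr h.symm.leTo
  · exact Or.inr (leTo_of_le h n)

lemma le_of_leTo {c d : ℕ → ℕ} (h : ∀ n, LeTo n c d) : c ≤ₗ d := by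
  by_contra hn
  obtain ⟨k, h1, h2⟩ := lexlt_iff.1 (not_le.1 hn)
  exact (h (k + 1)).not_lt ⟨k, Nat.lt_succ_self k, h1, h2⟩

lemma lt_of_agree_of_lt {n : ℕ} {c d : ℕ → ℕ} (h : Agree n c d)
    (h' : shift n c <ₗ shift n d) : c <ₗ d := by
  obtain ⟨k, h1, h2⟩ := lexlt_iff.1 h'
  exact (LtTo.of_add h ⟨k, Nat.lt_succ_self k, h1, h2⟩).lt

lemma app_lt_app {w : List ℕ} {c d : ℕ → ℕ} : app w c <ₗ app w d ↔ c <ₗ d := by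
  have key : ∀ {c d : ℕ → ℕ}, c <ₗ d → app w c <ₗ app w d := fun {c d} h =>
    lt_of_agree_of_lt (agree_app w c d) (by simpa using h)
  refine ⟨fun h => ?_, key⟩
  by_contra hn
  rcases (not_lt.1 hn).lt_or_eq with h' | h'
  · exact lt_asymm h (key h')
  · rw [toLex_inj] at h'; subst h'; exact lt_irrefl _ h

lemma app_le_app {w : List ℕ} {c d : ℕ → ℕ} : app w c ≤ₗ app w d ↔ c ≤ₗ d :=
  not_lt.symm.trans ((not_congr app_lt_app).trans not_lt)

lemma lt_of_head_lt {c d : ℕ → ℕ} (h : c 0 < d 0) : c <ₗ d := ⟨0, fun _ h => by simp at h, h⟩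

lemma head_le_of_le {c d : ℕ → ℕ} (h : c ≤ₗ d) : c 0 ≤ d 0 := by
  by_contra hn; exact absurd (lt_of_head_lt (not_le.1 hn)) (not_lt.2 h)

lemma shift_one_le {c d : ℕ → ℕ} (h : c ≤ₗ d) (h0 : c 0 = d 0) : shift 1 c ≤ₗ shift 1 d := by
  rwa [← cons_shift c, ← cons_shift d, h0, app_le_app] at h

lemma shift_one_lt {c d : ℕ → ℕ} (h : c <ₗ d) (h0 : c 0 = d 0) : shift 1 c <ₗ shift 1 d := by
  rwa [← cons_shift c, ← cons_shift d, h0, app_lt_app] at h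

lemma zero_le_seq (c : ℕ → ℕ) : (fun _ => 0) ≤ₗ c := by
  by_contra hn
  obtain ⟨k, -, h2⟩ := lexlt_iff.1 (not_le.1 hn)
  exact absurd h2 (Nat.not_lt_zero _)

lemma le_const {c : ℕ → ℕ} {a : ℕ} (h : ∀ i, c i ≤ a) : c ≤ₗ (fun _ => a) := by
  by_contra hn
  obtain ⟨k, -, h2⟩ := lexlt_iff.1 (not_le.1 hn)
  exact absurd h2 (not_lt.2 (h k))

/-- Squeezing: a sequence between two sequences that agree to `n` digits agrees with them. -/
lemma agree_of_between {n : ℕ} {c x d : ℕ → ℕ} (h1 : c ≤ₗ x) (h2 : x ≤ₗ d) (h : Agree n c d) :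
    Agree n x c := by
  rcases leTo_of_le h1 n with h3 | h3
  · have := h3.trans_le (leTo_of_le h2 n)
    exact absurd this (h.symm.leTo.not_lt)
  · exact h3.symm

/-- A binary sequence does not decrease when a leading `0` is removed. -/
lemma zero_cons_le (x : ℕ → ℕ) : app [0] x ≤ₗ x := by
  by_contra hn
  obtain ⟨k, h1, h2⟩ := lexlt_iff.1 (not_le.1 hn)
  have hx : ∀ i ≤ k, x i = 0 := by
    intro i
    induction i with
    | zero =>
      intro hi
      rcases hi.lt_or_eq with h | h
      · simpa [app] using h1 0 h
      · subst h; simp [app] at h2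
    | succ i ih =>
      intro hi
      have h3 : app [0] x (i + 1) = 0 := by simpa [app] using ih (by omega)
      rcases hi.lt_or_eq with h | h
      · rw [h1 _ h, h3]
      · rw [← h, h3] at h2; exact absurd h2 (Nat.not_lt_zero _)
  have : app [0] x k = 0 := by
    cases k with
    | zero => simp
    | succ k => simpa [app] using hx k (by omega)
  omega

/-- If `ax < x` with first difference at `k`, the agreement before `k` propagates the digit `a` one
place at a time, so `ax` has the digit `a` at `k` and `x` a larger one, which is excluded. -/
lemma le_const_cons {x : ℕ → ℕ} {a : ℕ} (hx : ∀ i, x i ≤ a) : x ≤ₗ app [a] x := by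
  by_contra hn
  obtain ⟨k, h1, h2⟩ := lexlt_iff.1 (not_le.1 hn)
  have hk : ∀ i ≤ k, app [a] x i = a := by
    intro i
    induction i with
    | zero => simp
    | succ i ih =>
      intro hi
      have : x i = a := by rw [← h1 i (by omega)]; exact ih (by omega)
      simpa [app] using this
  have := hx k
  rw [hk k le_rfl] at h2
  omega

lemma shiftsBetween_shift {c d z : ℕ → ℕ} (h : z ∈ shiftsBetween c d) (n : ℕ) :
    shift n z ∈ shiftsBetween c d := fun k => by rw [shift_shift]; exact h _

lemma shiftsBetween_mono {c d c' d' : ℕ → ℕ} (hc : c' ≤ₗ c) (hd : d ≤ₗ d') :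
    shiftsBetween c d ⊆ shiftsBetween c' d' :=
  fun _ h n => ⟨hc.trans (h n).1, (h n).2.trans hd⟩

lemma IsBin.shift {c : ℕ → ℕ} (h : IsBin c) (n : ℕ) : IsBin (shift n c) := fun _ => h _

lemma shiftsBetween_digit_le {c d z : ℕ → ℕ} (h : z ∈ shiftsBetween c d) (n : ℕ) : z n ≤ d 0 := by
  simpa using head_le_of_le (h n).2

lemma shiftsBetween_le_digit {c d z : ℕ → ℕ} (h : z ∈ shiftsBetween c d) (n : ℕ) : c 0 ≤ z n := by
  simpa using head_le_of_le (h n).1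

end BetaHole

namespace BetaHole
open Set

/-! ### Values of digit sequences -/

lemma BddDigits.shift {c : ℕ → ℕ} (h : BddDigits c) (n : ℕ) : BddDigits (shift n c) :=
  let ⟨M, hM⟩ := h; ⟨M, fun _ => hM _⟩

lemma geom_summable {β : ℝ} (hβ : 1 < β) : Summable fun i : ℕ => 1 / β ^ (i + 1) := by
  have : Summable fun i : ℕ => (1 / β) * (1 / β) ^ i :=
    (summable_geometric_of_lt_one (by positivity) (by rw [div_lt_one] <;> linarith)).mul_left _
  refine this.congr fun i => ?_
  rw [← pow_succ', one_div_pow]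

lemma value_summable {β : ℝ} (hβ : 1 < β) {c : ℕ → ℕ} (hc : BddDigits c) :
    Summable fun i : ℕ => (c i : ℝ) / β ^ (i + 1) := by
  obtain ⟨M, hM⟩ := hc
  refine Summable.of_nonneg_of_le (fun i => by positivity) (fun i => ?_)
    ((geom_summable hβ).mul_left (M : ℝ))
  rw [mul_one_div]
  have : (c i : ℝ) ≤ M := by exact_mod_cast hM i
  gcongr

lemma value_nonneg {β : ℝ} (hβ : 1 < β) (c : ℕ → ℕ) : 0 ≤ value β c :=
  tsum_nonneg fun i => by positivity

lemma value_succ {β : ℝ} (hβ : 1 < β) {c : ℕ → ℕ} (hc : BddDigits c) :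
    β * value β c = c 0 + value β (shift 1 c) := by
  have h0 : β ≠ 0 := by positivity
  unfold value
  rw [(value_summable hβ hc).tsum_eq_zero_add, mul_add, ← tsum_mul_left]
  congr 1
  · rw [zero_add, pow_one]; field_simp
  · refine tsum_congr fun i => ?_
    simp only [shift_apply]
    field_simp
    ring

lemma value_mono {β : ℝ} (hβ : 1 < β) {c d : ℕ → ℕ} (hd : BddDigits d) (h : ∀ i, c i ≤ d i) :
    value β c ≤ value β d := by
  have hc : BddDigits c := let ⟨M, hM⟩ := hd; ⟨M, fun i => (h i).trans (hM i)⟩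
  refine (value_summable hβ hc).tsum_le_tsum (fun i => ?_) (value_summable hβ hd)
  have : (c i : ℝ) ≤ d i := by exact_mod_cast h i
  gcongr

lemma value_const {β : ℝ} (hβ : 1 < β) (M : ℕ) : value β (fun _ => M) = M / (β - 1) := by
  have := value_succ hβ (c := fun _ => M) ⟨M, fun _ => le_rfl⟩
  rw [show shift 1 (fun _ => M) = fun _ => M from rfl] at this
  rw [eq_div_iff (by linarith)]
  linarith

lemma value_le {β : ℝ} (hβ : 1 < β) {c : ℕ → ℕ} {M : ℕ} (h : ∀ i, c i ≤ M) :
    value β c ≤ M / (β - 1) :=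
  value_const hβ M ▸ value_mono hβ ⟨M, fun _ => le_rfl⟩ h

lemma value_pos {β : ℝ} (hβ : 1 < β) {c : ℕ → ℕ} (hc : BddDigits c) {k : ℕ} (hk : c k ≠ 0) :
    0 < value β c := by
  refine (value_summable hβ hc).tsum_pos (fun i => by positivity) k ?_
  have : (0 : ℝ) < c k := by exact_mod_cast Nat.pos_of_ne_zero hk
  positivity

/-- Sequences with a common initial segment. -/
lemma value_sub {β : ℝ} (hβ : 1 < β) {c d : ℕ → ℕ} (hc : BddDigits c) (hd : BddDigits d) {n : ℕ}
    (h : Agree n c d) :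
    β ^ n * (value β c - value β d) = value β (shift n c) - value β (shift n d) := by
  induction n with
  | zero => simp
  | succ n ih =>
    have h1 := value_succ hβ (hc.shift n)
    have h2 := value_succ hβ (hd.shift n)
    rw [shift_shift, add_comm 1 n] at h1 h2
    have h3 : (shift n c 0 : ℕ) = shift n d 0 := by simpa using h n (Nat.lt_succ_self n)
    rw [pow_succ, mul_right_comm, ih (h.mono (Nat.le_succ n)), sub_mul]
    rw [h3] at h1
    linarith

lemma value_sub_le {β : ℝ} (hβ : 1 < β) {c d : ℕ → ℕ} {M : ℕ} (hc : ∀ i, c i ≤ M)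
    (hd : ∀ i, d i ≤ M) {n : ℕ} (h : Agree n c d) :
    |value β c - value β d| ≤ M / (β - 1) / β ^ n := by
  have h1 := value_sub hβ ⟨M, hc⟩ ⟨M, hd⟩ h
  have h2 := value_le (c := shift n c) hβ fun i => hc _
  have h3 := value_le (c := shift n d) hβ fun i => hd _
  have h4 := value_nonneg hβ (shift n c)
  have h5 := value_nonneg hβ (shift n d)
  rw [le_div_iff₀' (by positivity), ← abs_of_pos (show 0 < β ^ n by positivity), ← abs_mul, h1,
    abs_le]
  constructor <;> linarith

/-- The difference of the values of two sequences whose first difference is at `k`. -/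
lemma value_sub_of_first {β : ℝ} (hβ : 1 < β) {c d : ℕ → ℕ} (hc : BddDigits c)
    (hd : BddDigits d) {k : ℕ} (h : Agree k c d) :
    β ^ (k + 1) * (value β d - value β c) =
      (d k : ℝ) - c k + value β (shift (k + 1) d) - value β (shift (k + 1) c) := by
  have h0 := value_sub hβ hd hc h.symm
  have h1 := value_succ hβ (hc.shift k)
  have h2 := value_succ hβ (hd.shift k)
  rw [shift_shift, add_comm 1 k] at h1 h2
  simp only [shift_apply, zero_add] at h1 h2
  rw [pow_succ, mul_right_comm, h0, sub_mul]
  linarith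

/-- At the first difference the larger sequence gains at least one unit, and the last hypothesis
says that the tails cannot make up for it. -/
lemma value_lt_of_lex {β : ℝ} (hβ : 1 < β) {c d : ℕ → ℕ} (hc : BddDigits c)
    (hd : BddDigits d) {k : ℕ} (h : Agree k c d) (hk : c k < d k)
    (h1 : value β (shift (k + 1) c) < 1 + value β (shift (k + 1) d)) : value β c < value β d := by
  have h0 := value_sub_of_first hβ hc hd h
  have h2 : (c k : ℝ) + 1 ≤ d k := by exact_mod_cast hk
  have h3 : 0 < β ^ (k + 1) * (value β d - value β c) := by rw [h0]; linarith
  have := (mul_pos_iff_of_pos_left (by positivity : 0 < β ^ (k + 1))).1 h3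
  linarith

lemma value_strictAnti {β β' : ℝ} (hβ : 1 < β) (h : β < β') {c : ℕ → ℕ} (hc : BddDigits c) {k : ℕ}
    (hk : c k ≠ 0) : value β' c < value β c := by
  refine (value_summable (hβ.trans h) hc).tsum_lt_tsum (i := k) (fun i => ?_) ?_
    (value_summable hβ hc)
  · gcongr
  · have : (0 : ℝ) < c k := by exact_mod_cast Nat.pos_of_ne_zero hk
    gcongr

/-! ### The quasi-greedy expansion of 1 -/

/-- The remainders of the quasi-greedy algorithm started at `1`. -/
noncomputable def remainder (β : ℝ) : ℕ → ℝ
  | 0 => 1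
  | n + 1 => β * remainder β n - (⌈β * remainder β n⌉₊ - 1 : ℕ)

/-- The quasi-greedy expansion of `1`. -/
noncomputable def alpha (β : ℝ) (n : ℕ) : ℕ := ⌈β * remainder β n⌉₊ - 1

lemma remainder_succ (β : ℝ) (n : ℕ) :
    remainder β (n + 1) = β * remainder β n - alpha β n := rfl

lemma remainder_mem {β : ℝ} (hβ : 1 < β) (n : ℕ) : remainder β n ∈ Ioc (0 : ℝ) 1 := by
  induction n with
  | zero => simp [remainder]
  | succ n ih =>
    have h1 : 0 < β * remainder β n := mul_pos (by linarith) ih.1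
    have h2 := Nat.ceil_pos.2 h1
    have h3 := Nat.ceil_lt_add_one h1.le
    have h4 := Nat.le_ceil (β * remainder β n)
    simp only [remainder, Nat.cast_sub (show 1 ≤ ⌈β * remainder β n⌉₊ from h2), Nat.cast_one,
      mem_Ioc]
    constructor <;> linarith

lemma alpha_lt {β : ℝ} (hβ : 1 < β) (n : ℕ) : alpha β n < ⌈β⌉₊ := by
  have h := remainder_mem hβ n
  have h1 : 0 < β * remainder β n := mul_pos (by linarith) h.1
  have h2 := Nat.ceil_pos.2 h1
  have h3 : ⌈β * remainder β n⌉₊ ≤ ⌈β⌉₊ := Nat.ceil_mono (by nlinarith [h.2])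
  unfold alpha; omega

lemma alpha_bdd {β : ℝ} (hβ : 1 < β) : BddDigits (alpha β) :=
  ⟨⌈β⌉₊, fun n => (alpha_lt hβ n).le⟩

/-- A bounded sequence of remainders determines the value. -/
lemma value_eq_of_rec {β : ℝ} (hβ : 1 < β) {c : ℕ → ℕ} (hc : BddDigits c) {r : ℕ → ℝ} {B : ℝ}
    (hB : ∀ n, |r n| ≤ B) (hr : ∀ n, r (n + 1) = β * r n - c n) (n : ℕ) :
    value β (shift n c) = r n := by
  obtain ⟨M, hM⟩ := hc
  have key : ∀ k, β ^ k * (value β (shift n c) - r n) = value β (shift (k + n) c) - r (k + n) := by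
    intro k
    induction k with
    | zero => simp
    | succ k ih =>
      have h1 := value_succ hβ (c := shift (k + n) c) ⟨M, fun _ => hM _⟩
      rw [shift_shift, show 1 + (k + n) = k + 1 + n by ring] at h1
      simp only [shift_apply, zero_add] at h1
      rw [show k + 1 + n = (k + n) + 1 by ring, hr, ← show k + 1 + n = (k + n) + 1 by ring,
        pow_succ, mul_right_comm, ih]
      linarith
  by_contra hne
  have hpos : 0 < |value β (shift n c) - r n| := abs_pos.2 (sub_ne_zero.2 hne)
  obtain ⟨k, hk⟩ := pow_unbounded_of_one_lt ((M / (β - 1) + B) / |value β (shift n c) - r n|) hβ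
  rw [div_lt_iff₀ hpos, ← abs_of_pos (show 0 < β ^ k by positivity), ← abs_mul, key] at hk
  have h2 := value_le (c := shift (k + n) c) hβ fun i => hM _
  have h4 := value_nonneg hβ (shift (k + n) c)
  have h5 := abs_sub (value β (shift (k + n) c)) (r (k + n))
  rw [abs_of_nonneg h4] at h5
  linarith [hB (k + n)]

lemma value_shift_alpha {β : ℝ} (hβ : 1 < β) (n : ℕ) :
    value β (shift n (alpha β)) = remainder β n :=
  value_eq_of_rec hβ (alpha_bdd hβ) (r := remainder β) (B := 1)
    (fun n => by
      have := remainder_mem hβ n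
      rw [abs_of_pos this.1]; exact this.2) (fun _ => rfl) n

lemma value_alpha {β : ℝ} (hβ : 1 < β) : value β (alpha β) = 1 := value_shift_alpha hβ 0

lemma value_shift_alpha_pos {β : ℝ} (hβ : 1 < β) (n : ℕ) : 0 < value β (shift n (alpha β)) := by
  rw [value_shift_alpha hβ]; exact (remainder_mem hβ n).1

lemma value_shift_alpha_le {β : ℝ} (hβ : 1 < β) (n : ℕ) : value β (shift n (alpha β)) ≤ 1 := by
  rw [value_shift_alpha hβ]; exact (remainder_mem hβ n).2

lemma value_zero (β : ℝ) : value β (fun _ => 0) = 0 := by simp [value]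

lemma exists_ne_of_value_pos {β : ℝ} {c : ℕ → ℕ} (h : 0 < value β c) : ∃ k, c k ≠ 0 := by
  by_contra hn
  push Not at hn
  have : c = fun _ => 0 := funext hn
  rw [this, value_zero] at h
  exact lt_irrefl _ h

lemma alpha_infinite {β : ℝ} (hβ : 1 < β) (N : ℕ) : ∃ n, N ≤ n ∧ alpha β n ≠ 0 := by
  obtain ⟨k, hk⟩ := exists_ne_of_value_pos (value_shift_alpha_pos hβ N)
  exact ⟨k + N, by omega, hk⟩

/-- A lexicographically larger competitor gains one unit at the first difference, while the tail of
`alpha` is worth at most one. Since the competitor does not end in zeros, its own tail is positive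
and its value exceeds `1`. -/
lemma alpha_isQuasiGreedy {β : ℝ} (hβ : 1 < β) : IsQuasiGreedy β 1 (alpha β) := by
  refine ⟨⟨alpha_lt hβ, alpha_infinite hβ, value_alpha hβ⟩, fun d hd => ?_⟩
  by_contra hn
  obtain ⟨k, h1, h2⟩ := lexlt_iff.1 (not_le.1 hn)
  have hdb : BddDigits d := ⟨⌈β⌉₊, fun n => (hd.1 n).le⟩
  obtain ⟨j, hj, hj'⟩ := hd.2.1 (k + 1)
  have hpos : 0 < value β (shift (k + 1) d) :=
    value_pos hβ (hdb.shift _) (k := j - (k + 1)) (by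
      simpa [show j - (k + 1) + (k + 1) = j by omega] using hj')
  have := value_lt_of_lex hβ (alpha_bdd hβ) hdb h1 h2
    (by linarith [value_shift_alpha_le hβ (k + 1)])
  rw [value_alpha hβ, hd.2.2] at this
  exact lt_irrefl _ this

lemma isQuasiGreedy_iff {β : ℝ} (hβ : 1 < β) {c : ℕ → ℕ} :
    IsQuasiGreedy β 1 c ↔ c = alpha β := by
  refine ⟨fun h => ?_, fun h => h ▸ alpha_isQuasiGreedy hβ⟩
  have := le_antisymm ((alpha_isQuasiGreedy hβ).2 c h.1) (h.2 _ (alpha_isQuasiGreedy hβ).1)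
  simpa using this

lemma shift_alpha_le {β : ℝ} (hβ : 1 < β) (n : ℕ) : shift n (alpha β) ≤ₗ alpha β := by
  by_contra hn
  obtain ⟨k, h1, h2⟩ := lexlt_iff.1 (not_le.1 hn)
  have := value_lt_of_lex hβ (alpha_bdd hβ) ((alpha_bdd hβ).shift n) h1 h2 (by
    rw [shift_shift]
    linarith [value_shift_alpha_le hβ (k + 1), value_shift_alpha_pos hβ (k + 1 + n)])
  rw [value_alpha hβ] at this
  linarith [value_shift_alpha_le hβ n]

lemma one_le_alpha_zero {β : ℝ} (hβ : 1 < β) : 1 ≤ alpha β 0 := by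
  have : 1 < ⌈β⌉₊ := Nat.lt_ceil.2 (by simpa using hβ)
  simp only [alpha, remainder, mul_one]; omega

/-- A sequence whose shifts are at most `α` has value at most one. -/
lemma value_le_one {β : ℝ} (hβ : 1 < β) {a z : ℕ → ℕ} (ha : BddDigits a)
    (hv : value β a ≤ 1) (h : ∀ n, shift n z ≤ₗ a) : value β z ≤ 1 := by
  have hz : ∀ i, z i ≤ a 0 := fun i => by simpa using head_le_of_le (h i)
  have hbz : ∀ n, BddDigits (shift n z) := fun n => ⟨a 0, fun _ => hz _⟩
  by_contra hlt
  push Not at hlt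
  -- If the supremum `V` of the values of all shifts exceeded `1`, comparison with `a` at the first
  -- difference would bound every one of these values, hence `V`, by `1 + (V - 1)/β < V`.
  set V := ⨆ n, value β (shift n z) with hV
  have hbdd : BddAbove (range fun n => value β (shift n z)) :=
    ⟨a 0 / (β - 1), by rintro _ ⟨n, rfl⟩; exact value_le hβ fun _ => hz _⟩
  have hle : ∀ n, value β (shift n z) ≤ V := fun n => le_ciSup hbdd n
  have hV1 : 1 < V := hlt.trans_le (hle 0)
  have key : ∀ n, value β (shift n z) ≤ 1 + (V - 1) / β := by
    intro n
    have hq : 0 ≤ (V - 1) / β := div_nonneg (by linarith) (by linarith)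
    rcases (h n).lt_or_eq with h' | h'
    · obtain ⟨k, h1, h2⟩ := lexlt_iff.1 h'
      have h3 := value_sub_of_first hβ (hbz n) ha h1
      have h4 : (shift n z k : ℝ) + 1 ≤ a k := by exact_mod_cast h2
      have h5 := value_nonneg hβ (shift (k + 1) a)
      rw [shift_shift] at h3
      have h6 : 1 - V ≤ β ^ (k + 1) * (value β a - value β (shift n z)) := by
        linarith [hle (k + 1 + n)]
      rw [← sub_le_iff_le_add', le_div_iff₀ (by linarith)]
      by_contra h7
      push Not at h7
      have hβk : β ≤ β ^ (k + 1) := by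
        rw [pow_succ]; nlinarith [one_le_pow₀ (n := k) hβ.le]
      have h8 : 0 < value β (shift n z) - 1 := by nlinarith
      nlinarith [mul_le_mul_of_nonneg_right hβk h8.le, show 0 < β ^ (k+1) by positivity]
    · rw [toLex_inj] at h'
      rw [h']; linarith
  have h9 : V ≤ 1 + (V - 1) / β := ciSup_le key
  have : (V - 1) / β < V - 1 := div_lt_self (by linarith) hβ
  linarith

lemma value_le_one_of_le_alpha {β : ℝ} (hβ : 1 < β) {z : ℕ → ℕ}
    (h : ∀ n, shift n z ≤ₗ alpha β) (n : ℕ) : value β (shift n z) ≤ 1 :=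
  value_le_one hβ (alpha_bdd hβ) (value_alpha hβ).le fun k => by rw [shift_shift]; exact h _

lemma bdd_of_shift_le {z a : ℕ → ℕ} (h : ∀ n, shift n z ≤ₗ a) (i : ℕ) : z i ≤ a 0 := by
  simpa using head_le_of_le (h i)

/-- Sequences whose shifts are at most `f < α` have values bounded away from one. -/
lemma exists_gap {β : ℝ} (hβ : 1 < β) {f : ℕ → ℕ} (hf : f <ₗ alpha β) :
    ∃ δ > 0, ∀ z : ℕ → ℕ, (∀ n, shift n z ≤ₗ f) → ∀ n, value β (shift n z) ≤ 1 - δ := by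
  obtain ⟨k, hk1, hk2⟩ := lexlt_iff.1 hf
  -- A sequence with shifts at most `f` falls below `α` at some `j ≤ k`, and then loses at least the
  -- tail of `α` after `j`, scaled by `β^{-(j+1)}`. These are finitely many positive numbers, so
  -- they have a positive lower bound.
  have hex : ∃ δ > 0, ∀ j ≤ k, δ ≤ value β (shift (j + 1) (alpha β)) / β ^ (j + 1) := by
    clear hk1 hk2
    induction k with
    | zero =>
      refine ⟨_, ?_, fun j hj => by rw [Nat.le_zero.1 hj]⟩
      have := value_shift_alpha_pos hβ (0 + 1)
      positivity
    | succ k ih =>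
      obtain ⟨δ, h1, h2⟩ := ih
      refine ⟨min δ (value β (shift (k + 1 + 1) (alpha β)) / β ^ (k + 1 + 1)), ?_, ?_⟩
      · have := value_shift_alpha_pos hβ (k + 1 + 1)
        positivity
      · intro j hj
        rcases hj.lt_or_eq with h | h
        · exact (min_le_left _ _).trans (h2 j (by omega))
        · rw [h]; exact min_le_right _ _
  obtain ⟨δ, hδ, hd⟩ := hex
  refine ⟨δ, hδ, ?_⟩
  suffices ∀ z : ℕ → ℕ, (∀ n, shift n z ≤ₗ f) → value β z ≤ 1 - δ from
    fun z hz n => this _ fun m => by rw [shift_shift]; exact hz _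
  intro z hz
  have hza : LtTo (k + 1) z (alpha β) :=
    (leTo_of_le (hz 0) _).trans_lt ⟨k, Nat.lt_succ_self k, hk1, hk2⟩
  obtain ⟨j, hj, h1, h2⟩ := hza
  have hzb : BddDigits z := ⟨f 0, bdd_of_shift_le hz⟩
  have h3 := value_sub_of_first hβ hzb (alpha_bdd hβ) h1
  have h4 : (z j : ℝ) + 1 ≤ alpha β j := by exact_mod_cast h2
  have h5 := value_le_one_of_le_alpha hβ (fun n => (hz n).trans hf.le) (j + 1)
  rw [value_alpha hβ] at h3
  have h6 := hd j (by omega)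
  rw [div_eq_inv_mul] at h6
  have hp : 0 < β ^ (j + 1) := by positivity
  have h7 : value β (shift (j + 1) (alpha β)) ≤ β ^ (j + 1) * (1 - value β z) := by
    rw [h3]; linarith
  rw [← div_eq_inv_mul] at h6
  rw [← div_le_iff₀' hp] at h7
  linarith

lemma value_lt_one {β : ℝ} (hβ : 1 < β) {z : ℕ → ℕ} (h : ∀ n, shift n z ≤ₗ alpha β)
    (h0 : z <ₗ alpha β) : value β z < 1 := by
  obtain ⟨k, h1, h2⟩ := lexlt_iff.1 h0
  have := value_lt_of_lex hβ ⟨_, bdd_of_shift_le h⟩ (alpha_bdd hβ) h1 h2 (by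
    linarith [value_le_one_of_le_alpha hβ h (k + 1), value_shift_alpha_pos hβ (k + 1)])
  rwa [value_alpha hβ] at this

/-! ### Admissible sequences and bases -/

/-- The sequences that are quasi-greedy expansions of `1` in some base. -/
structure Admissible (c : ℕ → ℕ) : Prop where
  shift_le : ∀ n, shift n c ≤ₗ c
  inf : ∀ N, ∃ n, N ≤ n ∧ c n ≠ 0

lemma Admissible.bdd {c : ℕ → ℕ} (h : Admissible c) : BddDigits c :=
  ⟨c 0, bdd_of_shift_le h.shift_le⟩

lemma Admissible.head_ne {c : ℕ → ℕ} (h : Admissible c) : c 0 ≠ 0 := by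
  obtain ⟨n, -, hn⟩ := h.inf 0
  have := bdd_of_shift_le h.shift_le n
  omega

/-- All shifts have value in `(0,1]`. This leaves one choice for each digit, `⌈βr⌉ - 1` with `r` the
current remainder, so the sequence follows the quasi-greedy algorithm. -/
lemma Admissible.eq_alpha {c : ℕ → ℕ} (h : Admissible c) {β : ℝ} (hβ : 1 < β)
    (hv : value β c = 1) : c = alpha β := by
  have hle : ∀ n, value β (shift n c) ≤ 1 := fun n =>
    value_le_one hβ h.bdd hv.le fun k => by rw [shift_shift]; exact h.shift_le _
  have hpos : ∀ n, 0 < value β (shift n c) := fun n => by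
    obtain ⟨j, hj, hj'⟩ := h.inf n
    exact value_pos hβ (h.bdd.shift n) (k := j - n) (by simpa [show j - n + n = j by omega] using hj')
  have hs : ∀ n, β * value β (shift n c) = c n + value β (shift (n + 1) c) := fun n => by
    have h2 := value_succ hβ (h.bdd.shift n)
    rw [shift_shift, add_comm 1 n] at h2
    simpa using h2
  have step : ∀ n, value β (shift n c) = remainder β n → c n = alpha β n := by
    intro n h1
    have h2 := hs n
    rw [h1] at h2
    have h3 : ⌈β * remainder β n⌉₊ = c n + 1 := by
      rw [Nat.ceil_eq_iff (by omega)]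
      have := hle (n + 1); have := hpos (n + 1)
      push_cast [Nat.add_sub_cancel]
      constructor <;> linarith
    unfold alpha; omega
  have hr : ∀ n, value β (shift n c) = remainder β n := by
    intro n
    induction n with
    | zero => simpa [remainder] using hv
    | succ n ih => rw [remainder_succ, ← ih, ← step n ih, hs n]; ring
  exact funext fun n => step n (hr n)

/-- Otherwise all shifts of `α(β')` are at most `α(β)`, so its value in base `β` is at most `1`. But
that value is larger than the one in the larger base `β'`, which is `1`. -/
lemma alpha_lt_alpha {β β' : ℝ} (hβ : 1 < β) (h : β < β') : alpha β <ₗ alpha β' := by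
  by_contra hn
  have h1 := value_le_one_of_le_alpha hβ
    (fun n => (shift_alpha_le (hβ.trans h) n).trans (not_lt.1 hn)) 0
  obtain ⟨k, -, hk⟩ := alpha_infinite (hβ.trans h) 0
  have h2 := value_strictAnti hβ h (alpha_bdd (hβ.trans h)) hk
  rw [value_alpha (hβ.trans h)] at h2
  simp only [shift_zero] at h1
  linarith

lemma alpha_le_alpha_iff {β β' : ℝ} (hβ : 1 < β) (hβ' : 1 < β') :
    alpha β ≤ₗ alpha β' ↔ β ≤ β' := by
  constructor
  · intro h
    by_contra hn
    exact absurd (alpha_lt_alpha hβ' (not_le.1 hn)) (not_lt.2 h)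
  · intro h
    rcases h.lt_or_eq with h | rfl
    · exact (alpha_lt_alpha hβ h).le
    · exact le_rfl

lemma continuousOn_value {c : ℕ → ℕ} (hc : BddDigits c) {b : ℝ} (hb : 1 < b) :
    ContinuousOn (fun β => value β c) (Ici b) := by
  obtain ⟨M, hM⟩ := hc
  refine continuousOn_tsum (u := fun i : ℕ => (M : ℝ) * (1 / b ^ (i + 1))) (fun i => ?_)
    ((geom_summable hb).mul_left _) (fun i x hx => ?_)
  · refine continuousOn_const.div (continuousOn_pow _) fun x hx => ?_
    have : 0 < x := by linarith [mem_Ici.1 hx]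
    positivity
  · have hx' : b ≤ x := hx
    have h1 : (c i : ℝ) ≤ M := by exact_mod_cast hM i
    have h0 : 0 < x := by linarith
    rw [Real.norm_of_nonneg (by positivity), mul_one_div]
    gcongr

/-- Intermediate value theorem. Two nonzero digits contribute at least `1/b + 1/b^(k+1)`, which is
near `2` for `b` near `1`, while for `b ≥ M + 1` the geometric series bounds the value by `1`. -/
lemma Admissible.exists_base {c : ℕ → ℕ} (h : Admissible c) : ∃ β, 1 < β ∧ value β c = 1 := by
  obtain ⟨k, hk1, hk⟩ := h.inf 1
  have h0 := h.head_ne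
  obtain ⟨b, hb1, hb⟩ : ∃ b : ℝ, 1 < b ∧ 1 ≤ 1 / b + 1 / b ^ (k + 1) := by
    have hc : ContinuousAt (fun b : ℝ => 1 / b + 1 / b ^ (k + 1)) 1 := by
      refine ContinuousAt.add ?_ ?_
      · exact continuousAt_const.div continuousAt_id one_ne_zero
      · exact continuousAt_const.div (continuousAt_id.pow _) (by simp)
    have h2 : ∀ᶠ b in nhds (1 : ℝ), 1 < 1 / b + 1 / b ^ (k + 1) :=
      hc.eventually (lt_mem_nhds (by norm_num))
    have h3 := (h2.filter_mono nhdsWithin_le_nhds).and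
      (self_mem_nhdsWithin : Ioi (1 : ℝ) ∈ nhdsWithin 1 (Ioi 1))
    obtain ⟨b, hb, hb'⟩ := h3.exists
    exact ⟨b, hb', hb.le⟩
  have hlow : 1 ≤ value b c := by
    refine hb.trans ?_
    have h3 := (value_summable hb1 h.bdd).sum_le_tsum {0, k} (fun i _ => by positivity)
    rw [Finset.sum_pair (by omega)] at h3
    refine le_trans ?_ h3
    have h4 : (1 : ℝ) ≤ c 0 := by exact_mod_cast Nat.one_le_iff_ne_zero.2 h0
    have h5 : (1 : ℝ) ≤ c k := by exact_mod_cast Nat.one_le_iff_ne_zero.2 hk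
    rw [zero_add, pow_one]
    gcongr
  obtain ⟨M, hM⟩ := h.bdd
  set b' : ℝ := max b (M + 1) with hb'
  have hbb' : b ≤ b' := le_max_left _ _
  have hhigh : value b' c ≤ 1 := by
    have h1 : 1 < b' := hb1.trans_le hbb'
    refine (value_le h1 hM).trans ?_
    rw [div_le_one (by linarith)]
    linarith [le_max_right b ((M : ℝ) + 1)]
  obtain ⟨x, hx, hx'⟩ := intermediate_value_Icc' hbb'
    ((continuousOn_value h.bdd hb1).mono Icc_subset_Ici_self) ⟨hhigh, hlow⟩
  exact ⟨x, hb1.trans_le hx.1, hx'⟩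

lemma Admissible.baseOf_spec {c : ℕ → ℕ} (h : Admissible c) :
    1 < baseOf c ∧ alpha (baseOf c) = c := by
  obtain ⟨β, hβ, hv⟩ := h.exists_base
  have h0 := h.head_ne
  have : {β | 1 < β ∧ value β c = 1} = {β} := by
    ext x
    constructor
    · rintro ⟨hx, hxv⟩
      rcases lt_trichotomy x β with h' | h' | h'
      · have := value_strictAnti hx h' h.bdd h0
        linarith
      · exact h'
      · have := value_strictAnti hβ h' h.bdd h0
        linarith
    · rintro rfl; exact ⟨hβ, hv⟩
  have hb : baseOf c = β := by rw [baseOf, this, csInf_singleton]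
  rw [hb]
  exact ⟨hβ, (h.eq_alpha hβ hv).symm⟩

/-- With its dual below, this turns membership in intervals of bases into lexicographic conditions
on `α(β)`, the only form in which the intervals are used later. -/
lemma Admissible.baseOf_le_iff {c : ℕ → ℕ} (h : Admissible c) {β : ℝ} (hβ : 1 < β) :
    baseOf c ≤ β ↔ c ≤ₗ alpha β := by
  rw [← alpha_le_alpha_iff h.baseOf_spec.1 hβ, h.baseOf_spec.2]

lemma Admissible.le_baseOf_iff {c : ℕ → ℕ} (h : Admissible c) {β : ℝ} (hβ : 1 < β) :
    β ≤ baseOf c ↔ alpha β ≤ₗ c := by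
  rw [← alpha_le_alpha_iff hβ h.baseOf_spec.1, h.baseOf_spec.2]

/-! ### Greedy digits and the survivor set -/

/-- The greedy digits of `x`. -/
noncomputable def digits (β x : ℝ) (n : ℕ) : ℕ := ⌊β * (betaMap β)^[n] x⌋₊

lemma betaMap_iterate_mem {β x : ℝ} (hx : x ∈ Ico (0 : ℝ) 1) (n : ℕ) :
    (betaMap β)^[n] x ∈ Ico (0 : ℝ) 1 := by
  cases n with
  | zero => exact hx
  | succ n =>
    rw [Function.iterate_succ_apply']
    exact ⟨Int.fract_nonneg _, Int.fract_lt_one _⟩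

lemma betaMap_iterate_succ {β x : ℝ} (hβ : 1 < β) (hx : x ∈ Ico (0 : ℝ) 1) (n : ℕ) :
    (betaMap β)^[n + 1] x = β * (betaMap β)^[n] x - digits β x n := by
  rw [Function.iterate_succ_apply']
  have h := betaMap_iterate_mem (β := β) hx n
  have h0 : 0 ≤ β * (betaMap β)^[n] x := mul_nonneg (by linarith) h.1
  have : ((⌊β * (betaMap β)^[n] x⌋₊ : ℕ) : ℝ) = ((⌊β * (betaMap β)^[n] x⌋ : ℤ) : ℝ) := by
    rw [← Int.natCast_floor_eq_floor h0]; simp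
  rw [digits, this]
  rfl

lemma digits_bdd {β x : ℝ} (hβ : 1 < β) (hx : x ∈ Ico (0 : ℝ) 1) (n : ℕ) :
    digits β x n ≤ ⌊β⌋₊ := by
  have h := betaMap_iterate_mem (β := β) hx n
  exact Nat.floor_mono (by nlinarith [h.2])

lemma value_shift_digits {β x : ℝ} (hβ : 1 < β) (hx : x ∈ Ico (0 : ℝ) 1) (n : ℕ) :
    value β (shift n (digits β x)) = (betaMap β)^[n] x :=
  value_eq_of_rec hβ ⟨_, digits_bdd hβ hx⟩ (r := fun n => (betaMap β)^[n] x) (B := 1)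
    (fun n => by
      have := betaMap_iterate_mem (β := β) hx n
      rw [abs_of_nonneg this.1]; exact this.2.le) (fun n => betaMap_iterate_succ hβ hx n) n

/-- A sequence all of whose shifts have value less than one is lexicographically at least every
sequence with at most the same value. -/
lemma le_of_value_le {β : ℝ} (hβ : 1 < β) {z c : ℕ → ℕ} (hz : BddDigits z) (hc : BddDigits c)
    (h : ∀ n, value β (shift n z) < 1) (hv : value β c ≤ value β z) : c ≤ₗ z := by
  by_contra hn
  obtain ⟨k, h1, h2⟩ := lexlt_iff.1 (not_le.1 hn)
  have := value_lt_of_lex hβ hz hc h1 h2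
    (by linarith [h (k + 1), value_nonneg hβ (shift (k + 1) c)])
  linarith

lemma lt_alpha_of_value_lt {β : ℝ} (hβ : 1 < β) {z : ℕ → ℕ} (hz : BddDigits z)
    (hv : value β z < 1) : z <ₗ alpha β := by
  by_contra hn
  rcases (not_lt.1 hn).lt_or_eq with h | h
  · obtain ⟨k, h1, h2⟩ := lexlt_iff.1 h
    have h3 := value_sub_of_first hβ (alpha_bdd hβ) hz h1
    have h4 : (alpha β k : ℝ) + 1 ≤ z k := by exact_mod_cast h2
    have h5 := value_shift_alpha_le hβ (k + 1)
    have h6 := value_nonneg hβ (shift (k + 1) z)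
    rw [value_alpha hβ] at h3
    have h7 : β ^ (k + 1) * (value β z - 1) < 0 :=
      mul_neg_of_pos_of_neg (by positivity) (by linarith)
    linarith
  · rw [toLex_inj] at h
    rw [← h, value_alpha hβ] at hv
    exact lt_irrefl _ hv

lemma betaMap_iterate_value {β : ℝ} (hβ : 1 < β) {z : ℕ → ℕ} (hz : BddDigits z)
    (h : ∀ n, value β (shift n z) < 1) (n : ℕ) :
    (betaMap β)^[n] (value β z) = value β (shift n z) := by
  induction n with
  | zero => rfl
  | succ n ih =>
    have h2 := value_succ hβ (hz.shift n)
    rw [shift_shift, add_comm 1 n] at h2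
    rw [Function.iterate_succ_apply', ih, betaMap, h2, Int.fract_eq_iff]
    refine ⟨value_nonneg hβ _, h _, (z n : ℤ), by simp⟩

/-- The survivor set consists of values of sequences between `c` and the expansion of one. -/
lemma survivorSet_subset {β : ℝ} (hβ : 1 < β) {c d : ℕ → ℕ} (hc : BddDigits c)
    (hd : alpha β ≤ₗ d) : survivorSet β (value β c) ⊆ value β '' shiftsBetween c d := by
  rintro x ⟨hx, hxt⟩
  have hb : BddDigits (digits β x) := ⟨_, digits_bdd hβ hx⟩
  have hlt : ∀ n, value β (shift n (digits β x)) < 1 := fun n => by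
    rw [value_shift_digits hβ hx]; exact (betaMap_iterate_mem hx n).2
  refine ⟨digits β x, fun n => ⟨?_, ?_⟩, value_shift_digits hβ hx 0⟩
  · refine le_of_value_le hβ (hb.shift n) hc (fun m => ?_) ?_
    · rw [shift_shift]; exact hlt _
    · rw [value_shift_digits hβ hx]; exact hxt n
  · exact (lt_alpha_of_value_lt hβ (hb.shift n) (hlt n)).le.trans hd

/-- If the shifts of `c` have value at most one, a sequence which starts with a word at least as
large as an initial word of `c` has value at least that of `c`, up to an error. -/
lemma exists_agree_value_le {β t : ℝ} (hβ : 1 < β) {c : ℕ → ℕ} (hc : BddDigits c)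
    (h : ∀ n, value β (shift n c) ≤ 1) (ht : t < value β c) :
    ∃ N, ∀ e z : ℕ → ℕ, Agree N e c → e ≤ₗ z → BddDigits z → t ≤ value β z := by
  -- A common prefix of length `N` limits the loss of value to `β^{-N}`, and `N` is chosen to make
  -- this smaller than `(c)_β - t`.
  obtain ⟨N, hN⟩ := pow_unbounded_of_one_lt (1 / (value β c - t)) hβ
  refine ⟨N, fun e z he hez hz => ?_⟩
  have hle : LeTo N c z := (leTo_of_le hez N).congr he (fun _ _ => rfl)
  rcases hle with ⟨k, hk, h1, h2⟩ | hag
  · have h3 := value_sub_of_first hβ hc hz h1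
    have h4 : (c k : ℝ) + 1 ≤ z k := by exact_mod_cast h2
    have h5 : 0 ≤ β ^ (k + 1) * (value β z - value β c) := by
      rw [h3]; linarith [h (k + 1), value_nonneg hβ (shift (k + 1) z)]
    have := (mul_nonneg_iff_of_pos_left (by positivity : 0 < β ^ (k + 1))).1 h5
    linarith
  · have h3 := value_sub hβ hc hz hag
    have h4 : β ^ N * (value β c - value β z) ≤ 1 := by
      rw [h3]; linarith [h N, value_nonneg hβ (shift N z)]
    rw [div_lt_iff₀ (by linarith)] at hN
    by_contra hlt
    push Not at hlt
    have : β ^ N * (value β c - t) < β ^ N * (value β c - value β z) :=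
      mul_lt_mul_of_pos_left (by linarith) (by positivity)
    linarith

end BetaHole

namespace BetaHole
open Set MeasureTheory Filter
open scoped ENNReal NNReal

/-! ### Hausdorff dimension of sets of digit sequences -/

attribute [local instance] PiNat.metricSpaceNatNat

lemma edist_le_of_agree {c d : ℕ → ℕ} {n : ℕ} (h : Agree n c d) : edist c d ≤ (2⁻¹ : ℝ≥0∞) ^ n := by
  have h1 : dist c d ≤ (1 / 2) ^ n :=
    (PiNat.mem_cylinder_iff_dist_le (E := fun _ => ℕ)).1 (fun i hi => h i hi)
  rw [edist_dist, ENNReal.ofReal_le_iff_le_toReal (by finiteness)]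
  simpa using h1

lemma exists_first_diff {c d : ℕ → ℕ} (h : c ≠ d) :
    ∃ n, Agree n c d ∧ c n ≠ d n ∧ edist c d = (2⁻¹ : ℝ≥0∞) ^ n := by
  refine ⟨PiNat.firstDiff c d, fun i hi => PiNat.apply_eq_of_lt_firstDiff (E := fun _ => ℕ) hi,
    PiNat.apply_firstDiff_ne (E := fun _ => ℕ) h, ?_⟩
  have h3 : edist c d = ENNReal.ofReal ((1 / 2) ^ PiNat.firstDiff c d) := by
    rw [edist_dist]; congr 1; exact PiNat.dist_eq_of_ne (E := fun _ => ℕ) h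
  rw [h3, ENNReal.ofReal_pow (by norm_num), one_div, ENNReal.ofReal_inv_of_pos (by norm_num)]
  simp

/-- The Hausdorff dimension of a set of sequences, for the metric in which two sequences are at
distance `2^{-n}` if their first difference is at position `n`. -/
noncomputable def seqDim (X : Set (ℕ → ℕ)) : ℝ≥0∞ := dimH X

lemma seqDim_mono {X Y : Set (ℕ → ℕ)} (h : X ⊆ Y) : seqDim X ≤ seqDim Y := dimH_mono h

lemma seqDim_union (X Y : Set (ℕ → ℕ)) : seqDim (X ∪ Y) = max (seqDim X) (seqDim Y) :=
  dimH_union X Y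

lemma seqDim_iUnion {ι : Type*} [Countable ι] (X : ι → Set (ℕ → ℕ)) :
    seqDim (⋃ i, X i) = ⨆ i, seqDim (X i) := dimH_iUnion X

/-- In the metric `2^{-n}`, turning `n` common digits into `mn` is being Hölder with exponent `m`,
which divides the dimension by `m`. -/
lemma seqDim_image_le {f : (ℕ → ℕ) → ℕ → ℕ} {X : Set (ℕ → ℕ)} {m : ℕ} (hm : 0 < m)
    (h : ∀ c ∈ X, ∀ d ∈ X, ∀ n, Agree n c d → Agree (m * n) (f c) (f d)) :
    seqDim (f '' X) ≤ seqDim X / m := by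
  have hh : HolderOnWith 1 m f X := by
    intro c hc d hd
    by_cases hcd : c = d
    · subst hcd; simp
    obtain ⟨n, hn, -, he⟩ := exists_first_diff hcd
    rw [he, NNReal.coe_natCast, ENNReal.rpow_natCast, ← pow_mul, mul_comm n m, ENNReal.coe_one,
      one_mul]
    exact edist_le_of_agree (h c hc d hd n hn)
  simpa [seqDim] using hh.dimH_image_le (by exact_mod_cast hm)

/-- The hypothesis makes `f` injective on `X` with a Hölder inverse, so a zero-dimensional image
would force `X` to have dimension zero. -/
lemma dimH_image_pos {E : Type*} [EMetricSpace E] {f : (ℕ → ℕ) → E} {X : Set (ℕ → ℕ)} {C r : ℝ≥0}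
    (hr : 0 < r) (h : ∀ c ∈ X, ∀ d ∈ X, edist c d ≤ C * edist (f c) (f d) ^ (r : ℝ))
    (hX : 0 < seqDim X) : 0 < dimH (f '' X) := by
  classical
  have hinj : InjOn f X := fun c hc d hd hcd => by
    have := h c hc d hd
    rw [hcd, edist_self, ENNReal.zero_rpow_of_pos (by exact_mod_cast hr), mul_zero] at this
    exact edist_le_zero.1 this
  have hg : HolderOnWith C r (Function.invFunOn f X) (f '' X) := by
    rintro _ ⟨c, hc, rfl⟩ _ ⟨d, hd, rfl⟩
    rw [hinj.leftInvOn_invFunOn hc, hinj.leftInvOn_invFunOn hd]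
    exact h c hc d hd
  have h1 := hg.dimH_image_le hr
  rw [hinj.leftInvOn_invFunOn.image_image] at h1
  by_contra h0
  rw [not_lt, nonpos_iff_eq_zero] at h0
  rw [h0, ENNReal.zero_div] at h1
  exact absurd (lt_of_lt_of_le hX h1) (lt_irrefl _)

lemma seqDim_image_pos {f : (ℕ → ℕ) → ℕ → ℕ} {X : Set (ℕ → ℕ)} {m : ℕ} (hm : 0 < m)
    (h : ∀ c ∈ X, ∀ d ∈ X, ∀ n, Agree (m * n) (f c) (f d) → Agree n c d)
    (hX : 0 < seqDim X) : 0 < seqDim (f '' X) := by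
  have hm0 : (m : ℝ) ≠ 0 := by exact_mod_cast hm.ne'
  -- Sequences that first differ at `n` are only known to have images differing before `m(n+1)`. The
  -- constant `2` pays for passing from `2^{-n}` to `2^{-(n+1)}`.
  refine dimH_image_pos (C := 2) (r := (m : ℝ≥0)⁻¹) (by positivity) (fun c hc d hd => ?_) hX
  by_cases hcd : c = d
  · subst hcd; simp
  obtain ⟨n, -, hn', he⟩ := exists_first_diff hcd
  have hne : f c ≠ f d := fun h0 => hn' (h c hc d hd (n + 1) (fun i _ => by rw [h0]) n n.lt_succ_self)
  obtain ⟨k, hk, -, he'⟩ := exists_first_diff hne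
  have hkn : k < m * (n + 1) := by
    by_contra hlt
    exact hn' (h c hc d hd (n + 1) (hk.mono (not_lt.1 hlt)) n n.lt_succ_self)
  rw [he, he']
  calc (2⁻¹ : ℝ≥0∞) ^ n = 2 * (2⁻¹ : ℝ≥0∞) ^ (n + 1) := by
        rw [pow_succ, mul_comm _ (2⁻¹ : ℝ≥0∞), ← mul_assoc, ENNReal.mul_inv_cancel (by simp) (by simp), one_mul]
    _ = 2 * ((2⁻¹ : ℝ≥0∞) ^ (m * (n + 1))) ^ ((m : ℝ)⁻¹) := by
        rw [mul_comm m, pow_mul, ← ENNReal.rpow_natCast (_ ^ (n + 1)) m, ENNReal.rpow_rpow_inv hm0]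
    _ ≤ 2 * ((2⁻¹ : ℝ≥0∞) ^ k) ^ ((m : ℝ)⁻¹) := by
        refine mul_le_mul_right (ENNReal.rpow_le_rpow ?_ (by positivity)) _
        exact pow_le_pow_right_of_le_one' (show (2⁻¹ : ℝ≥0∞) ≤ 1 by simp) hkn.le
    _ = _ := by simp

/-- The exponent relating the metric on sequences to values in base `β`. -/
noncomputable def logTwo (β : ℝ) : ℝ≥0 := (Real.log β / Real.log 2).toNNReal

lemma logTwo_pos {β : ℝ} (hβ : 1 < β) : 0 < logTwo β := by
  have h1 := Real.log_pos hβ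
  have h2 := Real.log_pos one_lt_two
  exact Real.toNNReal_pos.2 (by positivity)

lemma two_pow_rpow_logTwo {β : ℝ} (hβ : 1 < β) (n : ℕ) :
    ((2⁻¹ : ℝ≥0∞) ^ n) ^ (logTwo β : ℝ) = ENNReal.ofReal (1 / β ^ n) := by
  have h1 := Real.log_pos hβ
  have h2 := Real.log_pos one_lt_two
  have h3 : (2 : ℝ) ^ (Real.log β / Real.log 2) = β := by
    rw [Real.rpow_def_of_pos (by norm_num), mul_div_cancel₀ _ h2.ne', Real.exp_log (by linarith)]
  have h4 : (2 : ℝ≥0∞) ^ (logTwo β : ℝ) = ENNReal.ofReal β := by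
    rw [logTwo, Real.coe_toNNReal _ (by positivity),
      show (2 : ℝ≥0∞) = ENNReal.ofReal 2 by simp, ENNReal.ofReal_rpow_of_pos (by norm_num), h3]
  rw [← ENNReal.rpow_natCast, ← ENNReal.rpow_mul, mul_comm, ENNReal.rpow_mul, ENNReal.inv_rpow, h4,
    ENNReal.rpow_natCast, ← ENNReal.ofReal_inv_of_pos (by linarith),
    ← ENNReal.ofReal_pow (by positivity), one_div, inv_pow]

lemma dimH_value_image_le {β : ℝ} (hβ : 1 < β) {M : ℕ} {X : Set (ℕ → ℕ)}
    (hX : ∀ c ∈ X, ∀ i, c i ≤ M) : dimH (value β '' X) ≤ seqDim X / logTwo β := by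
  have hh : HolderOnWith (M / (β - 1)).toNNReal (logTwo β) (value β) X := by
    intro c hc d hd
    by_cases hcd : c = d
    · subst hcd; simp
    obtain ⟨n, hn, -, he⟩ := exists_first_diff hcd
    rw [he, two_pow_rpow_logTwo hβ, edist_dist, Real.dist_eq,
      show ((M / (β - 1)).toNNReal : ℝ≥0∞) = ENNReal.ofReal (M / (β - 1)) from rfl,
      ← ENNReal.ofReal_mul (div_nonneg (by positivity) (by linarith))]
    refine ENNReal.ofReal_le_ofReal ?_
    rw [mul_one_div]
    exact value_sub_le hβ (hX c hc) (hX d hd) hn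
  exact hh.dimH_image_le (logTwo_pos hβ)

/-- The gap `δ` keeps cylinders apart: sequences that first differ at `k` have values at least
`δ/β^(k+1)` apart. So the inverse of `value β` is Hölder with exponent `1 / logTwo β`. -/
lemma dimH_value_image_pos {β δ : ℝ} (hβ : 1 < β) (hδ : 0 < δ) {X : Set (ℕ → ℕ)}
    (hX : ∀ c ∈ X, BddDigits c ∧ ∀ n, value β (shift n c) ≤ 1 - δ) (hpos : 0 < seqDim X) :
    0 < dimH (value β '' X) := by
  have hr := logTwo_pos hβ
  have key : ∀ c ∈ X, ∀ d ∈ X, ∀ k, Agree k c d → c k < d k →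
      δ / β * (1 / β ^ k) ≤ |value β c - value β d| := by
    intro c hc d hd k hk hlt
    have h3 := value_sub_of_first hβ (hX c hc).1 (hX d hd).1 hk
    have h4 : (c k : ℝ) + 1 ≤ d k := by exact_mod_cast hlt
    have h5 := (hX c hc).2 (k + 1)
    have h6 := value_nonneg hβ (shift (k + 1) d)
    have h7 : δ ≤ β ^ (k + 1) * (value β d - value β c) := by linarith
    rw [abs_sub_comm]
    refine le_trans ?_ (le_abs_self _)
    rw [div_mul_div_comm, mul_one, ← pow_succ', div_le_iff₀' (by positivity)]
    exact h7
  refine dimH_image_pos (C := (β / δ).toNNReal ^ ((logTwo β)⁻¹ : ℝ)) (r := (logTwo β)⁻¹)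
    (by positivity) (fun c hc d hd => ?_) hpos
  by_cases hcd : c = d
  · subst hcd; simp
  obtain ⟨k, hk, hne, he⟩ := exists_first_diff hcd
  have h1 : δ / β * (1 / β ^ k) ≤ |value β c - value β d| := by
    rcases lt_or_gt_of_ne hne with h | h
    · exact key c hc d hd k hk h
    · rw [abs_sub_comm]; exact key d hd c hc k hk.symm h
  have hr0 : (logTwo β : ℝ) ≠ 0 := by exact_mod_cast hr.ne'
  rw [he, ENNReal.coe_rpow_of_nonneg _ (by positivity), NNReal.coe_inv,
    ← ENNReal.mul_rpow_of_nonneg _ _ (by positivity), ENNReal.le_rpow_inv_iff (by positivity),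
    two_pow_rpow_logTwo hβ, edist_dist, Real.dist_eq,
    show ((β / δ).toNNReal : ℝ≥0∞) = ENNReal.ofReal (β / δ) from rfl,
    ← ENNReal.ofReal_mul (by positivity)]
  refine ENNReal.ofReal_le_ofReal ?_
  calc 1 / β ^ k = β / δ * (δ / β * (1 / β ^ k)) := by field_simp
    _ ≤ _ := by gcongr

/-! #### Counting words -/

/-- The words of length `n` that begin a sequence in `X`. -/
def initials (X : Set (ℕ → ℕ)) (n : ℕ) : Set (List ℕ) := initial n '' X

lemma initial_eq_iff {n : ℕ} {c d : ℕ → ℕ} : initial n c = initial n d ↔ Agree n c d := by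
  simp only [initial, List.ofFn_inj, funext_iff, Agree, Fin.forall_iff]

/-- The cylinders of the words of length `n` cover `X` and have diameter at most `2^{-n}`; the
uniform bound keeps the `d`-dimensional Hausdorff measure finite. -/
lemma seqDim_le_of_count {X : Set (ℕ → ℕ)} {d : ℝ≥0} {B : ℝ≥0} (hfin : ∀ n, (initials X n).Finite)
    (h : ∀ n, ((initials X n).ncard : ℝ≥0∞) * ((2⁻¹ : ℝ≥0∞) ^ n) ^ (d : ℝ) ≤ B) :
    seqDim X ≤ d := by
  borelize (ℕ → ℕ)
  refine dimH_le_of_hausdorffMeasure_ne_top ?_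
  have : ∀ n, Fintype (initials X n) := fun n => (hfin n).fintype
  have hle := Measure.hausdorffMeasure_le_liminf_sum (ι := fun n => initials X n) (d : ℝ) X (l := atTop)
    (fun n : ℕ => (2⁻¹ : ℝ≥0∞) ^ n)
    (ENNReal.tendsto_pow_atTop_nhds_zero_of_lt_one (by simp))
    (fun n w => {c | initial n c = w})
    (Eventually.of_forall fun n w => Metric.ediam_le fun c hc e he =>
      edist_le_of_agree (initial_eq_iff.1 (hc.trans he.symm)))
    (Eventually.of_forall fun n c hc => mem_iUnion.2 ⟨⟨initial n c, c, hc, rfl⟩, rfl⟩)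
  refine ne_top_of_le_ne_top (b := (B : ℝ≥0∞)) ENNReal.coe_ne_top (hle.trans ?_)
  refine liminf_le_of_frequently_le' (Frequently.of_forall fun n => ?_)
  refine le_trans ?_ (h n)
  calc ∑ w : initials X n, Metric.ediam {c | initial n c = (w : List ℕ)} ^ (d : ℝ)
      ≤ ∑ _w : initials X n, ((2⁻¹ : ℝ≥0∞) ^ n) ^ (d : ℝ) := by
        gcongr with w
        exact Metric.ediam_le fun c hc e he =>
          edist_le_of_agree (initial_eq_iff.1 (hc.trans he.symm))
    _ = _ := by
        rw [Finset.sum_const, nsmul_eq_mul, Finset.card_univ, ← Nat.card_eq_fintype_card]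
        rfl

lemma seqDim_bin_le : seqDim {c | IsBin c} ≤ 1 := by
  have hcard : ∀ n, (initials {c | IsBin c} n).Finite ∧ (initials {c | IsBin c} n).ncard ≤ 2 ^ n := by
    intro n
    have hsub : initials {c | IsBin c} n ⊆
        (fun f : Fin n → Bool => List.ofFn fun i => (f i).toNat) '' univ := by
      rintro _ ⟨c, hc, rfl⟩
      refine ⟨fun i => decide (c i = 1), mem_univ _, ?_⟩
      refine congrArg List.ofFn (funext fun i => ?_)
      have := hc i
      interval_cases h : c i <;> simp [h]
    have hf : ((fun f : Fin n → Bool => List.ofFn fun i => (f i).toNat) '' univ).Finite :=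
      finite_univ.image _
    refine ⟨hf.subset hsub, (ncard_le_ncard hsub hf).trans ((ncard_image_le finite_univ).trans ?_)⟩
    simp [ncard_univ]
  refine seqDim_le_of_count (d := 1) (B := 1) (fun n => (hcard n).1) fun n => ?_
  have h1 : ((initials {c | IsBin c} n).ncard : ℝ≥0∞) ≤ 2 ^ n := by exact_mod_cast (hcard n).2
  calc _ ≤ (2 : ℝ≥0∞) ^ n * ((2⁻¹ : ℝ≥0∞) ^ n) ^ ((1 : ℝ≥0) : ℝ) := by gcongr
    _ = 1 := by
      rw [NNReal.coe_one, ENNReal.rpow_one, ← mul_pow, ENNReal.mul_inv_cancel (by simp) (by simp),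
        one_pow]
    _ ≤ _ := by simp

/-- A system in which every word has at most one predecessor, except that one word of each length
may have two, has dimension zero. -/
lemma seqDim_injective_type (a : ℕ) (y : ℕ → ℕ) :
    seqDim (shiftsBetween (app [a] y) (app [a + 1] y)) = 0 := by
  classical
  set X := shiftsBetween (app [a] y) (app [a + 1] y) with hX
  have hdig : ∀ z ∈ X, ∀ n, z n = a ∨ z n = a + 1 := fun z hz n => by
    have h1 := shiftsBetween_digit_le hz n
    have h2 := shiftsBetween_le_digit hz n
    simp at h1 h2; omega
  have hcard : ∀ n, (initials X n).Finite ∧ (initials X n).ncard ≤ n + 1 := by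
    intro n
    induction n with
    | zero =>
      have hsub : initials X 0 ⊆ {[]} := by rintro _ ⟨c, -, rfl⟩; simp [initial]
      exact ⟨(finite_singleton _).subset hsub,
        (ncard_le_ncard hsub (finite_singleton _)).trans (by simp)⟩
    | succ n ih =>
      -- A chosen left extension of each word. The prefix of `y` may have two: `g` takes the one by
      -- `a + 1`, and the one by `a` is inserted separately, which accounts for one new word per
      -- length.
      set g : List ℕ → List ℕ := fun w =>
        if w = initial n y then (a + 1) :: w else
          if ∃ z ∈ X, z 0 = a ∧ initial n (shift 1 z) = w then a :: w else (a + 1) :: w with hg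
      have hsucc : ∀ z : ℕ → ℕ, initial (n + 1) z = z 0 :: initial n (shift 1 z) := fun z => by
        simp [initial, List.ofFn_succ]
      have hsub : initials X (n + 1) ⊆ insert (a :: initial n y) (g '' initials X n) := by
        rintro _ ⟨z, hz, rfl⟩
        rw [hsucc]
        by_cases hy : initial n (shift 1 z) = initial n y
        · rcases hdig z hz 0 with h0 | h0
          · left; rw [h0, hy]
          · right
            refine ⟨initial n (shift 1 z), ⟨_, shiftsBetween_shift hz 1, rfl⟩, ?_⟩
            simp only [hg]
            rw [if_pos hy, h0]
        · right
          refine ⟨initial n (shift 1 z), ⟨_, shiftsBetween_shift hz 1, rfl⟩, ?_⟩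
          simp only [hg]
          rw [if_neg hy]
          rcases hdig z hz 0 with h0 | h0
          · rw [if_pos ⟨z, hz, h0, rfl⟩, h0]
          · rw [if_neg, h0]
            -- A word preceded by `a` is at least the prefix of `y`, a word preceded by `a + 1` is
            -- at most that prefix. Both together force equality.
            rintro ⟨z', hz', h1, h2⟩
            have h3 : y ≤ₗ shift 1 z' := by
              have := shift_one_le (hz' 0).1 (by simp [h1])
              simpa using this
            have h4 : shift 1 z ≤ₗ y := by
              have := shift_one_le (hz 0).2 (by simp [h0])
              simpa using this
            have h5 := (leTo_of_le h3 n).congr (fun _ _ => rfl) (initial_eq_iff.1 h2)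
            rcases leTo_of_le h4 n with h6 | h6
            · exact h5.not_lt h6
            · exact hy (initial_eq_iff.2 h6)
      have hf := (ih.1.image g).insert (a :: initial n y)
      refine ⟨hf.subset hsub, (ncard_le_ncard hsub hf).trans ((ncard_insert_le _ _).trans ?_)⟩
      have := ncard_image_le (f := g) ih.1
      omega
  refine le_antisymm (ENNReal.le_of_forall_pos_le_add fun ε hε _ => ?_) bot_le
  rw [zero_add]
  -- Linear growth of the number of words is beaten by every exponent `ε > 0`, since `(n + 1) q^n`
  -- is bounded for `q = 2^{-ε} < 1`.
  set q : ℝ := (2 : ℝ)⁻¹ ^ (ε : ℝ) with hq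
  have hε' : (0 : ℝ) < ε := hε
  have hq0 : 0 < q := by positivity
  have hq1 : q < 1 := Real.rpow_lt_one (by norm_num) (by norm_num) hε'
  have hlim : Tendsto (fun n : ℕ => ((n : ℝ) + 1) * q ^ n) atTop (nhds 0) := by
    have h1 := tendsto_self_mul_const_pow_of_lt_one hq0.le hq1
    have h2 := tendsto_pow_atTop_nhds_zero_of_lt_one hq0.le hq1
    simpa [add_mul] using h1.add h2
  obtain ⟨B, hB⟩ := hlim.bddAbove_range
  refine seqDim_le_of_count (B := B.toNNReal) (fun n => (hcard n).1) fun n => ?_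
  have h1 : ((initials X n).ncard : ℝ≥0∞) ≤ ENNReal.ofReal (n + 1) := by
    rw [show ((n : ℝ) + 1) = ((n + 1 : ℕ) : ℝ) by push_cast; rfl, ENNReal.ofReal_natCast]
    exact_mod_cast (hcard n).2
  have h2 : ((2⁻¹ : ℝ≥0∞) ^ n) ^ (ε : ℝ) = ENNReal.ofReal (q ^ n) := by
    rw [← ENNReal.rpow_natCast, ← ENNReal.rpow_mul, mul_comm, ENNReal.rpow_mul,
      ENNReal.rpow_natCast, show (2⁻¹ : ℝ≥0∞) = ENNReal.ofReal 2⁻¹ by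
        rw [ENNReal.ofReal_inv_of_pos (by norm_num)]; simp,
      ENNReal.ofReal_rpow_of_pos (by norm_num), ← ENNReal.ofReal_pow hq0.le]
  rw [h2]
  calc _ ≤ ENNReal.ofReal (n + 1) * ENNReal.ofReal (q ^ n) := by gcongr
    _ = ENNReal.ofReal ((n + 1) * q ^ n) := by rw [ENNReal.ofReal_mul (by positivity)]
    _ ≤ _ := ENNReal.ofReal_le_ofReal (hB ⟨n, rfl⟩)

/-- Binary expansions represent all of `[0,1)`, which has dimension one, and taking values in base
`2` is Hölder. -/
lemma seqDim_bin_pos : 0 < seqDim {c | IsBin c} := by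
  have h1 := dimH_value_image_le (β := 2) one_lt_two (M := 1) (X := {c | IsBin c}) fun c hc => hc
  have h2 : Ico (0 : ℝ) 1 ⊆ value 2 '' {c | IsBin c} := by
    intro x hx
    refine ⟨digits 2 x, fun n => ?_, value_shift_digits one_lt_two hx 0⟩
    have h := betaMap_iterate_mem (β := 2) hx n
    have : digits 2 x n < 2 := (Nat.floor_lt (by linarith [h.1])).2 (by push_cast; linarith [h.2])
    omega
  have h3 : dimH (Ico (0 : ℝ) 1) = 1 := by
    rw [Real.dimH_of_nonempty_interior (by simp)]; simp
  have h4 := (dimH_mono h2).trans h1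
  rw [h3] at h4
  by_contra h0
  rw [not_lt, nonpos_iff_eq_zero] at h0
  rw [h0, ENNReal.zero_div] at h4
  exact absurd h4 (by simp)

end BetaHole

namespace BetaHole
open Set

/-! ### Maximal rotations and Lyndon words -/

lemma lt_of_agree_shift {n : ℕ} {c d : ℕ → ℕ} (h : Agree n c d) (hlt : c <ₗ d) :
    shift n c <ₗ shift n d := by
  have h1 : initial n c = initial n d := initial_eq_iff.2 h
  rw [← app_initial n c, ← app_initial n d, h1] at hlt
  exact app_lt_app.1 hlt

lemma per_rotate (w : List ℕ) (k : ℕ) : per (w.rotate k) = shift k (per w) := by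
  by_cases hw : w = []
  · subst hw; funext n; simp [per_apply]
  have hl : 0 < w.length := List.length_pos_iff.2 hw
  funext n
  have h1 : n % w.length < w.length := Nat.mod_lt _ hl
  have h2 : (n + k) % w.length < w.length := Nat.mod_lt _ hl
  rw [shift_apply, per_apply, per_apply, List.length_rotate, List.getD_eq_getElem _ _ (by simpa),
    List.getD_eq_getElem _ _ h2, List.getElem_rotate]
  simp

lemma per_lt_of_lt {u v : List ℕ} (hl : u.length = v.length) (h : u < v) : per u <ₗ per v := by
  rcases List.lt_iff_exists.1 h with h | ⟨i, h1, h2, h3, h4⟩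
  · omega
  · refine ⟨i, fun j hj => ?_, ?_⟩
    · have := h3 j hj
      have ha : j < u.length := by omega
      have hb : j < v.length := by omega
      simpa [per_apply, Nat.mod_eq_of_lt ha, Nat.mod_eq_of_lt hb, ha, hb] using this
    · simpa [per_apply, Nat.mod_eq_of_lt h1, Nat.mod_eq_of_lt h2, h1, h2] using h4

lemma foldr_max_mem {l : List (List ℕ)} : l ≠ [] → l.foldr max [] ∈ l := by
  induction l with
  | nil => intro h; exact absurd rfl h
  | cons a l ih =>
    intro _
    rw [List.foldr_cons]
    by_cases hl : l = []
    · subst hl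
      rw [List.foldr_nil, max_eq_left (not_lt.1 (by simp))]
      exact List.mem_cons_self
    · rcases max_choice a (l.foldr max []) with h | h
      · rw [h]; exact List.mem_cons_self
      · rw [h]; exact List.mem_cons_of_mem _ (ih hl)

lemma le_foldr_max {l : List (List ℕ)} {a : List ℕ} (h : a ∈ l) : a ≤ l.foldr max [] := by
  induction l with
  | nil => simp at h
  | cons b l ih =>
    rw [List.foldr_cons]
    rcases List.mem_cons.1 h with rfl | h
    · exact le_max_left _ _
    · exact (ih h).trans (le_max_right _ _)

lemma maxRot_isRotated (w : List ℕ) : maxRot w ~r w :=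
  List.mem_cyclicPermutations_iff.1 (foldr_max_mem (by simp))

lemma maxRot_length (w : List ℕ) : (maxRot w).length = w.length :=
  (maxRot_isRotated w).perm.length_eq

lemma exists_per_maxRot (w : List ℕ) : ∃ k, per (maxRot w) = shift k (per w) := by
  obtain ⟨k, hk⟩ := (maxRot_isRotated w).symm
  exact ⟨k, by rw [← hk, per_rotate]⟩

lemma shift_per_le_maxRot (w : List ℕ) (k : ℕ) : shift k (per w) ≤ₗ per (maxRot w) := by
  rw [← per_rotate]
  by_contra hn
  have h1 : w.rotate k ≤ maxRot w := le_foldr_max (List.mem_cyclicPermutations_iff.2 (List.IsRotated.symm ⟨k, rfl⟩))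
  have hl : (w.rotate k).length = (maxRot w).length := by rw [maxRot_length, List.length_rotate]
  rcases h1.lt_or_eq with h | h
  · exact hn (per_lt_of_lt hl h).le
  · rw [h] at hn; exact hn le_rfl

lemma maxRot_ne {w : List ℕ} (hw : w ≠ []) : maxRot w ≠ [] := by
  rw [← List.length_pos_iff, maxRot_length]; exact List.length_pos_iff.2 hw

/-- The maximal rotation is characterised by its periodic sequence. -/
lemma eq_maxRot {w v : List ℕ} (hl : v.length = w.length)
    (h1 : ∃ k, per v = shift k (per w)) (h2 : ∀ k, shift k (per w) ≤ₗ per v) : maxRot w = v := by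
  refine per_injective (by rw [maxRot_length, hl]) ?_
  obtain ⟨k, hk⟩ := h1
  obtain ⟨l, hl'⟩ := exists_per_maxRot w
  have h3 := h2 l
  have h4 := shift_per_le_maxRot w k
  rw [← hl'] at h3
  rw [← hk] at h4
  simpa using le_antisymm h3 h4

lemma plus_length {w : List ℕ} (hw : w ≠ []) : (plus w).length = w.length := by
  have : 0 < w.length := List.length_pos_iff.2 hw
  simp [plus]; omega

lemma minus_length {w : List ℕ} (hw : w ≠ []) : (minus w).length = w.length := by
  have : 0 < w.length := List.length_pos_iff.2 hw
  simp [minus]; omega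

lemma agree_app_per (w : List ℕ) (c : ℕ → ℕ) : Agree w.length (app w c) (per w) := by
  conv => arg 3; rw [per_eq w]
  exact agree_app w c _

lemma dropLast_append {w : List ℕ} (hw : w ≠ []) : w.dropLast ++ [w.getLastD 0] = w := by
  rw [List.getLastD_eq_getLast?, List.getLast?_eq_some_getLast hw, Option.getD_some]
  exact List.dropLast_append_getLast hw

lemma app_concat (u : List ℕ) (a : ℕ) (c : ℕ → ℕ) : app (u ++ [a]) c u.length = a := by
  rw [app_apply_lt (by simp)]; simp

lemma agree_concat (u : List ℕ) (a b : ℕ) (c d : ℕ → ℕ) :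
    Agree u.length (app (u ++ [a]) c) (app (u ++ [b]) d) := by
  rw [app_append, app_append]; exact agree_app _ _ _

lemma per_last {w : List ℕ} (hw : w ≠ []) : per w (w.length - 1) = w.getLastD 0 := by
  have h := app_concat w.dropLast (w.getLastD 0) (per w)
  rw [dropLast_append hw, ← per_eq, List.length_dropLast] at h
  exact h

lemma plus_agree {w : List ℕ} (hw : w ≠ []) (c : ℕ → ℕ) :
    Agree (w.length - 1) (app (plus w) c) (per w) := by
  have h := agree_concat w.dropLast (w.getLastD 0 + 1) (w.getLastD 0) c (per w)
  rwa [dropLast_append hw, ← per_eq, List.length_dropLast] at h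

lemma minus_agree {w : List ℕ} (hw : w ≠ []) (c : ℕ → ℕ) :
    Agree (w.length - 1) (app (minus w) c) (per w) := by
  have h := agree_concat w.dropLast (w.getLastD 0 - 1) (w.getLastD 0) c (per w)
  rwa [dropLast_append hw, ← per_eq, List.length_dropLast] at h

lemma plus_last {w : List ℕ} (hw : w ≠ []) (c : ℕ → ℕ) :
    app (plus w) c (w.length - 1) = per w (w.length - 1) + 1 := by
  rw [per_last hw, ← List.length_dropLast]; exact app_concat _ _ _

lemma minus_last {w : List ℕ} (hw : w ≠ []) (c : ℕ → ℕ) :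
    app (minus w) c (w.length - 1) = per w (w.length - 1) - 1 := by
  rw [per_last hw, ← List.length_dropLast]; exact app_concat _ _ _

/-- Words that are strictly smaller than their proper rotations and do not end in `0`. -/
structure IsLyndon (S : List ℕ) : Prop where
  ne : S ≠ []
  min : ∀ i, 0 < i → i < S.length → per S <ₗ shift i (per S)
  last : per S (S.length - 1) ≠ 0

lemma IsLyndon.length_pos {S : List ℕ} (hS : IsLyndon S) : 0 < S.length :=
  List.length_pos_iff.2 hS.ne

lemma IsLyndon.maxRot_ne {S : List ℕ} (hS : IsLyndon S) : maxRot S ≠ [] :=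
  BetaHole.maxRot_ne hS.ne

lemma IsLyndon.min_le {S : List ℕ} (hS : IsLyndon S) (i : ℕ) : per S ≤ₗ shift i (per S) := by
  rw [shift_mod_per]
  rcases Nat.eq_zero_or_pos (i % S.length) with h | h
  · rw [h, shift_zero]
  · exact (hS.min _ h (Nat.mod_lt _ hS.length_pos)).le

lemma shift_maxRot_le (S : List ℕ) (i : ℕ) : shift i (per (maxRot S)) ≤ₗ per (maxRot S) := by
  obtain ⟨k, hk⟩ := exists_per_maxRot S
  have := shift_per_le_maxRot S (i + k)
  rwa [← shift_shift, ← hk] at this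

lemma IsLyndon.le_shift_maxRot {S : List ℕ} (hS : IsLyndon S) (i : ℕ) :
    per S ≤ₗ shift i (per (maxRot S)) := by
  obtain ⟨k, hk⟩ := exists_per_maxRot S
  rw [hk, shift_shift]; exact hS.min_le _

lemma IsLyndon.le_maxRot {S : List ℕ} (hS : IsLyndon S) : per S ≤ₗ per (maxRot S) :=
  hS.le_shift_maxRot 0

/-- Equality would give the maximal rotation, and with it `S^∞`, the period `i < |S|`, contradicting
the strict minimality of a Lyndon word. -/
lemma IsLyndon.shift_maxRot_lt {S : List ℕ} (hS : IsLyndon S) {i : ℕ} (hi : 0 < i)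
    (him : i < S.length) : shift i (per (maxRot S)) <ₗ per (maxRot S) := by
  refine lt_of_le_of_ne (shift_maxRot_le S i) fun h => ?_
  rw [toLex_inj] at h
  obtain ⟨k, hk⟩ := exists_per_maxRot S
  have hr : shift (k * S.length - k) (per (maxRot S)) = per S := by
    have := Nat.le_mul_of_pos_right k hS.length_pos
    rw [hk, shift_shift, show k * S.length - k + k = k * S.length by omega, shift_mul_per]
  have h1 : shift i (per S) = per S := by
    rw [← hr, shift_shift, add_comm, ← shift_shift, h]
  have := hS.min i hi him
  rw [h1] at this
  exact lt_irrefl _ this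

/-- Suffixes of a Lyndon word exceed the prefixes of the same length. -/
lemma IsLyndon.ltTo_suffix {S : List ℕ} (hS : IsLyndon S) {j : ℕ} (hj : 0 < j)
    (hjm : j < S.length) : LtTo (S.length - j) (per S) (shift j (per S)) := by
  rcases leTo_of_le (hS.min_le j) (S.length - j) with h | h
  · exact h
  · have h1 := lt_of_agree_shift h (hS.min j hj hjm)
    rw [shift_shift, show S.length - j + j = S.length by omega, shift_per] at h1
    exact absurd h1 (not_lt.2 (hS.min_le _))

/-- If a suffix equalled the prefix of the same length, cancelling it would place `𝕃(S)^∞` strictly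
below one of its own shifts. -/
lemma IsLyndon.maxRot_suffix_ltTo {S : List ℕ} (hS : IsLyndon S) {j : ℕ} (hj : 0 < j)
    (hjm : j < S.length) :
    LtTo (S.length - j) (shift j (per (maxRot S))) (per (maxRot S)) := by
  rcases leTo_of_le (shift_maxRot_le S j) (S.length - j) with h | h
  · exact h
  · have h1 := lt_of_agree_shift h (hS.shift_maxRot_lt hj hjm)
    rw [shift_shift, show S.length - j + j = (maxRot S).length by rw [maxRot_length]; omega,
      shift_per] at h1
    exact absurd h1 (not_lt.2 (shift_maxRot_le _ _))

lemma LeTo.incr {n : ℕ} {c d e : ℕ → ℕ} (h : LeTo n c d) (hn : 0 < n) (hd : Agree (n - 1) e d)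
    (hl : d (n - 1) < e (n - 1)) : LtTo n c e :=
  h.trans_lt ⟨n - 1, by omega, hd.symm, hl⟩

lemma LeTo.decr_left {n : ℕ} {c d e : ℕ → ℕ} (h : LeTo n c d) (hn : 0 < n) (hd : Agree (n - 1) e c)
    (hl : e (n - 1) < c (n - 1)) : LtTo n e d :=
  LtTo.trans_le ⟨n - 1, by omega, hd, hl⟩ h

/-- A strict inequality between words of equal length leaves room for one unit in the last place.
This absorbs the change from `S` to `S⁻`, and in `LtTo.incr_left` from `𝕃(S)` to `𝕃(S)⁺`. -/
lemma LtTo.decr {n : ℕ} {c d e : ℕ → ℕ} (h : LtTo n c d) (hd : Agree (n - 1) e d)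
    (hl : d (n - 1) ≤ e (n - 1) + 1) : LeTo n c e := by
  obtain ⟨k, hk, h1, h2⟩ := h
  rcases (show k ≤ n - 1 by omega).lt_or_eq with h | rfl
  · exact Or.inl ⟨k, hk, h1.trans (hd.symm.mono h.le), by rw [hd k h]; exact h2⟩
  · rcases (show c (n - 1) ≤ e (n - 1) by omega).lt_or_eq with h3 | h3
    · exact Or.inl ⟨n - 1, hk, h1.trans hd.symm, h3⟩
    · refine Or.inr fun i hi => ?_
      rcases (show i ≤ n - 1 by omega).lt_or_eq with h4 | rfl
      · exact (h1.trans hd.symm) i h4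
      · exact h3

lemma LtTo.incr_left {n : ℕ} {c d e : ℕ → ℕ} (h : LtTo n c d) (hd : Agree (n - 1) e c)
    (hl : e (n - 1) ≤ c (n - 1) + 1) : LeTo n e d := by
  obtain ⟨k, hk, h1, h2⟩ := h
  rcases (show k ≤ n - 1 by omega).lt_or_eq with h | rfl
  · exact Or.inl ⟨k, hk, (hd.mono h.le).trans h1, by rw [hd k h]; exact h2⟩
  · rcases (show e (n - 1) ≤ d (n - 1) by omega).lt_or_eq with h3 | h3
    · exact Or.inl ⟨n - 1, hk, hd.trans h1, h3⟩
    · refine Or.inr fun i hi => ?_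
      rcases (show i ≤ n - 1 by omega).lt_or_eq with h4 | rfl
      · exact (hd.trans h1) i h4
      · exact h3

/-! ### The substitutions -/

/-- The image of a sequence that is preceded by the letter `p`. -/
def Phi (s : List ℕ) (p : ℕ) (c : ℕ → ℕ) : ℕ → ℕ := fun n =>
  (block s (if n / s.length = 0 then p else c (n / s.length - 1)) (c (n / s.length))).getD
    (n % s.length) 0

lemma substSeq_eq (s : List ℕ) (c : ℕ → ℕ) : substSeq s c = Phi s (1 - c 0) c := rfl

lemma block_length {s : List ℕ} (hs : s ≠ []) (p d : ℕ) : (block s p d).length = s.length := by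
  rcases p with _ | p <;> rcases d with _ | d <;>
    simp only [block, minus_length hs, plus_length (maxRot_ne hs), maxRot_length]

lemma Phi_eq {s : List ℕ} (hs : s ≠ []) (p : ℕ) (c : ℕ → ℕ) :
    Phi s p c = app (block s p (c 0)) (Phi s (c 0) (shift 1 c)) := by
  have hl : 0 < s.length := List.length_pos_iff.2 hs
  funext n
  by_cases h : n < s.length
  · rw [app_apply_lt (by rwa [block_length hs])]
    simp [Phi, Nat.div_eq_of_lt h, Nat.mod_eq_of_lt h]
  · simp only [app, block_length hs, if_neg h, Phi, shift_apply]
    have h1 : n / s.length = (n - s.length) / s.length + 1 := by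
      rw [Nat.div_eq_sub_div hl (by omega)]
    have h2 : n % s.length = (n - s.length) % s.length := Nat.mod_eq_sub_mod (by omega)
    rw [h1, h2]
    by_cases h3 : (n - s.length) / s.length = 0
    · simp [h3]
    · simp [h3, Nat.sub_add_cancel (Nat.one_le_iff_ne_zero.2 h3)]

lemma shift_Phi {s : List ℕ} (hs : s ≠ []) (p : ℕ) (c : ℕ → ℕ) (a : ℕ) :
    shift (a * s.length) (Phi s p c) = Phi s (if a = 0 then p else c (a - 1)) (shift a c) := by
  induction a with
  | zero => simp
  | succ a ih =>
    rw [Nat.succ_mul, add_comm, ← shift_shift, ih, Phi_eq hs]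
    conv_lhs => rw [← block_length hs (if a = 0 then p else c (a - 1)) (shift a c 0), shift_app]
    rw [shift_shift, add_comm 1 a]
    simp

lemma blocks_length {s : List ℕ} (hs : s ≠ []) (p : ℕ) (r : List ℕ) :
    (blocks s p r).length = r.length * s.length := by
  induction r generalizing p with
  | nil => simp [blocks]
  | cons a r ih => simp [blocks, block_length hs, ih, Nat.succ_mul, add_comm]

lemma Phi_app {s : List ℕ} (hs : s ≠ []) (p : ℕ) (r : List ℕ) (c : ℕ → ℕ) :
    Phi s p (app r c) = app (blocks s p r) (Phi s (r.getLastD p) c) := by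
  induction r generalizing p with
  | nil => simp [blocks]
  | cons a r ih =>
    rw [Phi_eq hs, app_cons_zero, shift_one_app_cons, ih, blocks, app_append]
    congr 3
    cases r <;> simp [List.getLastD]

lemma Phi_per {s : List ℕ} (hs : s ≠ []) {p : ℕ} {r : List ℕ} (hr : r ≠ [])
    (hp : r.getLastD p = p) : Phi s p (per r) = per (blocks s p r) := by
  refine eq_per ?_ ?_
  · rw [← List.length_pos_iff, blocks_length hs]
    exact Nat.mul_pos (List.length_pos_iff.2 hr) (List.length_pos_iff.2 hs)
  · conv_lhs => rw [per_eq r, Phi_app hs, hp]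

lemma Phi_agree {s : List ℕ} {p : ℕ} {c d : ℕ → ℕ} {n : ℕ} (h : Agree n c d) :
    Agree (s.length * n) (Phi s p c) (Phi s p d) := by
  intro i hi
  have h1 : i / s.length < n := Nat.div_lt_of_lt_mul hi
  simp only [Phi]
  rw [h _ h1, h (i / s.length - 1) (lt_of_le_of_lt (Nat.sub_le _ _) h1)]

lemma substSeq_agree {s : List ℕ} {c d : ℕ → ℕ} {n : ℕ} (h : Agree n c d) :
    Agree (s.length * n) (substSeq s c) (substSeq s d) := by
  rcases Nat.eq_zero_or_pos n with rfl | hn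
  · intro i hi; simp at hi
  · rw [substSeq_eq, substSeq_eq, h 0 hn]; exact Phi_agree h

lemma plus_minus {w : List ℕ} (hw : w ≠ []) (h : per w (w.length - 1) ≠ 0) :
    plus (minus w) = w := by
  rw [per_last hw] at h
  conv_rhs => rw [← dropLast_append hw, ← Nat.sub_add_cancel (Nat.one_le_iff_ne_zero.2 h)]
  simp only [plus, minus, List.dropLast_concat, List.getLastD_concat]

lemma minus_plus {w : List ℕ} (hw : w ≠ []) : minus (plus w) = w := by
  conv_rhs => rw [← dropLast_append hw]
  simp [plus, minus]

end BetaHole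

namespace BetaHole
open Set

/-! ### Order properties of the substitutions -/

lemma agree_self_app {w : List ℕ} {n : ℕ} (h : n ≤ w.length) (c : ℕ → ℕ) :
    Agree n (app w c) (per w) := (agree_app_per w c).mono h

/-- After either letter the two possible blocks differ by one in the last digit: `𝕃(S)` and `𝕃(S)⁺`
after `0`, `S⁻` and `S` after `1`. This is what makes `Φ_S` strictly increasing. -/
lemma block_lt {S : List ℕ} (hS : IsLyndon S) {p : ℕ} (c d : ℕ → ℕ) :
    LtTo S.length (app (block S p 0) c) (app (block S p 1) d) := by
  have hm := hS.length_pos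
  have hL := plus_last hS.maxRot_ne d
  have hL' := plus_agree hS.maxRot_ne d
  rw [maxRot_length] at hL hL'
  rcases p with _ | p
  · refine ⟨S.length - 1, by omega,
      (agree_self_app (w := maxRot S) (by rw [maxRot_length]; omega) c).trans hL'.symm, ?_⟩
    simp only [block]
    rw [hL, agree_self_app (w := maxRot S) (n := S.length) (by rw [maxRot_length]) c _ (by omega)]
    omega
  · refine ⟨S.length - 1, by omega,
      (minus_agree hS.ne c).trans (agree_self_app (by omega) d).symm, ?_⟩
    simp only [block]
    rw [minus_last hS.ne, agree_self_app le_rfl d _ (by omega)]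
    have := hS.last
    omega

lemma Phi_ltTo {S : List ℕ} (hS : IsLyndon S) {c d : ℕ → ℕ} (hd : IsBin d)
    {p n : ℕ} (h : LtTo n c d) : LtTo (S.length * n) (Phi S p c) (Phi S p d) := by
  obtain ⟨k, hk, h1, h2⟩ := h
  refine LtTo.mono (n := S.length * (k + 1)) ?_ (Nat.mul_le_mul_left _ hk)
  clear hk
  induction k generalizing p c d with
  | zero =>
    have h3 := hd 0
    rw [Phi_eq hS.ne, Phi_eq hS.ne p d, show c 0 = 0 by omega, show d 0 = 1 by omega]
    simpa using block_lt hS _ _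
  | succ k ih =>
    rw [Phi_eq hS.ne, Phi_eq hS.ne p d, h1 0 (Nat.succ_pos k), mul_add, mul_one, add_comm]
    have hl := block_length hS.ne p (d 0)
    have h4 := ih (p := d 0) (hd.shift 1) (h1.shift 1) h2
    refine LtTo.of_add (fun i hi => agree_app _ _ _ i (by rwa [hl])) ?_
    have h5 : ∀ x, shift S.length (app (block S p (d 0)) x) = x := fun x => by rw [← hl, shift_app]
    rw [h5, h5]
    exact h4

/-- The image of a sequence starting with `0` begins with a smaller block than `S`. -/
lemma substSeq_ltTo_per {S : List ℕ} (hS : IsLyndon S) {c : ℕ → ℕ} (h : c 0 = 0) :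
    LtTo S.length (substSeq S c) (per S) := by
  rw [substSeq_eq, Phi_eq hS.ne, h]
  have := hS.last
  exact ⟨S.length - 1, by have := hS.length_pos; omega, minus_agree hS.ne _, by
    simp only [block, Nat.sub_zero]; rw [minus_last hS.ne]; omega⟩

/-- The image of a sequence starting with `1` begins with a larger block than `𝕃(S)`. -/
lemma per_ltTo_substSeq {S : List ℕ} (hS : IsLyndon S) {c : ℕ → ℕ} (h : c 0 = 1) :
    LtTo S.length (per (maxRot S)) (substSeq S c) := by
  rw [substSeq_eq, Phi_eq hS.ne, h]
  have h1 := plus_agree hS.maxRot_ne (Phi S 1 (shift 1 c))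
  have h2 := plus_last hS.maxRot_ne (Phi S 1 (shift 1 c))
  rw [maxRot_length] at h1 h2
  exact ⟨S.length - 1, by have := hS.length_pos; omega, h1.symm, by
    simp only [block, Nat.sub_self]; rw [h2]; omega⟩

lemma substSeq_ltTo_substSeq {S : List ℕ} (hS : IsLyndon S) {c d : ℕ → ℕ} (hc : c 0 = 0)
    (hd : d 0 = 1) : LtTo S.length (substSeq S c) (substSeq S d) :=
  ((substSeq_ltTo_per hS hc).trans_le (leTo_of_le hS.le_maxRot _)).trans (per_ltTo_substSeq hS hd)

lemma substSeq_ltTo {S : List ℕ} (hS : IsLyndon S) {c d : ℕ → ℕ} (hd : IsBin d) {n : ℕ}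
    (h : LtTo n c d) : LtTo (S.length * n) (substSeq S c) (substSeq S d) := by
  by_cases h0 : c 0 = d 0
  · rw [substSeq_eq, substSeq_eq, h0]; exact Phi_ltTo hS hd h
  · obtain ⟨k, hk, -⟩ := id h
    have h1 := head_le_of_le h.lt.le
    have h2 := hd 0
    exact (substSeq_ltTo_substSeq hS (by omega) (by omega)).mono
      (Nat.le_mul_of_pos_right _ (by omega))

lemma substSeq_lt {S : List ℕ} (hS : IsLyndon S) {c d : ℕ → ℕ} (hd : IsBin d)
    (h : c <ₗ d) : substSeq S c <ₗ substSeq S d := by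
  obtain ⟨k, h1, h2⟩ := lexlt_iff.1 h
  exact (substSeq_ltTo hS hd ⟨k, k.lt_succ_self, h1, h2⟩).lt

lemma substSeq_le {S : List ℕ} (hS : IsLyndon S) {c d : ℕ → ℕ} (hd : IsBin d)
    (h : c ≤ₗ d) : substSeq S c ≤ₗ substSeq S d := by
  rcases h.lt_or_eq with h | h
  · exact (substSeq_lt hS hd h).le
  · rw [toLex_inj] at h; rw [h]

lemma le_of_substSeq_le {S : List ℕ} (hS : IsLyndon S) {c d : ℕ → ℕ} (hc : IsBin c)
    (h : substSeq S c ≤ₗ substSeq S d) : c ≤ₗ d := by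
  by_contra hn
  exact absurd (substSeq_lt hS hc (not_le.1 hn)) (not_lt.2 h)

lemma agree_of_substSeq_agree {S : List ℕ} (hS : IsLyndon S) {c d : ℕ → ℕ} (hc : IsBin c)
    (hd : IsBin d) {n : ℕ} (h : Agree (S.length * n) (substSeq S c) (substSeq S d)) :
    Agree n c d := by
  rcases ltTo_or_leTo n c d with h1 | h1 | h1
  · exact absurd (substSeq_ltTo hS hd h1) h.symm.leTo.not_lt
  · exact absurd (substSeq_ltTo hS hc h1) h.leTo.not_lt
  · exact h1.symm

lemma substSeq_injective {S : List ℕ} (hS : IsLyndon S) {c d : ℕ → ℕ} (hc : IsBin c)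
    (hd : IsBin d) (h : substSeq S c = substSeq S d) : c = d :=
  eq_of_agree fun _ => agree_of_substSeq_agree hS hc hd fun _ _ => by rw [h]

/-- The window starting inside a block, at distance `j` from its start. -/
lemma window_bounds {S : List ℕ} (hS : IsLyndon S) {p d e : ℕ} (hp : p ≤ 1) (hd : d ≤ 1)
    (he : e ≤ 1) {j : ℕ} (hj : 0 < j) (hjm : j < S.length) (c : ℕ → ℕ) :
    LeTo S.length (per S) (shift j (app (block S p d) (app (block S d e) c))) ∧
      LeTo S.length (shift j (app (block S p d) (app (block S d e) c))) (per (maxRot S)) := by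
  set t := app (block S d e) c with ht
  set z := app (block S p d) t with hz
  have hm := hS.length_pos
  have hLl := maxRot_length S
  have hsh : shift (S.length - j) (shift j z) = t := by
    rw [shift_shift, show S.length - j + j = (block S p d).length by
      rw [block_length hS.ne]; omega, hz, shift_app]
  have hlen : S.length - j + j = S.length := by omega
  have hidx : S.length - j - 1 + j = S.length - 1 := by omega
  have hsub : S.length - 1 - j = S.length - j - 1 := by omega
  have hpos : 0 < S.length - j := by omega
  have low1 := leTo_of_le (hS.le_shift_maxRot j) (S.length - j)
  have low2 := hS.ltTo_suffix hj hjm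
  have up1 := hS.maxRot_suffix_ltTo hj hjm
  have up2 := leTo_of_le (shift_per_le_maxRot S j) (S.length - j)
  have hlast := hS.last
  -- The block after a letter `0` starts, apart from its last digit, like `𝕃(S)`, so its first `j`
  -- digits dominate those of every rotation of `S`. After a letter `1` it starts like `S`, which
  -- gives the dual bound.
  have tail0 : d = 0 → LeTo j (shift (S.length - j) (per S)) t := fun h0 => by
    have h1 : Agree j t (per (maxRot S)) := by
      subst h0
      rcases e with _ | e
      · exact agree_self_app (w := maxRot S) (by omega) c
      · have := plus_agree hS.maxRot_ne c
        rw [hLl] at this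
        exact this.mono (by omega)
    exact (leTo_of_le (shift_per_le_maxRot S _) j).congr (fun _ _ => rfl) h1.symm
  have tail1 : d = 1 → LeTo j t (shift (S.length - j) (per (maxRot S))) := fun h0 => by
    have h1 : Agree j t (per S) := by
      subst h0
      rcases e with _ | e
      · exact (minus_agree hS.ne c).mono (by omega)
      · exact agree_self_app (w := S) (by omega) c
    exact (leTo_of_le (hS.le_shift_maxRot _) j).congr h1.symm (fun _ _ => rfl)
  have fin0 : LtTo (S.length - j) (per S) (shift j z) → LeTo S.length (per S) (shift j z) :=
    fun h => (h.mono (by omega)).leTo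
  have fin1 : LtTo (S.length - j) (shift j z) (per (maxRot S)) →
      LeTo S.length (shift j z) (per (maxRot S)) := fun h => (h.mono (by omega)).leTo
  have comb0 : d = 0 → LeTo (S.length - j) (per S) (shift j z) →
      LeTo S.length (per S) (shift j z) := fun h0 h => by
    have := h.of_add (b := j) (by rw [hsh]; exact tail0 h0)
    rwa [hlen] at this
  have comb1 : d = 1 → LeTo (S.length - j) (shift j z) (per (maxRot S)) →
      LeTo S.length (shift j z) (per (maxRot S)) := fun h0 h => by
    have := h.of_add (b := j) (by rw [hsh]; exact tail1 h0)
    rwa [hlen] at this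
  -- The first `|S| - j` digits are a suffix of one of the four blocks. Either they decide the
  -- comparison strictly (`fin0`, `fin1`), or equality remains possible and the next block settles
  -- it (`comb0`, `comb1`).
  rcases (show d = 0 ∨ d = 1 by omega) with h0 | h0 <;>
    rcases (show p = 0 ∨ p = 1 by omega) with h1 | h1
  · have ha : Agree (S.length - j) (shift j z) (shift j (per (maxRot S))) := by
      have : Agree S.length z (per (maxRot S)) := by
        rw [hz, h0, h1]; exact agree_self_app hLl.ge t
      exact this.shift j
    exact ⟨comb0 h0 (low1.congr (fun _ _ => rfl) ha.symm),
      fin1 (up1.congr ha.symm (fun _ _ => rfl))⟩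
  · have hA : Agree (S.length - 1) z (per S) := by rw [hz, h0, h1]; exact minus_agree hS.ne t
    have hB : z (S.length - 1) = per S (S.length - 1) - 1 := by
      rw [hz, h0, h1]; exact minus_last hS.ne t
    have ha := hA.shift j
    rw [hsub] at ha
    exact ⟨comb0 h0 (low2.decr ha (by simp only [shift_apply, hidx]; omega)),
      fin1 (up2.decr_left hpos ha (by simp only [shift_apply, hidx]; omega))⟩
  · have hA : Agree (S.length - 1) z (per (maxRot S)) := by
      rw [hz, h0, h1, ← hLl]; exact plus_agree hS.maxRot_ne t
    have hB : z (S.length - 1) = per (maxRot S) (S.length - 1) + 1 := by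
      rw [hz, h0, h1, ← hLl]; exact plus_last hS.maxRot_ne t
    have ha := hA.shift j
    rw [hsub] at ha
    exact ⟨fin0 (low1.incr hpos ha (by simp only [shift_apply, hidx]; omega)),
      comb1 h0 (up1.incr_left ha (by simp only [shift_apply, hidx]; omega))⟩
  · have ha : Agree (S.length - j) (shift j z) (shift j (per S)) := by
      have : Agree S.length z (per S) := by
        rw [hz, h0, h1]; exact agree_self_app le_rfl t
      exact this.shift j
    exact ⟨fin0 (low2.congr (fun _ _ => rfl) ha.symm),
      comb1 h0 (up2.congr ha.symm (fun _ _ => rfl))⟩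

lemma shift_substSeq {S : List ℕ} (hS : IsLyndon S) (c : ℕ → ℕ) (a : ℕ) :
    shift (a * S.length) (substSeq S c) =
      Phi S (if a = 0 then 1 - c 0 else c (a - 1)) (shift a c) := by
  rw [substSeq_eq, shift_Phi hS.ne]

/-- Every shift of the image of a binary sequence is the image of a shift, up to blocks between
`S` and `𝕃(S)`. -/
lemma shift_substSeq_cases {S : List ℕ} (hS : IsLyndon S) {c : ℕ → ℕ} (hc : IsBin c) (i : ℕ) :
    (∃ a, i = a * S.length ∧ shift i (substSeq S c) = substSeq S (shift a c)) ∨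
      (LeTo S.length (per S) (shift i (substSeq S c)) ∧
        LeTo S.length (shift i (substSeq S c)) (per (maxRot S))) := by
  have hm := hS.length_pos
  set a := i / S.length with ha
  set j := i % S.length with hj
  have hij : i = j + a * S.length := by rw [ha, hj, mul_comm]; exact (Nat.mod_add_div _ _).symm
  set p := if a = 0 then 1 - c 0 else c (a - 1) with hp
  have hp1 : p ≤ 1 := by
    rw [hp]; split_ifs
    · omega
    · exact hc _
  have hs : shift i (substSeq S c) = shift j (Phi S p (shift a c)) := by
    rw [hij, ← shift_shift, shift_substSeq hS]
  have hca : shift a c 0 ≤ 1 := hc _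
  rcases Nat.eq_zero_or_pos j with h0 | h0
  · rw [h0, shift_zero] at hs
    rw [h0, zero_add] at hij
    -- At a block boundary the shift is the image of a shift only if the preceding letter is the
    -- opposite one, as `substSeq` assumes at its start. Otherwise the block is `𝕃(S)` or `S`,
    -- within the bounds.
    by_cases hpc : p = 1 - shift a c 0
    · left
      exact ⟨a, hij, by rw [hs, hpc, substSeq_eq]⟩
    · right
      have hpe : p = shift a c 0 := by omega
      have h1 : ∃ t, shift i (substSeq S c) = app (block S p p) t :=
        ⟨_, by rw [hs, Phi_eq hS.ne, ← hpe]⟩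
      obtain ⟨t, ht⟩ := h1
      rw [ht]
      rcases (show p = 0 ∨ p = 1 by omega) with h | h <;> rw [h]
      · have hag : Agree S.length (app (block S 0 0) t) (per (maxRot S)) :=
          agree_self_app (maxRot_length S).ge t
        exact ⟨(leTo_of_le hS.le_maxRot _).congr (fun _ _ => rfl) hag.symm, hag.leTo⟩
      · have hag : Agree S.length (app (block S 1 1) t) (per S) := agree_self_app le_rfl t
        exact ⟨hag.symm.leTo, (leTo_of_le hS.le_maxRot _).congr hag.symm (fun _ _ => rfl)⟩
  · right
    rw [hs, Phi_eq hS.ne, Phi_eq hS.ne _ (shift 1 (shift a c))]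
    exact window_bounds hS hp1 hca (hc _) h0 (Nat.mod_lt _ hm) _

lemma substSeq_lower {S : List ℕ} (hS : IsLyndon S) {c : ℕ → ℕ} (hc : IsBin c) (i : ℕ) :
    (∃ a, i = a * S.length ∧ shift i (substSeq S c) = substSeq S (shift a c)) ∨
      ∀ d : ℕ → ℕ, d 0 = 0 → LtTo S.length (substSeq S d) (shift i (substSeq S c)) := by
  rcases shift_substSeq_cases hS hc i with h | h
  · exact Or.inl h
  · exact Or.inr fun d hd => (substSeq_ltTo_per hS hd).trans_le h.1

lemma substSeq_upper {S : List ℕ} (hS : IsLyndon S) {c : ℕ → ℕ} (hc : IsBin c) (i : ℕ) :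
    (∃ a, i = a * S.length ∧ shift i (substSeq S c) = substSeq S (shift a c)) ∨
      ∀ d : ℕ → ℕ, d 0 = 1 → LtTo S.length (shift i (substSeq S c)) (substSeq S d) := by
  rcases shift_substSeq_cases hS hc i with h | h
  · exact Or.inl h
  · exact Or.inr fun d hd => h.2.trans_lt (per_ltTo_substSeq hS hd)

/-- Shifts that are images of shifts are handled by monotonicity. All others start with a word
between `S` and `𝕃(S)`, strictly inside the initial blocks `S⁻` and `𝕃(S)⁺` of the two bounds. -/
lemma substSeq_mem_shiftsBetween {S : List ℕ} (hS : IsLyndon S) {c e f : ℕ → ℕ} (hc : IsBin c)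
    (hf : IsBin f) (he0 : e 0 = 0) (hf0 : f 0 = 1) (h : c ∈ shiftsBetween e f) :
    substSeq S c ∈ shiftsBetween (substSeq S e) (substSeq S f) := by
  intro i
  constructor
  · rcases substSeq_lower hS hc i with ⟨a, -, ha⟩ | ha
    · rw [ha]; exact substSeq_le hS (hc.shift a) (h a).1
    · exact (ha e he0).lt.le
  · rcases substSeq_upper hS hc i with ⟨a, -, ha⟩ | ha
    · rw [ha]; exact substSeq_le hS hf (h a).2
    · exact (ha f hf0).lt.le

/-! ### Explicit images -/

lemma Phi_zero {S : List ℕ} (hS : IsLyndon S) : Phi S 0 (fun _ => 0) = per (maxRot S) := by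
  have := Phi_per hS.ne (p := 0) (r := [0]) (by simp) (by simp)
  simpa [blocks, block] using this

lemma Phi_one {S : List ℕ} (hS : IsLyndon S) : Phi S 1 (fun _ => 1) = per S := by
  have := Phi_per hS.ne (p := 1) (r := [1]) (by simp) (by simp)
  simpa [blocks, block] using this

lemma substSeq_zero {S : List ℕ} (hS : IsLyndon S) :
    substSeq S (fun _ => 0) = evPer (minus S) (maxRot S) := by
  rw [substSeq_eq, Phi_eq hS.ne, evPer_eq]
  congr 1
  exact Phi_zero hS

lemma substSeq_one {S : List ℕ} (hS : IsLyndon S) :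
    substSeq S (fun _ => 1) = evPer (plus (maxRot S)) S := by
  rw [substSeq_eq, Phi_eq hS.ne, evPer_eq]
  congr 1
  exact Phi_one hS

lemma substSeq_one_zero {S : List ℕ} (hS : IsLyndon S) :
    substSeq S (app [1] fun _ => 0) = evPer (plus (maxRot S) ++ minus S) (maxRot S) := by
  rw [substSeq_eq, Phi_eq hS.ne, evPer_eq, app_append, app_cons_zero, shift_one_app_cons, app_nil,
    Phi_eq hS.ne]
  congr 2
  exact Phi_zero hS

/-! ### Compositions of substitutions -/

/-- The binary Lyndon words of length at least two. -/
structure IsBinLyndon (r : List ℕ) : Prop where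
  lyndon : IsLyndon r
  bin : ∀ x ∈ r, x ≤ 1
  two_le : 2 ≤ r.length

lemma isBin_per {r : List ℕ} (h : ∀ x ∈ r, x ≤ 1) : IsBin (per r) := by
  intro n
  rw [per_apply]
  by_cases hn : n % r.length < r.length
  · rw [List.getD_eq_getElem _ _ hn]; exact h _ (List.getElem_mem hn)
  · rw [List.getD_eq_default _ _ (not_lt.1 hn)]; exact Nat.zero_le _

namespace IsBinLyndon

lemma isBin {r : List ℕ} (hr : IsBinLyndon r) : IsBin (per r) := isBin_per hr.bin

lemma isBin_maxRot {r : List ℕ} (hr : IsBinLyndon r) : IsBin (per (maxRot r)) := by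
  obtain ⟨k, hk⟩ := exists_per_maxRot r
  rw [hk]; exact hr.isBin.shift k

lemma last {r : List ℕ} (hr : IsBinLyndon r) : per r (r.length - 1) = 1 := by
  have h1 := hr.lyndon.last
  have h2 := hr.isBin (r.length - 1)
  omega

lemma head {r : List ℕ} (hr : IsBinLyndon r) : per r 0 = 0 := by
  by_contra h
  have h1 := hr.lyndon.min 1 one_pos hr.two_le
  refine absurd h1 (not_lt.2 ?_)
  have h2 : ∀ i, per r i = 1 := fun i => by
    have h3 : per r 0 ≤ shift i (per r) 0 := head_le_of_le (hr.lyndon.min_le i)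
    have h4 := hr.isBin i
    simp at h3
    omega
  have : per r = fun _ => 1 := funext h2
  rw [this]; exact le_rfl

lemma head_maxRot {r : List ℕ} (hr : IsBinLyndon r) : per (maxRot r) 0 = 1 := by
  have h1 : shift (r.length - 1) (per r) 0 ≤ per (maxRot r) 0 :=
    head_le_of_le (shift_per_le_maxRot r _)
  have h2 := hr.isBin_maxRot 0
  simp [hr.last] at h1
  omega

/-- A final `1` could be moved to the front without decreasing the word, against the strict
maximality of the maximal rotation. -/
lemma last_maxRot {r : List ℕ} (hr : IsBinLyndon r) : per (maxRot r) (r.length - 1) = 0 := by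
  by_contra h
  have h2 := hr.isBin_maxRot (r.length - 1)
  have h1 := hr.lyndon.shift_maxRot_lt (i := r.length - 1) (by have := hr.two_le; omega)
    (by have := hr.two_le; omega)
  refine absurd h1 (not_lt.2 ?_)
  rw [← cons_shift (shift (r.length - 1) _), shift_shift,
    show 1 + (r.length - 1) = (maxRot r).length by
      rw [maxRot_length]; have := hr.two_le; omega, shift_per,
    shift_apply, zero_add, show per (maxRot r) (r.length - 1) = 1 by omega]
  exact le_const_cons hr.isBin_maxRot

end IsBinLyndon

lemma headD_eq_per {r : List ℕ} (hr : r ≠ []) : r.headD 0 = per r 0 := by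
  cases r with
  | nil => exact absurd rfl hr
  | cons a r => rw [per_eq, app_cons_zero]; rfl

lemma getLastD_eq {r : List ℕ} (hr : r ≠ []) (a b : ℕ) : r.getLastD a = r.getLastD b := by
  cases r with
  | nil => exact absurd rfl hr
  | cons x r => simp [List.getLastD]

lemma subst_eq_blocks {S r : List ℕ} (hr : IsBinLyndon r) : subst S r = blocks S 1 r := by
  rw [subst, headD_eq_per hr.lyndon.ne, hr.head]

lemma subst_maxRot_eq_blocks {S r : List ℕ} (hr : IsBinLyndon r) :
    subst S (maxRot r) = blocks S 0 (maxRot r) := by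
  rw [subst, headD_eq_per hr.lyndon.maxRot_ne, hr.head_maxRot]

/-- A binary Lyndon word starts with `0` and ends with `1`, so the letter before each period is the
one that `substSeq` assumes before the first. For `𝕃(r)` the roles of the letters are exchanged. -/
lemma substSeq_per {S r : List ℕ} (hS : IsLyndon S) (hr : IsBinLyndon r) :
    substSeq S (per r) = per (subst S r) := by
  rw [substSeq_eq, hr.head, subst_eq_blocks hr]
  exact Phi_per hS.ne hr.lyndon.ne
    (by rw [getLastD_eq hr.lyndon.ne _ 0, ← per_last hr.lyndon.ne, hr.last])

lemma substSeq_per_maxRot {S r : List ℕ} (hS : IsLyndon S) (hr : IsBinLyndon r) :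
    substSeq S (per (maxRot r)) = per (subst S (maxRot r)) := by
  rw [substSeq_eq, hr.head_maxRot, subst_maxRot_eq_blocks hr]
  exact Phi_per hS.ne hr.lyndon.maxRot_ne
    (by rw [getLastD_eq hr.lyndon.maxRot_ne _ 0, ← per_last hr.lyndon.maxRot_ne, maxRot_length,
      hr.last_maxRot])

lemma subst_length {S r : List ℕ} (hS : S ≠ []) : (subst S r).length = r.length * S.length :=
  blocks_length hS _ _

/-- Shifts that are images of shifts inherit minimality from `r`; every other shift begins with a
word at least `S`, whereas the image of `r` begins with `S⁻`. -/
lemma subst_lyndon {S r : List ℕ} (hS : IsLyndon S) (hr : IsBinLyndon r) :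
    IsLyndon (subst S r) := by
  have hlen := subst_length (r := r) hS.ne
  have hm := hS.length_pos
  have hq := hr.lyndon.length_pos
  have hl0 : 0 < (subst S r).length := by rw [hlen]; exact Nat.mul_pos hq hm
  refine ⟨List.length_pos_iff.1 hl0, fun i hi him => ?_, ?_⟩
  · rw [← substSeq_per hS hr]
    rcases substSeq_lower hS hr.isBin i with ⟨a, h1, h2⟩ | h
    · rw [h2]
      refine substSeq_lt hS (hr.isBin.shift a) (hr.lyndon.min a ?_ ?_)
      · rcases Nat.eq_zero_or_pos a with h | h
        · rw [h] at h1; omega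
        · exact h
      · rw [hlen, h1] at him
        exact lt_of_mul_lt_mul_right him (Nat.zero_le _)
    · exact (h _ hr.head).lt
  · have h1 : (subst S r).length - 1 = S.length - 1 + (r.length - 1) * S.length := by
      rw [hlen, Nat.sub_mul, one_mul]
      have := Nat.le_mul_of_pos_left S.length hq
      omega
    have h2 : r.length - 1 ≠ 0 := by have := hr.two_le; omega
    have h3 := congrFun (shift_substSeq hS (per r) (r.length - 1)) (S.length - 1)
    rw [shift_apply, ← h1, substSeq_per hS hr, if_neg h2, Phi_eq hS.ne, shift_apply, zero_add,
      hr.last] at h3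
    rw [h3]
    rcases per r (r.length - 1 - 1) with _ | k
    · simp only [block]
      rw [← maxRot_length S, plus_last hS.maxRot_ne]
      omega
    · simp only [block]
      rw [agree_self_app le_rfl _ _ (by omega)]
      exact hS.last

lemma maxRot_subst {S r : List ℕ} (hS : IsLyndon S) (hr : IsBinLyndon r) :
    maxRot (subst S r) = subst S (maxRot r) := by
  have hlen := subst_length (r := r) hS.ne
  have hq := hr.two_le
  refine eq_maxRot (by rw [hlen, subst_length hS.ne, maxRot_length]) ?_ ?_
  · obtain ⟨k, hk⟩ := exists_per_maxRot r
    -- The additional period makes the shift positive, so its first block is preceded by an actual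
    -- letter, the final `0` of `𝕃(r)`, and not by the letter assumed at the start.
    have hk' : per (maxRot r) = shift (k + r.length) (per r) := by
      rw [← shift_shift, shift_per, hk]
    refine ⟨(k + r.length) * S.length, ?_⟩
    rw [← substSeq_per hS hr, ← substSeq_per_maxRot hS hr, shift_substSeq hS, ← hk', substSeq_eq,
      if_neg (by omega), hr.head_maxRot]
    congr 1
    have h1 := hr.last_maxRot
    rw [hk, shift_apply] at h1
    rw [Nat.sub_self, ← h1]
    congr 1; omega
  · intro k
    rw [← substSeq_per hS hr, ← substSeq_per_maxRot hS hr]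
    rcases substSeq_upper hS hr.isBin k with ⟨a, -, h⟩ | h
    · rw [h]; exact substSeq_le hS hr.isBin_maxRot (shift_per_le_maxRot r a)
    · exact (h _ hr.head_maxRot).lt.le

/-! ### Associativity of the substitutions -/

lemma blocks_append (S u v : List ℕ) (p : ℕ) :
    blocks S p (u ++ v) = blocks S p u ++ blocks S (u.getLastD p) v := by
  induction u generalizing p with
  | nil => simp [blocks]
  | cons a u ih =>
    rw [List.cons_append, blocks, blocks, ih, List.append_assoc]
    congr 3
    cases u <;> simp [List.getLastD]

lemma plus_append {u v : List ℕ} (hv : v ≠ []) : plus (u ++ v) = u ++ plus v := by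
  have h : u ++ v = (u ++ v.dropLast) ++ [v.getLastD 0] := by
    rw [List.append_assoc, dropLast_append hv]
  rw [h]
  simp only [plus, List.dropLast_concat, List.getLastD_concat]
  rw [List.append_assoc]

lemma minus_append {u v : List ℕ} (hv : v ≠ []) : minus (u ++ v) = u ++ minus v := by
  have h : u ++ v = (u ++ v.dropLast) ++ [v.getLastD 0] := by
    rw [List.append_assoc, dropLast_append hv]
  rw [h]
  simp only [minus, List.dropLast_concat, List.getLastD_concat]
  rw [List.append_assoc]

lemma plus_block_zero {S : List ℕ} (hS : IsLyndon S) (q : ℕ) :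
    plus (block S q 0) = block S q 1 := by
  rcases q with _ | q
  · rfl
  · exact plus_minus hS.ne hS.last

lemma minus_block_one {S : List ℕ} (hS : IsLyndon S) (q : ℕ) :
    minus (block S q 1) = block S q 0 := by
  rcases q with _ | q
  · exact minus_plus hS.maxRot_ne
  · rfl

lemma block_ne {S : List ℕ} (hS : S ≠ []) (p d : ℕ) : block S p d ≠ [] := by
  rw [← List.length_pos_iff, block_length hS]; exact List.length_pos_iff.2 hS

lemma blocks_plus {S w : List ℕ} (hS : IsLyndon S) (hw : w ≠ []) (h : w.getLastD 0 = 0) (p : ℕ) :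
    blocks S p (plus w) = plus (blocks S p w) := by
  conv_rhs => rw [← dropLast_append hw]
  rw [plus, blocks_append, blocks_append, h]
  simp only [blocks, List.append_nil]
  rw [plus_append (block_ne hS.ne _ _), plus_block_zero hS]

lemma blocks_minus {S w : List ℕ} (hS : IsLyndon S) (hw : w ≠ []) (h : w.getLastD 0 = 1) (p : ℕ) :
    blocks S p (minus w) = minus (blocks S p w) := by
  conv_rhs => rw [← dropLast_append hw]
  rw [minus, blocks_append, blocks_append, h]
  simp only [blocks, List.append_nil]
  rw [minus_append (block_ne hS.ne _ _), minus_block_one hS]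

lemma block_subst {S r : List ℕ} (hS : IsLyndon S) (hr : IsBinLyndon r) {p d : ℕ} (hp : p ≤ 1)
    (hd : d ≤ 1) : block (subst S r) p d = blocks S p (block r p d) := by
  have h1 : (maxRot r).getLastD 0 = 0 := by
    rw [← per_last hr.lyndon.maxRot_ne, maxRot_length, hr.last_maxRot]
  have h2 : r.getLastD 0 = 1 := by rw [← per_last hr.lyndon.ne, hr.last]
  rcases (show p = 0 ∨ p = 1 by omega) with rfl | rfl <;>
    rcases (show d = 0 ∨ d = 1 by omega) with rfl | rfl <;> simp only [block]
  · rw [maxRot_subst hS hr, subst_maxRot_eq_blocks hr]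
  · rw [maxRot_subst hS hr, subst_maxRot_eq_blocks hr, blocks_plus hS hr.lyndon.maxRot_ne h1]
  · rw [subst_eq_blocks hr, blocks_minus hS hr.lyndon.ne h2]
  · rw [subst_eq_blocks hr]

lemma getLastD_block {r : List ℕ} (hr : IsBinLyndon r) {p d : ℕ} (hp : p ≤ 1)
    (hd : d ≤ 1) (b : ℕ) : (block r p d).getLastD b = d := by
  have h1 : (maxRot r).getLastD 0 = 0 := by
    rw [← per_last hr.lyndon.maxRot_ne, maxRot_length, hr.last_maxRot]
  have h2 : r.getLastD 0 = 1 := by rw [← per_last hr.lyndon.ne, hr.last]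
  rw [getLastD_eq (block_ne hr.lyndon.ne p d) b 0]
  rcases (show p = 0 ∨ p = 1 by omega) with rfl | rfl <;>
    rcases (show d = 0 ∨ d = 1 by omega) with rfl | rfl <;> simp only [block]
  · exact h1
  · rw [plus, List.getLastD_concat, h1]
  · rw [minus, List.getLastD_concat, h2]
  · exact h2

/-- The blocks of `S • r` are the `S`-images of the blocks of `r` (`block_subst`). Each block of `r`
ends in the letter for which it is written, so the following block sees the right predecessor and
the identity continues. -/
lemma Phi_subst {S r : List ℕ} (hS : IsLyndon S) (hr : IsBinLyndon r) {p : ℕ} (hp : p ≤ 1)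
    {c : ℕ → ℕ} (hc : IsBin c) : Phi (subst S r) p c = Phi S p (Phi r p c) := by
  have hSr := subst_lyndon hS hr
  funext n
  induction n using Nat.strong_induction_on generalizing p c with
  | _ n ih =>
    rw [Phi_eq hSr.ne, Phi_eq hr.lyndon.ne, Phi_app hS.ne, getLastD_block hr hp (hc 0),
      block_subst hS hr hp (hc 0)]
    have hb : 0 < (blocks S p (block r p (c 0))).length := by
      rw [blocks_length hS.ne, block_length hr.lyndon.ne]
      exact Nat.mul_pos hr.lyndon.length_pos hS.length_pos
    by_cases h : n < (blocks S p (block r p (c 0))).length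
    · rw [app_apply_lt h, app_apply_lt h]
    · simp only [app, if_neg h]
      exact ih _ (by omega) (hc 0) (hc.shift 1)

lemma substSeq_head {r : List ℕ} (hr : IsBinLyndon r) {c : ℕ → ℕ} (hc : IsBin c) :
    substSeq r c 0 = c 0 := by
  have hl := hr.lyndon.length_pos
  have h2 := hr.two_le
  rw [substSeq_eq, Phi_eq hr.lyndon.ne]
  have := hc 0
  rcases (show c 0 = 0 ∨ c 0 = 1 by omega) with h | h <;> rw [h] <;> simp only [block, Nat.sub_zero,
    Nat.sub_self]
  · rw [minus_agree hr.lyndon.ne _ 0 (by omega), hr.head]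
  · rw [plus_agree hr.lyndon.maxRot_ne _ 0 (by rw [maxRot_length]; omega), hr.head_maxRot]

lemma substSeq_subst {S r : List ℕ} (hS : IsLyndon S) (hr : IsBinLyndon r)
    {c : ℕ → ℕ} (hc : IsBin c) : substSeq (subst S r) c = substSeq S (substSeq r c) := by
  rw [substSeq_eq, Phi_subst hS hr (by omega) hc, substSeq_eq S, substSeq_head hr hc]
  rfl

lemma isBin_block {r : List ℕ} (hr : IsBinLyndon r) {p d : ℕ} (hp : p ≤ 1) (hd : d ≤ 1) :
    ∀ x ∈ block r p d, x ≤ 1 := by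
  have hL : ∀ x ∈ maxRot r, x ≤ 1 := fun x hx => hr.bin x ((maxRot_isRotated r).mem_iff.1 hx)
  rcases (show p = 0 ∨ p = 1 by omega) with rfl | rfl <;>
    rcases (show d = 0 ∨ d = 1 by omega) with rfl | rfl <;> simp only [block]
  · exact hL
  · intro x hx
    rw [plus, ← per_last hr.lyndon.maxRot_ne, maxRot_length, hr.last_maxRot] at hx
    rcases List.mem_append.1 hx with h | h
    · exact hL x (List.mem_of_mem_dropLast h)
    · simp at h; omega
  · intro x hx
    rw [minus, ← per_last hr.lyndon.ne, hr.last] at hx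
    rcases List.mem_append.1 hx with h | h
    · exact hr.bin x (List.mem_of_mem_dropLast h)
    · simp at h; omega
  · exact hr.bin

lemma isBin_substSeq {r : List ℕ} (hr : IsBinLyndon r) {c : ℕ → ℕ} (hc : IsBin c) :
    IsBin (substSeq r c) := by
  intro n
  rw [substSeq_eq]
  simp only [Phi]
  set b := block r (if n / r.length = 0 then 1 - c 0 else c (n / r.length - 1)) (c (n / r.length))
    with hb
  have hp : (if n / r.length = 0 then 1 - c 0 else c (n / r.length - 1)) ≤ 1 := by
    split_ifs
    · omega
    · exact hc _
  by_cases h : n % r.length < b.length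
  · rw [List.getD_eq_getElem _ _ h]
    exact isBin_block hr hp (hc _) _ (List.getElem_mem h)
  · rw [List.getD_eq_default _ _ (not_lt.1 h)]; exact Nat.zero_le _

end BetaHole

namespace BetaHole
open Set

/-! ### Free substitutions -/

/-- Concatenation of the images of the letters of `c`, evaluated with a bound on the recursion. -/
def morphAux (f : ℕ → List ℕ) : ℕ → (ℕ → ℕ) → ℕ → ℕ
  | 0, _, _ => 0
  | k + 1, c, n => if n < (f (c 0)).length then (f (c 0)).getD n 0
      else morphAux f k (shift 1 c) (n - (f (c 0)).length)

/-- The sequence obtained from `c` by replacing each letter `d` by the word `f d`. -/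
def morph (f : ℕ → List ℕ) (c : ℕ → ℕ) : ℕ → ℕ := fun n => morphAux f (n + 1) c n

lemma morphAux_eq {f : ℕ → List ℕ} (hf : ∀ d, f d ≠ []) {k l n : ℕ} (hk : n < k) (hl : n < l)
    (c : ℕ → ℕ) : morphAux f k c n = morphAux f l c n := by
  induction k generalizing l n c with
  | zero => omega
  | succ k ih =>
    cases l with
    | zero => omega
    | succ l =>
      have := List.length_pos_iff.2 (hf (c 0))
      simp only [morphAux]
      split_ifs with h
      · rfl
      · exact ih (by omega) (by omega) _

lemma morph_eq {f : ℕ → List ℕ} (hf : ∀ d, f d ≠ []) (c : ℕ → ℕ) :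
    morph f c = app (f (c 0)) (morph f (shift 1 c)) := by
  funext n
  have := List.length_pos_iff.2 (hf (c 0))
  simp only [morph, app]
  rw [morphAux]
  split_ifs with h
  · rfl
  · exact morphAux_eq hf (by omega) (by omega) _

lemma morph_app {f : ℕ → List ℕ} (hf : ∀ d, f d ≠ []) (w : List ℕ) (c : ℕ → ℕ) :
    morph f (app w c) = app (w.flatMap f) (morph f c) := by
  induction w with
  | nil => simp
  | cons a w ih =>
    rw [morph_eq hf, app_cons_zero, shift_one_app_cons, ih, List.flatMap_cons, app_append]

lemma flatMap_ne {f : ℕ → List ℕ} (hf : ∀ d, f d ≠ []) {w : List ℕ} (hw : w ≠ []) :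
    w.flatMap f ≠ [] := by
  cases w with
  | nil => exact absurd rfl hw
  | cons a w => simp [hf a]

lemma morph_per {f : ℕ → List ℕ} (hf : ∀ d, f d ≠ []) {w : List ℕ} (hw : w ≠ []) :
    morph f (per w) = per (w.flatMap f) :=
  eq_per (flatMap_ne hf hw) (by conv_lhs => rw [per_eq w, morph_app hf])

lemma morph_agree {f : ℕ → List ℕ} (hf : ∀ d, f d ≠ []) {n : ℕ} {c d : ℕ → ℕ} (h : Agree n c d) :
    Agree n (morph f c) (morph f d) := by
  induction n generalizing c d with
  | zero => intro i hi; omega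
  | succ n ih =>
    have hl := List.length_pos_iff.2 (hf (d 0))
    rw [morph_eq hf, morph_eq hf d, h 0 n.succ_pos]
    exact ((ih (h.shift 1)).app (f (d 0))).mono (by omega)

lemma initial_add (a b : ℕ) (c : ℕ → ℕ) :
    initial (a + b) c = initial a c ++ initial b (shift a c) := by
  refine List.ext_getElem (by simp) fun i h1 h2 => ?_
  rw [initial_length] at h1
  rw [List.getElem_append]
  simp only [initial, List.getElem_ofFn, List.length_ofFn, shift_apply]
  split_ifs with h
  · rfl
  · congr 1; omega

lemma initial_per (w : List ℕ) : initial w.length (per w) = w := by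
  refine List.ext_getElem (by simp) fun i h1 h2 => ?_
  simp [initial, per_apply, Nat.mod_eq_of_lt h2, h2]

lemma shift_morph {f : ℕ → List ℕ} (hf : ∀ d, f d ≠ []) (z : ℕ → ℕ) (a : ℕ) :
    shift ((initial a z).flatMap f).length (morph f z) = morph f (shift a z) := by
  conv_lhs => rw [← app_initial a z, morph_app hf]
  rw [app_initial, shift_app]

lemma exists_shift_morph {f : ℕ → List ℕ} (hf : ∀ d, f d ≠ []) (z : ℕ → ℕ) (n : ℕ) :
    ∃ a j, j < (f (z a)).length ∧ n = ((initial a z).flatMap f).length + j ∧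
      shift n (morph f z) = shift j (morph f (shift a z)) := by
  suffices ∃ a j, j < (f (z a)).length ∧ n = ((initial a z).flatMap f).length + j by
    obtain ⟨a, j, h1, h2⟩ := this
    refine ⟨a, j, h1, h2, ?_⟩
    rw [← shift_morph hf, shift_shift, add_comm j, ← h2]
  induction n with
  | zero => exact ⟨0, 0, List.length_pos_iff.2 (hf _), by simp [initial]⟩
  | succ n ih =>
    obtain ⟨a, j, h1, h2⟩ := ih
    by_cases h : j + 1 < (f (z a)).length
    · exact ⟨a, j + 1, h, by omega⟩
    · refine ⟨a + 1, 0, List.length_pos_iff.2 (hf _), ?_⟩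
      have h1 : initial 1 (shift a z) = [z a] := by simp [initial]
      rw [initial_add, List.flatMap_append, List.length_append, h1, List.flatMap_singleton]
      omega

/-! ### The two Farey substitutions -/

/-- The images of the letters under `0 ↦ 0, 1 ↦ 01` and under `0 ↦ 01, 1 ↦ 1`. -/
def letter : Bool → ℕ → List ℕ
  | false, 0 => [0]
  | false, _ + 1 => [0, 1]
  | true, 0 => [0, 1]
  | true, _ + 1 => [1]

lemma letter_ne (b : Bool) (d : ℕ) : letter b d ≠ [] := by
  rcases b with _ | _ <;> rcases d with _ | d <;> simp [letter]

lemma letter_length_le (b : Bool) (d : ℕ) : (letter b d).length ≤ 2 := by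
  rcases b with _ | _ <;> rcases d with _ | d <;> simp [letter]

lemma letter_bin (b : Bool) (d : ℕ) : ∀ x ∈ letter b d, x ≤ 1 := by
  rcases b with _ | _ <;> rcases d with _ | d <;> simp [letter]

/-- Replaces the first digit by its successor. -/
def inc (c : ℕ → ℕ) : ℕ → ℕ := app [c 0 + 1] (shift 1 c)

@[simp] lemma inc_zero (c : ℕ → ℕ) : inc c 0 = c 0 + 1 := by simp [inc]

@[simp] lemma shift_inc (c : ℕ → ℕ) : shift 1 (inc c) = shift 1 c := by simp [inc]

lemma inc_app_cons (a : ℕ) (w : List ℕ) (c : ℕ → ℕ) :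
    inc (app (a :: w) c) = app ((a + 1) :: w) c := by
  rw [inc, app_cons_zero, shift_one_app_cons, ← app_cons]

lemma inc_injective {c d : ℕ → ℕ} (h : inc c = inc d) : c = d := by
  have h0 := congrFun h 0
  have h1 := congrArg (shift 1) h
  simp only [inc_zero, shift_inc] at h0 h1
  rw [← cons_shift c, ← cons_shift d, h1, Nat.succ_injective h0]

lemma inc_lt {c d : ℕ → ℕ} (h : c <ₗ d) : inc c <ₗ inc d := by
  rcases (head_le_of_le h.le).lt_or_eq with h0 | h0
  · exact lt_of_head_lt (by simpa using h0)
  · rw [inc, inc, h0, app_lt_app]; exact shift_one_lt h h0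

lemma inc_agree {n : ℕ} {c d : ℕ → ℕ} (h : Agree n c d) : Agree n (inc c) (inc d) := by
  intro i hi
  cases i with
  | zero => simp [h 0 hi]
  | succ i =>
    have h1 := congrFun (shift_inc c) i
    have h2 := congrFun (shift_inc d) i
    simp only [shift_apply] at h1 h2
    rw [h1, h2, h _ hi]

lemma isBin_inc {c : ℕ → ℕ} (h : IsBin c) (h0 : c 0 = 0) : IsBin (inc c) := by
  intro i
  cases i with
  | zero => simp [h0]
  | succ i =>
    have h1 := congrFun (shift_inc c) i
    simp only [shift_apply] at h1
    rw [h1]; exact h _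

lemma isBin_app {w : List ℕ} {c : ℕ → ℕ} (hw : ∀ x ∈ w, x ≤ 1) (hc : IsBin c) : IsBin (app w c) := by
  intro i
  by_cases h : i < w.length
  · rw [app_apply_lt h, List.getD_eq_getElem _ _ h]; exact hw _ (List.getElem_mem h)
  · simp only [app, if_neg h]; exact hc _

lemma isBin_morph (b : Bool) (c : ℕ → ℕ) : IsBin (morph (letter b) c) := by
  intro n
  induction n using Nat.strong_induction_on generalizing c with
  | _ n ih =>
    rw [morph_eq (letter_ne b)]
    by_cases h : n < (letter b (c 0)).length
    · rw [app_apply_lt h, List.getD_eq_getElem _ _ h]; exact letter_bin _ _ _ (List.getElem_mem h)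
    · have := List.length_pos_iff.2 (letter_ne b (c 0))
      simp only [app, if_neg h]; exact ih _ (by omega) _

lemma morph_head {b : Bool} {c : ℕ → ℕ} (h : c 0 = 0) : morph (letter b) c 0 = 0 := by
  rw [morph_eq (letter_ne b), h]
  rcases b with _ | _ <;> simp [letter]

lemma lam_head (c : ℕ → ℕ) : morph (letter false) c 0 = 0 := by
  rw [morph_eq (letter_ne _)]
  rcases c 0 with _ | _ <;> simp [letter]

lemma lam_zero {c : ℕ → ℕ} (h : c 0 = 0) :
    morph (letter false) c = app [0] (morph (letter false) (shift 1 c)) := by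
  rw [morph_eq (letter_ne _), h]; rfl

lemma lam_one {c : ℕ → ℕ} (h : c 0 = 1) :
    morph (letter false) c = app [0] (app [1] (morph (letter false) (shift 1 c))) := by
  rw [morph_eq (letter_ne _), h]; exact app_cons _ _ _

lemma rho_zero {c : ℕ → ℕ} (h : c 0 = 0) :
    morph (letter true) c = app [0] (app [1] (morph (letter true) (shift 1 c))) := by
  rw [morph_eq (letter_ne _), h]; exact app_cons _ _ _

lemma rho_one {c : ℕ → ℕ} (h : c 0 = 1) :
    morph (letter true) c = app [1] (morph (letter true) (shift 1 c)) := by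
  rw [morph_eq (letter_ne _), h]; rfl

/-- A first difference `0 < 1` becomes `00 < 01` under `λ`, whose images all begin with `0`, and `01
< 1` under `ρ`. The factor `2` bounds the length of the image of a letter. -/
lemma morph_ltTo (b : Bool) {c d : ℕ → ℕ} (hd : IsBin d) {n : ℕ} (h : LtTo n c d) :
    LtTo (2 * n) (morph (letter b) c) (morph (letter b) d) := by
  obtain ⟨k, hk, h1, h2⟩ := h
  refine LtTo.mono (n := 2 * (k + 1)) ?_ (by omega)
  clear hk
  induction k generalizing c d with
  | zero =>
    have h3 := hd 0
    have hc0 : c 0 = 0 := by omega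
    have hd0 : d 0 = 1 := by omega
    rcases b with _ | _
    · rw [lam_zero hc0, lam_one hd0]
      refine LtTo.mono (n := 1 + 1) (LtTo.of_add (agree_app [0] _ _) ?_) (by omega)
      rw [shift_one_app_cons, shift_one_app_cons, app_nil, app_nil]
      exact ⟨0, one_pos, fun i hi => by omega, by rw [lam_head]; simp⟩
    · rw [rho_zero hc0, rho_one hd0]
      exact ⟨0, by omega, fun i hi => by omega, by simp⟩
  | succ k ih =>
    rw [morph_eq (letter_ne b), morph_eq (letter_ne b) d, h1 0 k.succ_pos]
    have h4 := ih (hd.shift 1) (h1.shift 1) h2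
    have h5 := letter_length_le b (d 0)
    refine LtTo.mono (n := (letter b (d 0)).length + 2 * (k + 1)) ?_ (by omega)
    exact LtTo.of_add (agree_app _ _ _) (by rw [shift_app, shift_app]; exact h4)

lemma morph_lt (b : Bool) {c d : ℕ → ℕ} (hd : IsBin d) (h : c <ₗ d) :
    morph (letter b) c <ₗ morph (letter b) d := by
  obtain ⟨k, h1, h2⟩ := lexlt_iff.1 h
  exact (morph_ltTo b hd ⟨k, k.lt_succ_self, h1, h2⟩).lt

lemma morph_le (b : Bool) {c d : ℕ → ℕ} (hd : IsBin d) (h : c ≤ₗ d) :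
    morph (letter b) c ≤ₗ morph (letter b) d := by
  rcases h.lt_or_eq with h | h
  · exact (morph_lt b hd h).le
  · rw [toLex_inj] at h; rw [h]

lemma agree_of_morph_agree (b : Bool) {c d : ℕ → ℕ} (hc : IsBin c) (hd : IsBin d) {n : ℕ}
    (h : Agree (2 * n) (morph (letter b) c) (morph (letter b) d)) : Agree n c d := by
  rcases ltTo_or_leTo n c d with h1 | h1 | h1
  · exact absurd (morph_ltTo b hd h1) h.symm.leTo.not_lt
  · exact absurd (morph_ltTo b hc h1) h.leTo.not_lt
  · exact h1.symm

/-- The upper bounds match because `λ(x⁺) = 0 λ(x)⁺` and `ρ(x⁺) = 1 ρ(x⁺)` up to replacing the left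
side by `ρ(x)⁺`, where `x⁺` is `inc x`. Monotonicity then covers the starts of letter images; the
only other position is the `1` inside an image `01`. -/
lemma morph_mem_shiftsBetween (b : Bool) {z e x : ℕ → ℕ} (hx : IsBin x) (he0 : e 0 = 0)
    (hx0 : x 0 = 0) (hz : z ∈ shiftsBetween e (inc x)) :
    morph (letter b) z ∈ shiftsBetween (morph (letter b) e) (inc (morph (letter b) x)) := by
  have hzb : IsBin z := fun i => by
    have := shiftsBetween_digit_le hz i
    simpa [hx0] using this
  have hib := isBin_inc hx hx0
  intro n
  obtain ⟨a, j, hj, -, hs⟩ := exists_shift_morph (letter_ne b) z n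
  have hj2 := hj.trans_le (letter_length_le b (z a))
  have hza : shift a z 0 = z a := by simp
  have h01 : z a = 0 ∨ z a = 1 := by have := hzb a; omega
  rw [hs]
  rcases (show j = 0 ∨ j = 1 by omega) with rfl | rfl
  · refine ⟨morph_le b (hzb.shift a) (hz a).1, ?_⟩
    rw [shift_zero]
    rcases b with _ | _
    · exact (lt_of_head_lt (by rw [lam_head]; simp)).le
    · have h1 : inc (morph (letter true) x) = app [1] (morph (letter true) (inc x)) := by
        rw [rho_one (c := inc x) (by simp [hx0]), rho_zero hx0, inc_app_cons, shift_inc]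
      rw [h1]
      exact (morph_le true hib (hz a).2).trans (le_const_cons (isBin_morph _ _))
  · rcases b with _ | _
    · have h1 : z a = 1 := by
        rcases h01 with h | h
        · rw [h] at hj; simp [letter] at hj
        · exact h
      refine ⟨(lt_of_head_lt ?_).le, ?_⟩
      · rw [lam_head, lam_one (by rw [hza, h1]), shift_one_app_cons]; simp
      · have h2 := morph_le false hib (hz a).2
        have h3 := shift_one_le h2 (by rw [lam_head, lam_head])
        rw [lam_one (c := inc x) (by simp [hx0]), shift_inc] at h3
        rw [lam_zero hx0, inc_app_cons]
        simpa using h3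
    · have h1 : z a = 0 := by
        rcases h01 with h | h
        · exact h
        · rw [h] at hj; simp [letter] at hj
      refine ⟨(lt_of_head_lt ?_).le, ?_⟩
      · rw [morph_head he0, rho_zero (by rw [hza, h1]), shift_one_app_cons]; simp
      · rw [rho_zero (by rw [hza, h1]), shift_one_app_cons, app_nil, rho_zero hx0, inc_app_cons,
          shift_shift, app_le_app]
        have h2 := morph_le true hib (hz (1 + a)).2
        rwa [rho_one (c := inc x) (by simp [hx0]), shift_inc] at h2

/-! ### Farey words -/

/-- The composition of the Farey substitutions along a path, on sequences. -/
def farSeq (w : List Bool) (c : ℕ → ℕ) : ℕ → ℕ := w.foldr (fun b c => morph (letter b) c) c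

/-- The composition of the Farey substitutions along a path, on words. -/
def farWord (w : List Bool) (v : List ℕ) : List ℕ := w.foldr (fun b v => v.flatMap (letter b)) v

@[simp] lemma farSeq_nil (c : ℕ → ℕ) : farSeq [] c = c := rfl
@[simp] lemma farSeq_cons (b : Bool) (w : List Bool) (c : ℕ → ℕ) :
    farSeq (b :: w) c = morph (letter b) (farSeq w c) := rfl
@[simp] lemma farWord_cons (b : Bool) (w : List Bool) (v : List ℕ) :
    farWord (b :: w) v = (farWord w v).flatMap (letter b) := rfl

lemma farSeq_append (w w' : List Bool) (c : ℕ → ℕ) :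
    farSeq (w ++ w') c = farSeq w (farSeq w' c) := by
  induction w with
  | nil => rfl
  | cons b w ih => rw [List.cons_append, farSeq_cons, farSeq_cons, ih]

lemma farWord_path_append (w w' : List Bool) (v : List ℕ) :
    farWord (w ++ w') v = farWord w (farWord w' v) := by
  induction w with
  | nil => rfl
  | cons b w ih => rw [List.cons_append, farWord_cons, farWord_cons, ih]

lemma farWord_append (w : List Bool) (u v : List ℕ) :
    farWord w (u ++ v) = farWord w u ++ farWord w v := by
  induction w with
  | nil => rfl
  | cons b w ih => simp [ih]

lemma length_le_farWord (w : List Bool) (v : List ℕ) : v.length ≤ (farWord w v).length := by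
  induction w with
  | nil => rfl
  | cons b w ih =>
    refine ih.trans ?_
    rw [farWord_cons]
    generalize farWord w v = u
    induction u with
    | nil => simp
    | cons a u ih =>
      have := List.length_pos_iff.2 (letter_ne b a)
      simp only [List.flatMap_cons, List.length_append, List.length_cons]; omega

lemma farWord_ne (w : List Bool) {v : List ℕ} (hv : v ≠ []) : farWord w v ≠ [] := by
  rw [← List.length_pos_iff] at hv ⊢; exact hv.trans_le (length_le_farWord w v)

lemma farSeq_app (w : List Bool) (v : List ℕ) (c : ℕ → ℕ) :
    farSeq w (app v c) = app (farWord w v) (farSeq w c) := by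
  induction w with
  | nil => rfl
  | cons b w ih => rw [farSeq_cons, ih, morph_app (letter_ne b)]; rfl

lemma farSeq_per (w : List Bool) {v : List ℕ} (hv : v ≠ []) :
    farSeq w (per v) = per (farWord w v) :=
  eq_per (farWord_ne w hv) (by conv_lhs => rw [per_eq v, farSeq_app])

lemma isBin_farSeq (w : List Bool) {c : ℕ → ℕ} (hc : IsBin c) : IsBin (farSeq w c) := by
  cases w with
  | nil => exact hc
  | cons b w => exact isBin_morph b _

lemma farSeq_head (w : List Bool) {c : ℕ → ℕ} (hc : c 0 = 0) : farSeq w c 0 = 0 := by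
  induction w with
  | nil => exact hc
  | cons b w ih => exact morph_head ih

lemma farSeq_lt (w : List Bool) {c d : ℕ → ℕ} (hd : IsBin d) (h : c <ₗ d) :
    farSeq w c <ₗ farSeq w d := by
  induction w with
  | nil => exact h
  | cons b w ih => exact morph_lt b (isBin_farSeq w hd) ih

lemma farSeq_le (w : List Bool) {c d : ℕ → ℕ} (hd : IsBin d) (h : c ≤ₗ d) :
    farSeq w c ≤ₗ farSeq w d := by
  rcases h.lt_or_eq with h | h
  · exact (farSeq_lt w hd h).le
  · rw [toLex_inj] at h; rw [h]

/-- The shape of Farey words: `r = 0m1`, `𝕃(r) = 1m0`, and `𝕃(r)^∞ = 1y`, `x = 0y`. -/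
structure FareyShape (r : List ℕ) (x : ℕ → ℕ) : Prop where
  lyndon : IsBinLyndon r
  shape : ∃ m, r = 0 :: m ++ [1] ∧ maxRot r = 1 :: m ++ [0]
  isBin : IsBin x
  head : x 0 = 0
  per_max : per (maxRot r) = inc x

/-- Both images under `ρ` end in `1`. So a `1` may be put before the image of a shift and the result
is still a shift of the image, as the maximal rotation requires in the case of `ρ`. -/
lemma rho_preceded (z : ℕ → ℕ) (k : ℕ) :
    ∃ n, shift n (morph (letter true) z) = app [1] (morph (letter true) (shift (k + 1) z)) := by
  have h1 := shift_morph (letter_ne true) z k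
  have h2 : shift 1 (shift k z) = shift (k + 1) z := by rw [shift_shift, add_comm]
  rw [morph_eq (letter_ne true) (shift k z), h2] at h1
  rcases h3 : shift k z 0 with _ | d
  · refine ⟨1 + ((initial k z).flatMap (letter true)).length, ?_⟩
    rw [← shift_shift, h1, h3]
    exact shift_one_app_cons _ _ _
  · refine ⟨((initial k z).flatMap (letter true)).length, ?_⟩
    rw [h1, h3]; rfl

/-- The word `0m1` becomes `0 λ(m)0 1` or `0 1ρ(m) 1`, which determines the new middle part. Since
`x` is `0m0` followed by `inc x`, the candidate `inc` of the image of `x` has period `1m'0`, and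
`morph_mem_shiftsBetween` shows that it dominates all rotations. -/
lemma FareyShape.step {r : List ℕ} {x : ℕ → ℕ} (h : FareyShape r x) (b : Bool) :
    FareyShape (r.flatMap (letter b)) (morph (letter b) x) := by
  obtain ⟨m, hm1, hm2⟩ := h.shape
  set r' := r.flatMap (letter b) with hr'
  have hz : morph (letter b) (per r) = per r' := morph_per (letter_ne b) h.lyndon.lyndon.ne
  have hbin' : ∀ y ∈ r', y ≤ 1 := fun y hy => by
    obtain ⟨a, -, ha⟩ := List.mem_flatMap.1 hy
    exact letter_bin b a y ha
  have hlen : r.length ≤ r'.length := length_le_farWord [b] r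
  have hne' : r' ≠ [] := flatMap_ne (letter_ne b) h.lyndon.lyndon.ne
  have hhead' : per r' 0 = 0 := by rw [← hz]; exact morph_head h.lyndon.head
  -- the shape
  set m' := (if b then 1 :: m.flatMap (letter b) else m.flatMap (letter b) ++ [0]) with hm'
  have hshape1 : r' = 0 :: m' ++ [1] := by
    rw [hr', hm1, hm']
    rcases b with _ | _ <;> simp [letter, List.flatMap_append]
  have hx1 : x = app (0 :: m ++ [0]) (inc x) := by
    apply inc_injective
    rw [List.cons_append, inc_app_cons]
    have h1 := per_eq (maxRot r)
    rwa [h.per_max, hm2] at h1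
  have hx2 : inc (morph (letter b) x) = app (1 :: m' ++ [0]) (inc (morph (letter b) x)) := by
    conv_lhs => rw [hx1, morph_app (letter_ne b)]
    rcases b with _ | _
    · have h1 : morph (letter false) (inc x) = app [0] (inc (morph (letter false) x)) := by
        rw [lam_one (c := inc x) (by simp [h.head]), shift_inc, lam_zero h.head, inc_app_cons]
      rw [h1, ← app_append]
      simp only [letter, hm', List.cons_append, List.flatMap_cons, List.flatMap_append,
        List.flatMap_nil, List.nil_append, List.append_assoc, inc_app_cons]
      simp
    · have h1 : inc (morph (letter true) x) = app [1] (morph (letter true) (inc x)) := by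
        rw [rho_one (c := inc x) (by simp [h.head]), shift_inc, rho_zero h.head, inc_app_cons]
      rw [h1, ← app_append]
      simp only [letter, hm', List.cons_append, List.flatMap_cons, List.flatMap_append,
        List.flatMap_nil, List.nil_append, List.append_assoc, inc_app_cons]
      simp
  have hper : inc (morph (letter b) x) = per (1 :: m' ++ [0]) := eq_per (by simp) hx2
  have hmax : maxRot r' = 1 :: m' ++ [0] := by
    refine eq_maxRot (by rw [hshape1]; simp) ?_ ?_
    · rw [← hper, ← hz]
      obtain ⟨k, hk⟩ := exists_per_maxRot r
      rcases b with _ | _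
      · have h1 : morph (letter false) (inc x) = app [0] (inc (morph (letter false) x)) := by
          rw [lam_one (c := inc x) (by simp [h.head]), shift_inc, lam_zero h.head, inc_app_cons]
        refine ⟨1 + ((initial k (per r)).flatMap (letter false)).length, ?_⟩
        rw [← shift_shift, shift_morph (letter_ne _), ← hk, h.per_max, h1]
        simp
      · have h1 : inc (morph (letter true) x) = app [1] (morph (letter true) (inc x)) := by
          rw [rho_one (c := inc x) (by simp [h.head]), shift_inc, rho_zero h.head, inc_app_cons]
        obtain ⟨n, hn⟩ := rho_preceded (per r) (k + r.length - 1)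
        refine ⟨n, ?_⟩
        have h2 := h.lyndon.two_le
        rw [hn, h1, ← h.per_max, hk, show k + r.length - 1 + 1 = k + r.length by omega,
          ← shift_shift, shift_per]
    · intro k
      rw [← hper, ← hz]
      refine (morph_mem_shiftsBetween b h.isBin h.lyndon.head h.head (fun n => ?_) k).2
      rw [← h.per_max]
      exact ⟨h.lyndon.lyndon.min_le n, shift_per_le_maxRot r n⟩
  refine ⟨⟨⟨hne', fun i hi him => ?_, ?_⟩, hbin', h.lyndon.two_le.trans hlen⟩,
    ⟨m', hshape1, hmax⟩, isBin_morph _ _, morph_head h.head, by rw [hmax, hper]⟩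
  · obtain ⟨a, j, hj, hij, hs⟩ := exists_shift_morph (letter_ne b) (per r) i
    rw [← hz, hs]
    have hj2 := hj.trans_le (letter_length_le b (per r a))
    rcases (show j = 0 ∨ j = 1 by omega) with rfl | rfl
    · refine morph_lt b (h.lyndon.isBin.shift a) (h.lyndon.lyndon.min a ?_ ?_)
      · rcases Nat.eq_zero_or_pos a with h0 | h0
        · subst h0; simp [initial] at hij; omega
        · exact h0
      · by_contra hge
        have h1 : initial a (per r) = r ++ initial (a - r.length) (per r) := by
          have h2 := initial_add r.length (a - r.length) (per r)
          rw [show r.length + (a - r.length) = a by omega, shift_per] at h2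
          rw [h2, initial_per]
        rw [h1, List.flatMap_append, List.length_append, ← hr'] at hij
        omega
    · refine lt_of_head_lt ?_
      rw [morph_head h.lyndon.head]
      have : shift 1 (morph (letter b) (shift a (per r))) 0 = 1 := by
        rw [morph_eq (letter_ne b), show shift a (per r) 0 = per r a by simp]
        rcases b with _ | _ <;> rcases h3 : per r a with _ | _ <;> rw [h3] at hj <;>
          simp [letter, app] at hj ⊢
      omega
  · rw [per_last hne', hshape1, List.getLastD_concat]; exact one_ne_zero

end BetaHole

namespace BetaHole
open Set
open scoped ENNReal

/-! ### Farey words as images along paths -/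

lemma fareyShape_base : FareyShape [0, 1] (app [0] (per [0, 1])) := by
  have hb : ∀ x ∈ [0, 1], x ≤ 1 := by simp
  have h1 : per [0, 1] 0 = 0 := rfl
  have h2 : per [0, 1] 1 = 1 := rfl
  refine ⟨⟨⟨by simp, fun i hi hi2 => ?_, ?_⟩, hb, by simp⟩, ⟨[], rfl, by decide⟩,
    isBin_app (by simp) (isBin_per hb), by simp, ?_⟩
  · obtain rfl : i = 1 := by simp at hi2; omega
    exact lt_of_head_lt (by simp [h1, h2])
  · simp [h2]
  · rw [show maxRot [0, 1] = [1, 0] by decide, inc_app_cons]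
    refine (eq_per (by simp) ?_).symm
    conv_lhs => rw [per_eq [0, 1]]
    rw [← app_append, ← app_append]; rfl

lemma fareyShape_path (w : List Bool) :
    FareyShape (farWord w [0, 1]) (farSeq w (app [0] (per [0, 1]))) := by
  induction w with
  | nil => exact fareyShape_base
  | cons b w ih => exact ih.step b

lemma fareyRefine_cons_cons (v w : List ℕ) (l : List (List ℕ)) :
    fareyRefine (v :: w :: l) = v :: (v ++ w) :: fareyRefine (w :: l) := by rw [fareyRefine]

lemma exists_fareyRefine_cons (w : List ℕ) (l : List (List ℕ)) :
    ∃ t, fareyRefine (w :: l) = w :: t := by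
  cases l with
  | nil => exact ⟨[], by simp [fareyRefine]⟩
  | cons a l => exact ⟨_, fareyRefine_cons_cons _ _ _⟩

lemma infix_fareyRefine (l₁ l₂ : List (List ℕ)) (v w : List ℕ) :
    [v, v ++ w, w] <:+: fareyRefine (l₁ ++ v :: w :: l₂) := by
  induction l₁ with
  | nil =>
    obtain ⟨t, ht⟩ := exists_fareyRefine_cons w l₂
    rw [List.nil_append, fareyRefine_cons_cons, ht]
    exact ⟨[], t, rfl⟩
  | cons a l₁ ih =>
    obtain ⟨b, t, ht⟩ : ∃ b t, l₁ ++ v :: w :: l₂ = b :: t := by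
      cases l₁ <;> simp
    rw [List.cons_append, ht, fareyRefine_cons_cons, ← ht]
    exact ih.trans ⟨[a, a ++ b], [], by simp⟩

/-- Neighbours are the images of `0` and `1` along a path. Inserting the concatenation replaces the
pair by the images of `(0, 01)` and `(01, 1)`, that is, it appends `λ` or `ρ` to the path. -/
lemma exists_infix_fareyList (w : List Bool) :
    ∃ n, [farWord w [0], farWord w [1]] <:+: fareyList n := by
  induction w using List.reverseRecOn with
  | nil => exact ⟨0, List.infix_rfl⟩
  | append_singleton w b ih =>
    obtain ⟨n, l₁, l₂, h⟩ := ih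
    refine ⟨n + 1, ?_⟩
    rw [farWord_path_append, farWord_path_append, fareyList, ← h]
    have h1 := infix_fareyRefine l₁ l₂ (farWord w [0]) (farWord w [1])
    rw [show l₁ ++ [farWord w [0], farWord w [1]] ++ l₂ =
      l₁ ++ farWord w [0] :: farWord w [1] :: l₂ by simp]
    rcases b with _ | _
    · have h2 : farWord [false] [1] = [0] ++ [1] := rfl
      have h3 : farWord [false] [0] = [0] := rfl
      rw [h2, h3, farWord_append]
      exact List.IsInfix.trans ⟨[], [farWord w [1]], rfl⟩ h1
    · have h2 : farWord [true] [0] = [0] ++ [1] := rfl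
      have h3 : farWord [true] [1] = [1] := rfl
      rw [h2, h3, farWord_append]
      exact List.IsInfix.trans ⟨[farWord w [0]], [], rfl⟩ h1

lemma farWord_mem_farey (w : List Bool) : farWord w [0, 1] ∈ farey := by
  obtain ⟨n, l₁, l₂, h⟩ := exists_infix_fareyList w
  have h1 := infix_fareyRefine l₁ l₂ (farWord w [0]) (farWord w [1])
  rw [show l₁ ++ farWord w [0] :: farWord w [1] :: l₂ =
    l₁ ++ [farWord w [0], farWord w [1]] ++ l₂ by simp, h, ← farWord_append] at h1
  have hlen := length_le_farWord w [0, 1]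
  refine ⟨n + 1, by omega, h1.subset (by simp), ?_, ?_⟩ <;>
  · intro h0; rw [h0] at hlen; simp at hlen

/-- Neighbours in the Farey lists. -/
def FareyPair (u v : List ℕ) : Prop := ∃ w, u = farWord w [0] ∧ v = farWord w [1]

lemma isChain_fareyRefine {l : List (List ℕ)} (h : l.IsChain FareyPair) :
    (fareyRefine l).IsChain FareyPair := by
  induction l with
  | nil => simp [fareyRefine]
  | cons a l ih =>
    cases l with
    | nil => simp [fareyRefine]
    | cons b l =>
      rw [List.isChain_cons_cons] at h
      obtain ⟨t, ht⟩ := exists_fareyRefine_cons b l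
      have h1 := ih h.2
      rw [fareyRefine_cons_cons, ht] at *
      obtain ⟨w, rfl, rfl⟩ := h.1
      rw [← farWord_append]
      refine List.isChain_cons_cons.2 ⟨⟨w ++ [false], ?_, ?_⟩,
        List.isChain_cons_cons.2 ⟨⟨w ++ [true], ?_, ?_⟩, h1⟩⟩ <;>
      · rw [farWord_path_append]; rfl

lemma mem_fareyRefine {l : List (List ℕ)} (h : l.IsChain FareyPair) {x : List ℕ}
    (hx : x ∈ fareyRefine l) : x ∈ l ∨ ∃ w, x = farWord w [0, 1] := by
  induction l with
  | nil => simp [fareyRefine] at hx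
  | cons a l ih =>
    cases l with
    | nil => simp [fareyRefine] at hx; simp [hx]
    | cons b l =>
      rw [List.isChain_cons_cons] at h
      rw [fareyRefine_cons_cons] at hx
      rcases List.mem_cons.1 hx with rfl | hx
      · simp
      rcases List.mem_cons.1 hx with rfl | hx
      · obtain ⟨w, rfl, rfl⟩ := h.1
        exact Or.inr ⟨w, by rw [← farWord_append]; rfl⟩
      · rcases ih h.2 hx with h' | h'
        · exact Or.inl (List.mem_cons_of_mem _ h')
        · exact Or.inr h'

lemma isChain_fareyList (n : ℕ) : (fareyList n).IsChain FareyPair := by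
  induction n with
  | zero => exact List.isChain_cons_cons.2 ⟨⟨[], rfl, rfl⟩, by simp⟩
  | succ n ih => exact isChain_fareyRefine ih

lemma mem_farey_iff {r : List ℕ} : r ∈ farey ↔ ∃ w, r = farWord w [0, 1] := by
  refine ⟨?_, fun ⟨w, hw⟩ => hw ▸ farWord_mem_farey w⟩
  rintro ⟨n, -, hn, h0, h1⟩
  have : ∀ n, r ∈ fareyList n → r = [0] ∨ r = [1] ∨ ∃ w, r = farWord w [0, 1] := by
    intro n
    induction n with
    | zero => intro h; simp [fareyList] at h; tauto
    | succ n ih =>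
      intro h
      rcases mem_fareyRefine (isChain_fareyList n) h with h | h
      · exact ih h
      · exact Or.inr (Or.inr h)
  rcases this n hn with h | h | h
  · exact absurd h h0
  · exact absurd h h1
  · exact h

lemma fareyShape_of_mem {r : List ℕ} (h : r ∈ farey) : ∃ x, FareyShape r x := by
  obtain ⟨w, rfl⟩ := mem_farey_iff.1 h
  exact ⟨_, fareyShape_path w⟩

lemma isBinLyndon_of_mem {r : List ℕ} (h : r ∈ farey) : IsBinLyndon r :=
  let ⟨_, hx⟩ := fareyShape_of_mem h; hx.lyndon

lemma FareyShape.substSeq_zero_eq {r : List ℕ} {x : ℕ → ℕ} (h : FareyShape r x) :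
    substSeq r (fun _ => 0) = x := by
  obtain ⟨m, h1, h2⟩ := h.shape
  rw [substSeq_zero h.lyndon.lyndon, evPer_eq]
  apply inc_injective
  have h3 : minus r = 0 :: (m ++ [0]) := by
    rw [h1]; simp only [minus, List.dropLast_concat, List.getLastD_concat]; rfl
  rw [h3, inc_app_cons, ← h.per_max]
  conv_rhs => rw [per_eq, h2]
  rw [h2]; rfl

/-! ### Sets of positive dimension -/

/-- The pair `(c, d)` is a limit of pairs `(e, f)` with `f < d` such that the set of sequences with
all shifts between `e` and `f` has positive dimension. -/
def Rich (c d : ℕ → ℕ) : Prop :=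
  ∀ N, ∃ e f, Agree N e c ∧ f <ₗ d ∧ 0 < seqDim (shiftsBetween e f)

/-- A version of `Rich` for binary sequences. -/
def RichBin (x : ℕ → ℕ) : Prop :=
  ∀ N, ∃ e x', Agree N e x ∧ e 0 = 0 ∧ IsBin x' ∧ x' 0 = 0 ∧ x' <ₗ x ∧
    0 < seqDim (shiftsBetween e (inc x'))

lemma isBin_of_mem {e x z : ℕ → ℕ} (hx : x 0 = 0) (hz : z ∈ shiftsBetween e (inc x)) : IsBin z :=
  fun i => by simpa [hx] using shiftsBetween_digit_le hz i

lemma seqDim_morph_pos (b : Bool) {e x : ℕ → ℕ} (hx : IsBin x) (he0 : e 0 = 0) (hx0 : x 0 = 0)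
    (h : 0 < seqDim (shiftsBetween e (inc x))) :
    0 < seqDim (shiftsBetween (morph (letter b) e) (inc (morph (letter b) x))) := by
  refine (seqDim_image_pos (m := 2) two_pos (fun c hc d hd n hn =>
    agree_of_morph_agree b (isBin_of_mem hx0 hc) (isBin_of_mem hx0 hd) hn) h).trans_le
    (seqDim_mono ?_)
  rintro _ ⟨z, hz, rfl⟩
  exact morph_mem_shiftsBetween b hx he0 hx0 hz

lemma RichBin.morph {x : ℕ → ℕ} (h : RichBin x) (hx : IsBin x) (b : Bool) :
    RichBin (morph (letter b) x) := by
  intro N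
  obtain ⟨e, x', h1, h2, h3, h4, h5, h6⟩ := h N
  exact ⟨_, _, morph_agree (letter_ne b) h1, morph_head h2, isBin_morph b x', morph_head h4,
    morph_lt b hx h5, seqDim_morph_pos b h3 h2 h4 h6⟩

lemma isBin_zero_one : IsBin (app [0] fun _ => 1) := isBin_app (by simp) fun _ => le_rfl

lemma rho_ones : morph (letter true) (fun _ => 1) = fun _ => 1 := by
  rw [← per_singleton 1, morph_per (letter_ne true) (by simp)]; rfl

lemma rho_zero_ones : morph (letter true) (app [0] fun _ => 1) = app [0] fun _ => 1 := by
  rw [rho_zero (by simp), shift_one_app_cons, app_nil, rho_ones,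
    show app [1] (fun _ => 1) = fun _ => 1 from cons_shift fun _ => 1]

lemma lam_zero_ones : morph (letter false) (app [0] fun _ => 1) = app [0] (per [0, 1]) := by
  rw [lam_zero (by simp), shift_one_app_cons, app_nil, ← per_singleton 1,
    morph_per (letter_ne false) (by simp)]
  rfl

/-- The full binary shift lies between `0^∞` and `1^∞`, and `λ` carries it below the smaller bound
`inc (0(01)^∞)`. As `ρ` fixes `01^∞`, each application of `ρ` keeps the upper bound strictly smaller
and lengthens the agreement of the lower bound with `01^∞` by a digit. -/
lemma richBin_base : RichBin (app [0] fun _ => 1) := by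
  have key : ∀ N, ∃ e x', Agree (N + 1) e (app [0] fun _ => 1) ∧ e 0 = 0 ∧ IsBin x' ∧ x' 0 = 0 ∧
      x' <ₗ (app [0] fun _ => 1) ∧ 0 < seqDim (shiftsBetween e (inc x')) := by
    intro N
    induction N with
    | zero =>
      refine ⟨fun _ => 0, app [0] (per [0, 1]), fun i hi => ?_, rfl, fareyShape_base.isBin, by simp,
        ?_, ?_⟩
      · obtain rfl : i = 0 := by omega
        simp
      · rw [app_lt_app]; exact lt_of_head_lt Nat.zero_lt_one
      · have h0 := seqDim_morph_pos false (e := fun _ => 0) isBin_zero_one rfl (by simp) ?_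
        · rw [lam_zero_ones, ← per_singleton 0, morph_per (letter_ne false) (by simp)] at h0
          rw [← per_singleton 0]
          exact h0
        · refine seqDim_bin_pos.trans_le (seqDim_mono fun c hc n => ⟨zero_le_seq _, ?_⟩)
          rw [inc_app_cons, show app [0 + 1] (fun _ => 1) = fun _ => 1 from cons_shift fun _ => 1]
          exact le_const (IsBin.shift hc n)
    | succ N ih =>
      obtain ⟨e, x', h1, h2, h3, h4, h5, h6⟩ := ih
      refine ⟨_, _, ?_, morph_head h2, isBin_morph true x', morph_head h4, ?_,
        seqDim_morph_pos true h3 h2 h4 h6⟩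
      · rw [← rho_zero_ones, rho_zero h2, rho_zero (c := app [0] fun _ => 1) (by simp),
          ← app_append, ← app_append]
        have := morph_agree (letter_ne true) (h1.shift 1)
        exact (this.app ([0] ++ [1])).mono (by simp; omega)
      · have := morph_lt true isBin_zero_one h5
        rwa [rho_zero_ones] at this
  intro N
  obtain ⟨e, x', h1, h2⟩ := key N
  exact ⟨e, x', h1.mono (Nat.le_succ N), h2⟩

lemma richBin_path (w : List Bool) : RichBin (farSeq w (app [0] (per [0, 1]))) := by
  induction w with
  | nil => rw [farSeq_nil, ← lam_zero_ones]; exact richBin_base.morph isBin_zero_one false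
  | cons b w ih => exact ih.morph (isBin_farSeq w fareyShape_base.isBin) b

lemma RichBin.substSeq {x : ℕ → ℕ} (h : RichBin x) (hx : IsBin x) (hx0 : x 0 = 0) {S : List ℕ}
    (hS : IsLyndon S) : Rich (substSeq S x) (substSeq S (inc x)) := by
  intro N
  obtain ⟨e, x', h1, h2, h3, h4, h5, h6⟩ := h N
  refine ⟨BetaHole.substSeq S e, BetaHole.substSeq S (inc x'),
    (substSeq_agree h1).mono (Nat.le_mul_of_pos_left _ hS.length_pos),
    substSeq_lt hS (isBin_inc hx hx0) (inc_lt h5),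
    (seqDim_image_pos (m := S.length) hS.length_pos (fun c hc d hd n hn =>
      agree_of_substSeq_agree hS (isBin_of_mem h4 hc) (isBin_of_mem h4 hd) hn) h6).trans_le
      (seqDim_mono ?_)⟩
  rintro _ ⟨z, hz, rfl⟩
  exact substSeq_mem_shiftsBetween hS (isBin_of_mem h4 hz) (isBin_inc h3 h4) h2 (by simp [h4]) hz

/-- Adds `k` to every digit. -/
def raise (k : ℕ) (c : ℕ → ℕ) : ℕ → ℕ := fun n => c n + k

lemma raise_lt {k : ℕ} {c d : ℕ → ℕ} (h : c <ₗ d) : raise k c <ₗ raise k d := by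
  obtain ⟨n, h1, h2⟩ := lexlt_iff.1 h
  exact ⟨n, fun i hi => by simp [raise, h1 i hi], by simpa [raise] using h2⟩

lemma raise_le {k : ℕ} {c d : ℕ → ℕ} (h : c ≤ₗ d) : raise k c ≤ₗ raise k d := by
  rcases h.lt_or_eq with h | h
  · exact (raise_lt h).le
  · rw [toLex_inj] at h; rw [h]

lemma raise_agree {k n : ℕ} {c d : ℕ → ℕ} : Agree n (raise k c) (raise k d) ↔ Agree n c d := by
  simp [Agree, raise]

lemma raise_app (k : ℕ) (w : List ℕ) (c : ℕ → ℕ) :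
    raise k (app w c) = app (shiftDigits k w) (raise k c) := by
  funext n
  by_cases h : n < w.length
  · simp [raise, app, shiftDigits, h]
  · simp [raise, app, shiftDigits, h]

lemma raise_per (k : ℕ) {w : List ℕ} (hw : w ≠ []) : raise k (per w) = per (shiftDigits k w) :=
  eq_per (by simpa [shiftDigits] using hw) (by conv_lhs => rw [per_eq w, raise_app])

lemma raise_inc (k : ℕ) (c : ℕ → ℕ) : raise k (inc c) = inc (raise k c) := by
  rw [inc, raise_app, inc]
  simp [shiftDigits, raise, add_right_comm]
  rfl

lemma RichBin.raise {x : ℕ → ℕ} (h : RichBin x) (k : ℕ) :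
    Rich (raise k x) (inc (raise k x)) := by
  intro N
  obtain ⟨e, x', h1, h2, h3, h4, h5, h6⟩ := h N
  refine ⟨BetaHole.raise k e, BetaHole.raise k (inc x'), raise_agree.2 h1, ?_,
    (seqDim_image_pos (f := BetaHole.raise k) (m := 1) one_pos (fun c hc d hd n hn => ?_) h6).trans_le
      (seqDim_mono ?_)⟩
  · rw [← raise_inc]; exact raise_lt (inc_lt h5)
  · rw [one_mul, raise_agree] at hn; exact hn
  · rintro _ ⟨z, hz, rfl⟩ n
    exact ⟨raise_le (hz n).1, raise_le (hz n).2⟩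

/-! ### Extended Farey words -/

/-- The properties of extended Farey words that are used. -/
structure ExtShape (s : List ℕ) : Prop where
  lyndon : IsLyndon s
  shape : ∃ a q, s = a :: q ∧ plus (maxRot s) = (a + 1) :: q
  inc_eq : inc (substSeq s fun _ => 0) = per (maxRot s)
  rich : Rich (substSeq s fun _ => 0) (per (maxRot s))

lemma maxRot_shiftDigits (k : ℕ) {w : List ℕ} (hw : w ≠ []) :
    maxRot (shiftDigits k w) = shiftDigits k (maxRot w) := by
  refine eq_maxRot (by simp [shiftDigits, maxRot_length]) ?_ fun n => ?_
  · obtain ⟨n, hn⟩ := exists_per_maxRot w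
    exact ⟨n, by rw [← raise_per k hw, ← raise_per k (maxRot_ne hw), hn]; rfl⟩
  · rw [← raise_per k hw, ← raise_per k (maxRot_ne hw)]
    exact raise_le (shift_per_le_maxRot w n)

lemma plus_shiftDigits (k : ℕ) {w : List ℕ} (hw : w ≠ []) :
    plus (shiftDigits k w) = shiftDigits k (plus w) := by
  have h := dropLast_append hw
  rw [← h]
  simp only [shiftDigits, List.map_append, List.map_cons, List.map_nil, plus, List.dropLast_concat,
    List.getLastD_concat, add_right_comm]

lemma minus_shiftDigits (k : ℕ) {w : List ℕ} (hw : IsLyndon w) :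
    minus (shiftDigits k w) = shiftDigits k (minus w) := by
  have h := dropLast_append hw.ne
  have h1 := hw.last
  rw [per_last hw.ne] at h1
  rw [← h]
  simp only [shiftDigits, List.map_append, List.map_cons, List.map_nil, minus, List.dropLast_concat,
    List.getLastD_concat]
  congr 2; omega

lemma IsLyndon.shiftDigits {w : List ℕ} (hw : IsLyndon w) (k : ℕ) :
    IsLyndon (shiftDigits k w) := by
  have hl : (BetaHole.shiftDigits k w).length = w.length := by simp [BetaHole.shiftDigits]
  refine ⟨by simpa [BetaHole.shiftDigits] using hw.ne, fun i h1 h2 => ?_, ?_⟩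
  · rw [← raise_per k hw.ne]; exact raise_lt (hw.min i h1 (hl ▸ h2))
  · rw [← raise_per k hw.ne, hl]
    have := hw.last
    simp only [raise]; omega

lemma substSeq_zero_shiftDigits (k : ℕ) {w : List ℕ} (hw : IsLyndon w) :
    substSeq (shiftDigits k w) (fun _ => 0) = raise k (substSeq w fun _ => 0) := by
  rw [substSeq_zero hw, substSeq_zero (hw.shiftDigits k), maxRot_shiftDigits k hw.ne,
    minus_shiftDigits k hw, evPer_eq, evPer_eq, raise_app, raise_per k hw.maxRot_ne]

lemma ExtShape.mk_shift {s : List ℕ} (k : ℕ) (hs : IsLyndon s)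
    (h1 : ∃ a q, s = a :: q ∧ plus (maxRot s) = (a + 1) :: q)
    (h2 : inc (substSeq s fun _ => 0) = per (maxRot s)) (h3 : RichBin (substSeq s fun _ => 0)) :
    ExtShape (shiftDigits k s) := by
  have h4 : inc (substSeq (shiftDigits k s) fun _ => 0) = per (maxRot (shiftDigits k s)) := by
    rw [substSeq_zero_shiftDigits k hs, maxRot_shiftDigits k hs.ne, ← raise_per k hs.maxRot_ne,
      ← h2, raise_inc]
  refine ⟨hs.shiftDigits k, ?_, h4, ?_⟩
  · obtain ⟨a, q, h5, h6⟩ := h1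
    refine ⟨a + k, shiftDigits k q, by rw [h5]; rfl, ?_⟩
    rw [maxRot_shiftDigits k hs.ne, plus_shiftDigits k hs.maxRot_ne, h6]
    simp [shiftDigits, add_right_comm]
  · rw [← h4, substSeq_zero_shiftDigits k hs]
    exact h3.raise k

lemma isLyndon_one : IsLyndon [1] :=
  ⟨by simp, fun i h1 h2 => by simp at h2; omega, by simp⟩

lemma substSeq_one_word : substSeq [1] (fun _ => 0) = app [0] fun _ => 1 := by
  rw [substSeq_zero isLyndon_one, evPer_eq, show maxRot [1] = [1] by decide, per_singleton]; rfl

lemma extShape_of_mem {s : List ℕ} (h : s ∈ fareyExt) : ExtShape s := by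
  obtain ⟨k, v, hv, rfl⟩ := h
  rcases hv with hv | rfl
  · obtain ⟨w, rfl⟩ := mem_farey_iff.1 hv
    have h := fareyShape_path w
    obtain ⟨m, h1, h2⟩ := h.shape
    refine ExtShape.mk_shift k h.lyndon.lyndon ⟨0, m ++ [1], by rw [h1]; rfl, ?_⟩ ?_ ?_
    · rw [h2]; simp only [plus, List.dropLast_concat, List.getLastD_concat]; rfl
    · rw [h.substSeq_zero_eq, h.per_max]
    · rw [h.substSeq_zero_eq]; exact richBin_path w
  · refine ExtShape.mk_shift k isLyndon_one ⟨1, [], rfl, by decide⟩ ?_ ?_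
    · rw [substSeq_one_word, inc_app_cons, show maxRot [1] = [1] by decide, per_singleton]
      exact cons_shift fun _ => 1
    · rw [substSeq_one_word]; exact richBin_base

lemma farey_subset_fareyExt {r : List ℕ} (h : r ∈ farey) : r ∈ fareyExt :=
  ⟨0, r, Or.inl h, by simp [shiftDigits]⟩

/-! ### Dimension and renormalization -/

/-- No word of the same length lies strictly between `A` and `A⁺`. The sequence starts with one of
them, and cancelling it keeps the corresponding bound. -/
lemma eq_app_or_eq_app_plus {A : List ℕ} (hA : A ≠ []) {x p q : ℕ → ℕ} (h1 : app A p ≤ₗ x)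
    (h2 : x ≤ₗ app (plus A) q) :
    (x = app A (shift A.length x) ∧ p ≤ₗ shift A.length x) ∨
      (x = app (plus A) (shift A.length x) ∧ shift A.length x ≤ₗ q) := by
  have hl := plus_length hA
  rcases leTo_of_le h1 A.length with h3 | h3
  · right
    have h4 := leTo_of_le h2 A.length
    have h5 : Agree A.length x (app (plus A) q) := by
      rcases h4 with h4 | h4
      · refine absurd h3 (LeTo.not_lt (h4.decr (e := app A p) ?_ ?_))
        · exact ((agree_app_per A p).mono (by omega)).trans (plus_agree hA q).symm
        · rw [plus_last hA, agree_app_per A p _ (by have := List.length_pos_iff.2 hA; omega)]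
      · exact h4
    have h6 := eq_app_of_agree (w := plus A) (by rw [hl]; exact h5)
    rw [hl] at h6
    refine ⟨h6, ?_⟩
    rw [h6, app_le_app] at h2
    exact h2
  · left
    have h6 := eq_app_of_agree h3.symm
    refine ⟨h6, ?_⟩
    rw [h6, app_le_app] at h1
    exact h1

/-- What is known about a sequence that follows a block for the letter `p`. -/
def Follows (s : List ℕ) (p : ℕ) (x : ℕ → ℕ) : Prop :=
  if p = 0 then per (maxRot s) ≤ₗ x else x ≤ₗ per s

/-- After `0` the sequence lies between `𝕃(s)^∞` and `𝕃(s)⁺s^∞`, after `1` between `s⁻𝕃(s)^∞` and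
`s^∞`. In both cases only two consecutive words can come next, and the bound left over is the one
required after the new letter. -/
lemma follows_step {s : List ℕ} (hs : IsLyndon s) {p : ℕ} {x : ℕ → ℕ} (hp : p ≤ 1)
    (h1 : substSeq s (fun _ => 0) ≤ₗ x) (h2 : x ≤ₗ substSeq s (fun _ => 1)) (h : Follows s p x) :
    ∃ d ≤ 1, x = app (block s p d) (shift s.length x) ∧ Follows s d (shift s.length x) := by
  rw [substSeq_zero hs, evPer_eq] at h1
  rw [substSeq_one hs, evPer_eq] at h2
  rcases (show p = 0 ∨ p = 1 by omega) with rfl | rfl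
  · have h' : per (maxRot s) ≤ₗ x := h
    rw [per_eq] at h'
    have := eq_app_or_eq_app_plus hs.maxRot_ne h' h2
    rw [maxRot_length] at this
    rcases this with h3 | h3
    · exact ⟨0, by omega, h3⟩
    · exact ⟨1, le_rfl, h3⟩
  · have h' : x ≤ₗ per s := h
    rw [per_eq] at h'
    have hne : minus s ≠ [] := by simp [minus]
    have := eq_app_or_eq_app_plus hne h1 (q := per s)
      (by rw [plus_minus hs.ne hs.last]; exact h')
    rw [minus_length hs.ne, plus_minus hs.ne hs.last] at this
    rcases this with h3 | h3
    · exact ⟨0, by omega, h3⟩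
    · exact ⟨1, le_rfl, h3⟩

lemma exists_eq_Phi {s : List ℕ} (hs : IsLyndon s) {p : ℕ} {x : ℕ → ℕ} (hp : p ≤ 1)
    (hx : x ∈ shiftsBetween (substSeq s fun _ => 0) (substSeq s fun _ => 1))
    (h : Follows s p x) : ∃ d, IsBin d ∧ x = Phi s p d := by
  classical
  have hstep : ∀ n q, q ≤ 1 → Follows s q (shift (n * s.length) x) → ∃ d ≤ 1,
      shift (n * s.length) x = app (block s q d) (shift ((n + 1) * s.length) x) ∧
        Follows s d (shift ((n + 1) * s.length) x) := by
    intro n q hq hf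
    have := follows_step hs hq (hx _).1 (hx _).2 hf
    rwa [shift_shift, show s.length + n * s.length = (n + 1) * s.length by ring] at this
  choose! g hg1 hg2 hg3 using hstep
  -- `P n` is the letter before the block number `n`, starting from `p`; the decoded sequence is `P`
  -- without its first term.
  let P : ℕ → ℕ := fun n => Nat.rec p (fun n q => g n q) n
  have hP : ∀ n, P n ≤ 1 ∧ Follows s (P n) (shift (n * s.length) x) := by
    intro n
    induction n with
    | zero => exact ⟨hp, by rw [Nat.zero_mul, shift_zero]; exact h⟩
    | succ n ih => exact ⟨hg1 n _ ih.1 ih.2, hg3 n _ ih.1 ih.2⟩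
  refine ⟨fun n => P (n + 1), fun n => (hP (n + 1)).1, funext fun i => ?_⟩
  have hm := hs.length_pos
  have h1 := hg2 (i / s.length) _ (hP (i / s.length)).1 (hP _).2
  have h2 := congrFun h1 (i % s.length)
  have hlt : i % s.length < s.length := Nat.mod_lt _ hm
  rw [shift_apply, app_apply_lt (by rwa [block_length hs.ne]), mul_comm, Nat.mod_add_div] at h2
  rw [h2, Phi]
  congr 2
  by_cases h0 : i / s.length = 0
  · rw [h0, if_pos rfl]; rfl
  · rw [if_neg h0, Nat.sub_add_cancel (Nat.one_le_iff_ne_zero.2 h0)]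

/-- At the start and where the letter changes, the shifted image is the image of the shift and the
order is reflected. Inside a run the bounds come from the position before: dropping a leading `0`
does not decrease a sequence, dropping a leading `1` does not increase it, and the other two
comparisons are decided by the first letter. -/
lemma mem_shiftsBetween_of_substSeq {s : List ℕ} (hs : IsLyndon s) {c₀ c₁ d : ℕ → ℕ}
    (hc₀ : IsBin c₀) (h₀ : c₀ 0 = 0) (h₁ : c₁ 0 = 1) (hd : IsBin d)
    (h : substSeq s d ∈ shiftsBetween (substSeq s c₀) (substSeq s c₁)) :
    d ∈ shiftsBetween c₀ c₁ := by
  have key : ∀ i, (i = 0 ∨ d (i - 1) ≠ d i) →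
      shift (i * s.length) (substSeq s d) = substSeq s (shift i d) := by
    intro i hi
    rw [shift_substSeq hs, substSeq_eq s (shift i d), shift_apply, zero_add]
    congr 1
    rcases hi with rfl | hi
    · rfl
    · have h1 := hd (i - 1)
      have h2 := hd i
      split_ifs with h0
      · rw [h0]
      · omega
  have hstep : ∀ i, d i = d (i + 1) → shift i d = app [d i] (shift (i + 1) d) := fun i _ => by
    have := cons_shift (shift i d)
    rw [shift_shift, shift_apply, zero_add, add_comm 1] at this
    exact this.symm
  intro n
  constructor
  · induction n with
    | zero => exact le_of_substSeq_le hs hc₀ (by rw [← key 0 (Or.inl rfl)]; exact (h _).1)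
    | succ n ih =>
      have h2 := hd (n + 1)
      by_cases hn : d n = d (n + 1)
      · rcases (show d (n + 1) = 0 ∨ d (n + 1) = 1 by omega) with h3 | h3
        · have h4 := hstep n hn
          rw [hn, h3] at h4
          exact ih.trans (h4 ▸ zero_cons_le _)
        · exact (lt_of_head_lt (by simp [h₀, h3])).le
      · exact le_of_substSeq_le hs hc₀ (by rw [← key (n + 1) (Or.inr hn)]; exact (h _).1)
  · induction n with
    | zero =>
      exact le_of_substSeq_le hs (hd.shift _) (by rw [← key 0 (Or.inl rfl)]; exact (h _).2)
    | succ n ih =>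
      have h2 := hd (n + 1)
      by_cases hn : d n = d (n + 1)
      · rcases (show d (n + 1) = 0 ∨ d (n + 1) = 1 by omega) with h3 | h3
        · exact (lt_of_head_lt (by simp [h₁, h3])).le
        · have h4 := hstep n hn
          rw [hn, h3] at h4
          refine le_trans ?_ ih; rw [h4]; exact le_const_cons (hd.shift _)
      · exact le_of_substSeq_le hs (hd.shift _) (by rw [← key (n + 1) (Or.inr hn)]; exact (h _).2)

lemma app_zero_le_of_leTo {w : List ℕ} {x : ℕ → ℕ} (h : LeTo w.length (app w fun _ => 0) x) :
    (app w fun _ => 0) ≤ₗ x := by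
  rcases h with h | h
  · exact h.lt.le
  · rw [eq_app_of_agree h.symm, app_le_app]; exact zero_le_seq _

/-- If all windows of `z` are at least `s` and below `𝕃(s)⁺`, then `z` lies in a set of dimension
zero, because `s = aq` and `𝕃(s)⁺ = (a+1)q`. Otherwise some window is `s⁻` or `𝕃(s)⁺`, and from
there on `z` is forced to be a `Φ_s`-image. The prefixes before that window are countably many and
do not affect the dimension. -/
lemma seqDim_renorm_ext {s : List ℕ} (hs : ExtShape s) {c₀ c₁ : ℕ → ℕ} (hc₀ : IsBin c₀)
    (hc₁ : IsBin c₁) (h₀ : c₀ 0 = 0) (h₁ : c₁ 0 = 1) :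
    seqDim (shiftsBetween (substSeq s c₀) (substSeq s c₁)) ≤
      seqDim (shiftsBetween c₀ c₁) / s.length := by
  have hL := hs.lyndon
  obtain ⟨a, q, hs1, hs2⟩ := hs.shape
  set Y := substSeq s '' shiftsBetween c₀ c₁ with hY
  have hlow : substSeq s (fun _ => 0) ≤ₗ substSeq s c₀ := substSeq_le hL hc₀ (zero_le_seq _)
  have hup : substSeq s c₁ ≤ₗ substSeq s (fun _ => 1) :=
    substSeq_le hL (fun _ => le_rfl) (le_const hc₁)
  have hsub : shiftsBetween (substSeq s c₀) (substSeq s c₁) ⊆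
      shiftsBetween (app [a] (app q fun _ => 0)) (app [a + 1] (app q fun _ => 0)) ∪
        ⋃ w : List ℕ, app w '' Y := by
    intro z hz
    have hz' := shiftsBetween_mono hlow hup hz
    by_cases hA : ∀ n, LeTo s.length (per s) (shift n z) ∧
        LtTo s.length (shift n z) (app (plus (maxRot s)) fun _ => 0)
    · left
      intro n
      obtain ⟨h1, h2⟩ := hA n
      constructor
      · rw [← app_cons, ← hs1]
        exact app_zero_le_of_leTo (h1.congr (agree_app_per s _).symm fun _ _ => rfl)
      · rw [← app_cons, ← hs2]; exact h2.lt.le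
    · right
      push Not at hA
      obtain ⟨n, hn⟩ := hA
      have hxn := shiftsBetween_shift hz' n
      set x := shift n z with hx
      have h1 := (hxn 0).1
      have h2 := (hxn 0).2
      rw [shift_zero, substSeq_zero hL, evPer_eq] at h1
      rw [shift_zero, substSeq_one hL, evPer_eq] at h2
      -- A window below `s` can only be `s⁻`, and one not below `𝕃(s)⁺` only `𝕃(s)⁺`, by the outer
      -- bounds `Φ_s(0^∞)` and `Φ_s(1^∞)`. These are the blocks with which an image may start.
      have hfirst : ∃ p ≤ 1, x = app (block s (1 - p) p) (shift s.length x) ∧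
          Follows s p (shift s.length x) := by
        rcases ltTo_or_leTo s.length x (per s) with h3 | h3
        · have hne : minus s ≠ [] := by simp [minus]
          have h4 := h3.lt.le
          rw [per_eq] at h4
          have := eq_app_or_eq_app_plus hne h1 (q := per s)
            (by rw [plus_minus hL.ne hL.last]; exact h4)
          rw [minus_length hL.ne, plus_minus hL.ne hL.last] at this
          rcases this with h5 | h5
          · exact ⟨0, by omega, h5⟩
          · rw [h5.1] at h3
            exact absurd h3 (agree_app_per s _).symm.leTo.not_lt
        · have h4 := hn h3
          rcases ltTo_or_leTo s.length x (app (plus (maxRot s)) fun _ => 0) with h5 | h5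
          · exact absurd h5 h4
          have hlen : (plus (maxRot s)).length = s.length := by
            rw [plus_length hL.maxRot_ne, maxRot_length]
          have h6 : Agree (plus (maxRot s)).length x (app (plus (maxRot s)) (per s)) := by
            have h7 : LeTo s.length (app (plus (maxRot s)) (per s)) x :=
              h5.congr (hlen ▸ agree_app _ _ _) fun _ _ => rfl
            rw [hlen]
            rcases leTo_of_le h2 s.length with h8 | h8
            · exact absurd h8 h7.not_lt
            · exact h8
          have h7 := eq_app_of_agree h6
          rw [hlen] at h7
          refine ⟨1, le_rfl, h7, ?_⟩
          rw [h7, app_le_app] at h2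
          exact h2
      obtain ⟨p, hp, hx1, hx2⟩ := hfirst
      obtain ⟨d', hd', hd''⟩ := exists_eq_Phi hL hp (shiftsBetween_shift hxn s.length) hx2
      have hxd : x = substSeq s (app [p] d') := by
        rw [substSeq_eq, Phi_eq hL.ne, app_cons_zero, shift_one_app_cons, app_nil, ← hd'']
        exact hx1
      have hdb : IsBin (app [p] d') := isBin_app (by simpa using hp) hd'
      refine mem_iUnion.2 ⟨initial n z, x, ⟨app [p] d', ?_, hxd.symm⟩, app_initial n z⟩
      refine mem_shiftsBetween_of_substSeq hL hc₀ h₀ h₁ hdb ?_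
      rw [← hxd]
      exact shiftsBetween_shift hz n
  refine (seqDim_mono hsub).trans ?_
  rw [seqDim_union, seqDim_injective_type, seqDim_iUnion]
  refine max_le bot_le (iSup_le fun w => ?_)
  have h1 : seqDim (app w '' Y) ≤ seqDim Y := by
    have := seqDim_image_le (f := app w) (X := Y) one_pos fun c _ d _ n h => by
      rw [one_mul]; exact (h.app w).mono (by omega)
    simpa using this
  refine h1.trans (seqDim_image_le hL.length_pos fun c _ d _ n h => substSeq_agree h)

/-- The words of `Λ_e`, with the properties that are used. -/
structure LambdaShape (S : List ℕ) : Prop where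
  lyndon : IsLyndon S
  rich : Rich (substSeq S fun _ => 0) (per (maxRot S))
  renorm : ∀ c₀ c₁ : ℕ → ℕ, IsBin c₀ → IsBin c₁ → c₀ 0 = 0 → c₁ 0 = 1 →
    seqDim (shiftsBetween (substSeq S c₀) (substSeq S c₁)) ≤
      seqDim (shiftsBetween c₀ c₁) / S.length

lemma ExtShape.lambda {s : List ℕ} (hs : ExtShape s) : LambdaShape s :=
  ⟨hs.lyndon, hs.rich, fun _ _ => seqDim_renorm_ext hs⟩

lemma LambdaShape.subst {S r : List ℕ} (hS : LambdaShape S) (hr : r ∈ farey) :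
    LambdaShape (subst S r) := by
  obtain ⟨w, rfl⟩ := mem_farey_iff.1 hr
  have hf := fareyShape_path w
  refine ⟨subst_lyndon hS.lyndon hf.lyndon, ?_, fun c₀ c₁ hc₀ hc₁ h₀ h₁ => ?_⟩
  · rw [substSeq_subst hS.lyndon hf.lyndon fun _ => Nat.zero_le _, maxRot_subst hS.lyndon hf.lyndon,
      ← substSeq_per_maxRot hS.lyndon hf.lyndon, hf.per_max, hf.substSeq_zero_eq]
    exact (richBin_path w).substSeq hf.isBin hf.head hS.lyndon
  · rw [substSeq_subst hS.lyndon hf.lyndon hc₀, substSeq_subst hS.lyndon hf.lyndon hc₁]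
    refine (hS.renorm _ _ (isBin_substSeq hf.lyndon hc₀) (isBin_substSeq hf.lyndon hc₁)
      (by rw [substSeq_head hf.lyndon hc₀, h₀]) (by rw [substSeq_head hf.lyndon hc₁, h₁])).trans ?_
    have h1 := seqDim_renorm_ext (extShape_of_mem (farey_subset_fareyExt hr)) hc₀ hc₁ h₀ h₁
    rw [subst_length hS.lyndon.ne, Nat.cast_mul]
    calc _ ≤ seqDim (shiftsBetween c₀ c₁) / (farWord w [0, 1]).length / S.length := by gcongr
      _ = _ := by
        rw [div_eq_mul_inv, div_eq_mul_inv, div_eq_mul_inv, mul_assoc,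
          ENNReal.mul_inv (by simp) (by simp)]

lemma lambdaShape_chain {s : ℕ → List ℕ} (hs : IsFareySeq s) (n : ℕ) :
    LambdaShape (chain s n) := by
  induction n with
  | zero => exact (extShape_of_mem hs.1).lambda
  | succ n ih => exact ih.subst (hs.2 _ (Nat.succ_pos n))

lemma lambdaShape_of_mem {S : List ℕ} (h : S ∈ lambdaExt) : LambdaShape S := by
  obtain ⟨m, -, s, hs, rfl⟩ := h
  exact lambdaShape_chain hs _

end BetaHole

namespace BetaHole
open Set
open scoped ENNReal

/-! ### Dimension of survivor sets -/

lemma dimH_survivorSet_le {β : ℝ} (hβ : 1 < β) {c d : ℕ → ℕ} (hc : BddDigits c)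
    (hd : alpha β ≤ₗ d) :
    dimH (survivorSet β (value β c)) ≤ seqDim (shiftsBetween c d) / logTwo β :=
  (dimH_mono (survivorSet_subset hβ hc hd)).trans
    (dimH_value_image_le hβ fun _ hz => shiftsBetween_digit_le hz)

lemma dimH_survivorSet_eq_zero {β : ℝ} (hβ : 1 < β) {c d : ℕ → ℕ} (hc : BddDigits c)
    (hd : alpha β ≤ₗ d) (h : seqDim (shiftsBetween c d) = 0) :
    dimH (survivorSet β (value β c)) = 0 := by
  have := dimH_survivorSet_le hβ hc hd
  rw [h, ENNReal.zero_div] at this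
  exact le_antisymm this bot_le

lemma dimH_survivorSet_pos {β t : ℝ} (hβ : 1 < β) {c : ℕ → ℕ} (hc : BddDigits c)
    (h1 : ∀ n, value β (shift n c) ≤ 1) (h : Rich c (alpha β)) (ht : t < value β c) :
    0 < dimH (survivorSet β t) := by
  obtain ⟨N, hN⟩ := exists_agree_value_le hβ hc h1 ht
  obtain ⟨e, f, he, hf, hpos⟩ := h N
  obtain ⟨δ, hδ, hgap⟩ := exists_gap hβ hf
  have hX : ∀ z ∈ shiftsBetween e f, BddDigits z ∧ ∀ n, value β (shift n z) ≤ 1 - δ :=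
    fun z hz => ⟨⟨f 0, shiftsBetween_digit_le hz⟩, hgap z fun n => (hz n).2⟩
  refine (dimH_value_image_pos hβ hδ hX hpos).trans_le (dimH_mono ?_)
  rintro _ ⟨z, hz, rfl⟩
  have hz1 : ∀ n, value β (shift n z) < 1 := fun n => by linarith [(hX z hz).2 n]
  refine ⟨⟨value_nonneg hβ _, hz1 0⟩, fun n => ?_⟩
  rw [betaMap_iterate_value hβ (hX z hz).1 hz1]
  exact hN e _ he (hz n).1 ((hX z hz).1.shift n)

/-- The vanishing dimension shows that `(c)_β` is a parameter. For `t < (c)_β`, richness supplies a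
subshift of positive dimension with upper bound below `α(β)`, whose values form part of the survivor
set of `t`. -/
lemma isLeast_zeroDimParams {β : ℝ} (hβ : 1 < β) {c d : ℕ → ℕ} (hc : ∀ n, shift n c ≤ₗ alpha β)
    (hlt : c <ₗ alpha β) (h0 : ∃ k, c k ≠ 0) (hrich : Rich c (alpha β)) (hd : alpha β ≤ₗ d)
    (h : seqDim (shiftsBetween c d) = 0) : IsLeast (zeroDimParams β) (value β c) := by
  have hb : BddDigits c := ⟨_, bdd_of_shift_le hc⟩
  obtain ⟨k, hk⟩ := h0
  refine ⟨⟨value_pos hβ hb hk, value_lt_one hβ hc hlt, dimH_survivorSet_eq_zero hβ hb hd h⟩,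
    fun t ht => ?_⟩
  by_contra hlt
  exact (dimH_survivorSet_pos hβ hb (value_le_one_of_le_alpha hβ hc) hrich
    (not_le.1 hlt)).ne' ht.2.2

/-- Richness passes to limits of the lower bound; in this way it reaches the points outside all
Farey intervals and the infinitely renormalizable ones. -/
lemma Rich.of_approx {c d : ℕ → ℕ}
    (h : ∀ N, ∃ c' d', Agree N c' c ∧ d' ≤ₗ d ∧ Rich c' d') : Rich c d := by
  intro N
  obtain ⟨c', d', h1, h2, h3⟩ := h N
  obtain ⟨e, f, h4, h5, h6⟩ := h3 N
  exact ⟨e, f, h4.trans h1, h5.trans_le h2, h6⟩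

lemma Rich.mono {c d d' : ℕ → ℕ} (h : Rich c d) (hd : d ≤ₗ d') : Rich c d' :=
  Rich.of_approx fun _ => ⟨c, d, fun _ _ => rfl, hd, h⟩

lemma bdd_of_inc_eq_alpha {β : ℝ} (hβ : 1 < β) {x : ℕ → ℕ} (h : inc x = alpha β) :
    BddDigits x := by
  obtain ⟨M, hM⟩ := alpha_bdd hβ
  refine ⟨M, fun i => ?_⟩
  have := hM i
  rw [← h] at this
  rcases i with _ | i
  · rw [inc_zero] at this; omega
  · rwa [← shift_apply 1 (inc x) i, shift_inc] at this

lemma value_dec_first {β : ℝ} (hβ : 1 < β) {x : ℕ → ℕ} (h : inc x = alpha β) :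
    value β x = 1 - 1 / β := by
  have h1 := value_succ hβ (alpha_bdd hβ)
  have h2 := bdd_of_inc_eq_alpha hβ h
  have h3 := value_succ hβ h2
  rw [value_alpha hβ, ← h, shift_inc, inc_zero] at h1
  push_cast at h1
  have h0 : β ≠ 0 := by positivity
  field_simp
  linarith

lemma seqDim_inc {x : ℕ → ℕ} : seqDim (shiftsBetween x (inc x)) = 0 := by
  have h := seqDim_injective_type (x 0) (shift 1 x)
  have h1 := cons_shift x
  have h2 : app [x 0 + 1] (shift 1 x) = inc x := by
    rw [← inc_app_cons, h1]
  rwa [h1, h2] at h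

lemma inc_zero_ones : inc (app [0] fun _ => 1) = fun _ => 1 := by
  rw [inc_app_cons]; exact cons_shift fun _ => 1

lemma inc_zeros : inc (fun _ => 0) = app [1] fun _ => 0 := by
  conv_lhs => rw [← cons_shift fun _ => 0]
  rw [inc_app_cons]; rfl

lemma exists_inc_eq_alpha {β : ℝ} (hβ : 1 < β) : ∃ x, inc x = alpha β := by
  refine ⟨app [alpha β 0 - 1] (shift 1 (alpha β)), ?_⟩
  rw [inc_app_cons, Nat.sub_add_cancel (one_le_alpha_zero hβ), cons_shift]

lemma lt_inc (x : ℕ → ℕ) : x <ₗ inc x := lt_of_head_lt (by rw [inc_zero]; omega)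

/-- `1 - 1/β` is the value of `α(β)` with its first digit lowered by one, and the shifts between
this sequence and `α(β)` form a set of dimension zero. -/
lemma one_sub_inv_mem {β : ℝ} (hβ : 1 < β) : 1 - 1 / β ∈ zeroDimParams β := by
  obtain ⟨x, hx⟩ := exists_inc_eq_alpha hβ
  have h1 : 1 / β < 1 := by rw [div_lt_one] <;> linarith
  have h2 : 0 < 1 / β := by positivity
  refine ⟨by linarith, by linarith, ?_⟩
  have hb := bdd_of_inc_eq_alpha hβ hx
  rw [← value_dec_first hβ hx]
  exact dimH_survivorSet_eq_zero hβ hb (by rw [hx]) seqDim_inc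

lemma criticalValue_le {β t : ℝ} (h : t ∈ zeroDimParams β) : criticalValue β ≤ t :=
  csInf_le ⟨0, fun _ h => h.1.le⟩ h

/-! ### The sequences defining the end points of the intervals -/

lemma substSeq_ge {S : List ℕ} (hS : IsLyndon S) {c : ℕ → ℕ} (hc : IsBin c) (i : ℕ) :
    substSeq S (fun _ => 0) ≤ₗ shift i (substSeq S c) :=
  (substSeq_mem_shiftsBetween hS hc (f := fun _ => 1) (fun _ => le_rfl) rfl rfl
    (fun n => ⟨zero_le_seq _, le_const (hc.shift n)⟩) i).1

lemma exists_ne_of_lt {c : ℕ → ℕ} (h : (fun _ => 0) <ₗ c) : ∃ k, c k ≠ 0 := by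
  obtain ⟨k, -, hk⟩ := lexlt_iff.1 h
  exact ⟨k, (Nat.zero_lt_of_lt hk).ne'⟩

lemma lt_of_exists_ne {c : ℕ → ℕ} (h : ∃ k, c k ≠ 0) : (fun _ => 0) <ₗ c := by
  refine lt_of_le_of_ne (zero_le_seq c) fun h0 => ?_
  rw [toLex_inj] at h0
  obtain ⟨k, hk⟩ := h
  exact hk (congrFun h0 k).symm

lemma infinite_of_shift_pos {c : ℕ → ℕ} (h : ∀ n, (fun _ => 0) <ₗ shift n c) (N : ℕ) :
    ∃ n, N ≤ n ∧ c n ≠ 0 := by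
  obtain ⟨k, hk⟩ := exists_ne_of_lt (h N)
  exact ⟨k + N, by omega, hk⟩

lemma IsLyndon.per_pos {S : List ℕ} (hS : IsLyndon S) : (fun _ => 0) <ₗ per S :=
  lt_of_exists_ne ⟨_, hS.last⟩

lemma IsLyndon.admissible_per_maxRot {S : List ℕ} (hS : IsLyndon S) :
    Admissible (per (maxRot S)) :=
  ⟨shift_maxRot_le S, infinite_of_shift_pos fun n => hS.per_pos.trans_le (hS.le_shift_maxRot n)⟩

lemma substSeq_zero_pos {S : List ℕ} (hS : IsLyndon S) :
    (fun _ => 0) <ₗ substSeq S fun _ => 0 := by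
  obtain ⟨k, -, hk⟩ := hS.admissible_per_maxRot.inf 0
  rw [substSeq_zero hS, evPer_eq]
  exact lt_of_exists_ne ⟨_, by rwa [app_apply_add]⟩

lemma admissible_substSeq {S : List ℕ} (hS : IsLyndon S) {a : ℕ → ℕ} (ha : IsBin a) (h1 : a 0 = 1)
    (h : ∀ n, shift n a ≤ₗ a) : Admissible (substSeq S a) := by
  refine ⟨fun n => ?_, infinite_of_shift_pos fun n =>
    (substSeq_zero_pos hS).trans_le (substSeq_ge hS ha n)⟩
  rcases substSeq_upper hS ha n with ⟨k, -, hk⟩ | hk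
  · rw [hk]; exact substSeq_le hS ha (h k)
  · exact (hk a h1).lt.le

lemma admissible_substSeq_one {S : List ℕ} (hS : IsLyndon S) :
    Admissible (substSeq S fun _ => 1) :=
  admissible_substSeq hS (fun _ => le_rfl) rfl fun _ => le_rfl

lemma admissible_substSeq_one_zero {S : List ℕ} (hS : IsLyndon S) :
    Admissible (substSeq S (app [1] fun _ => 0)) := by
  refine admissible_substSeq hS (isBin_app (by simp) fun _ => Nat.zero_le _) (by simp) fun n => ?_
  rcases n with _ | n
  · rw [shift_zero]
  · rw [← shift_shift n 1, shift_one_app_cons, app_nil]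
    exact (lt_of_head_lt (by simp)).le

lemma betaL_gt_one {S : List ℕ} (hS : IsLyndon S) : 1 < betaL S :=
  hS.admissible_per_maxRot.baseOf_spec.1

lemma alpha_betaL {S : List ℕ} (hS : IsLyndon S) : alpha (betaL S) = per (maxRot S) :=
  hS.admissible_per_maxRot.baseOf_spec.2

lemma mem_outerInterval_iff {S : List ℕ} (hS : IsLyndon S) {β : ℝ} :
    β ∈ outerInterval S ↔
      1 < β ∧ per (maxRot S) ≤ₗ alpha β ∧ alpha β ≤ₗ substSeq S fun _ => 1 := by
  have h1 := admissible_substSeq_one hS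
  by_cases hβ : 1 < β
  · rw [outerInterval, betaL, betaR, mem_Icc, ← substSeq_one hS, h1.le_baseOf_iff hβ]
    exact (and_congr_left' (hS.admissible_per_maxRot.baseOf_le_iff hβ)).trans (by simp [hβ])
  · exact ⟨fun h => absurd ((betaL_gt_one hS).trans_le h.1) hβ, fun h => absurd h.1 hβ⟩

lemma mem_basicInterval_iff {S : List ℕ} (hS : IsLyndon S) {β : ℝ} :
    β ∈ basicInterval S ↔
      1 < β ∧ per (maxRot S) ≤ₗ alpha β ∧ alpha β ≤ₗ substSeq S (app [1] fun _ => 0) := by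
  have h1 := admissible_substSeq_one_zero hS
  by_cases hβ : 1 < β
  · rw [basicInterval, betaL, betaStar, mem_Icc, ← substSeq_one_zero hS, h1.le_baseOf_iff hβ]
    exact (and_congr_left' (hS.admissible_per_maxRot.baseOf_le_iff hβ)).trans (by simp [hβ])
  · exact ⟨fun h => absurd ((betaL_gt_one hS).trans_le h.1) hβ, fun h => absurd h.1 hβ⟩

lemma alpha_injective {β β' : ℝ} (hβ : 1 < β) (hβ' : 1 < β') (h : alpha β = alpha β') : β = β' :=
  le_antisymm ((alpha_le_alpha_iff hβ hβ').1 (by rw [h])) ((alpha_le_alpha_iff hβ' hβ).1 (by rw [h]))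

lemma shift_substSeq_zero_le {S : List ℕ} (hS : IsLyndon S) (n : ℕ) :
    shift n (substSeq S fun _ => 0) ≤ₗ per (maxRot S) := by
  have hm := hS.length_pos
  have hl := minus_length hS.ne
  rw [substSeq_zero hS, evPer_eq]
  rcases lt_or_ge n S.length with h | h
  · have h1 : LtTo (S.length - n) (shift n (app (minus S) (per (maxRot S)))) (shift n (per S)) := by
      refine ⟨S.length - 1 - n, by omega,
        ((minus_agree hS.ne (per (maxRot S))).shift n), ?_⟩
      rw [shift_apply, shift_apply, show S.length - 1 - n + n = S.length - 1 by omega,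
        minus_last hS.ne]
      have := hS.last
      omega
    exact h1.lt.le.trans (shift_per_le_maxRot S n)
  · obtain ⟨k, rfl⟩ := Nat.exists_eq_add_of_le' h
    rw [← hl, shift_app_add]
    exact shift_maxRot_le S k

lemma substSeq_zero_lt {S : List ℕ} (hS : IsLyndon S) :
    (substSeq S fun _ => 0) <ₗ per (maxRot S) :=
  (substSeq_ltTo_per hS rfl).lt.trans_le hS.le_maxRot

lemma per_maxRot_lt_substSeq {S : List ℕ} (hS : IsLyndon S) {c : ℕ → ℕ} (h : c 0 = 1) :
    per (maxRot S) <ₗ substSeq S c := (per_ltTo_substSeq hS h).lt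

/-! ### Basic intervals -/

/-- On `I^S` the expansion is at most `Φ_S(10^∞)`. As `10^∞` is `inc (0^∞)`, renormalization reduces
the vanishing of the dimension to `seqDim_inc`. -/
lemma isLeast_of_mem_basicInterval {S : List ℕ} (hS : LambdaShape S) {β : ℝ}
    (h : β ∈ basicInterval S) :
    IsLeast (zeroDimParams β) (value β (evPer (minus S) (maxRot S))) := by
  have hL := hS.lyndon
  obtain ⟨hβ, h1, h2⟩ := (mem_basicInterval_iff hL).1 h
  rw [← substSeq_zero hL]
  refine isLeast_zeroDimParams hβ (fun n => (shift_substSeq_zero_le hL n).trans h1)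
    ((substSeq_zero_lt hL).trans_le h1) (exists_ne_of_lt (substSeq_zero_pos hL)) (hS.rich.mono h1)
    h2 (le_antisymm ?_ bot_le)
  have h3 := hS.renorm (fun _ => 0) (app [1] fun _ => 0) (fun _ => Nat.zero_le _)
    (isBin_app (by simp) fun _ => Nat.zero_le _) rfl (by simp)
  rw [← inc_zeros, seqDim_inc, ENNReal.zero_div, inc_zeros] at h3
  exact h3

/-! ### Strict inequality inside the intervals -/

/-- If `c` began with `L`, the rest of `c` would lie between `L^∞` and `c`. Agreement with `L^∞`
would then spread block by block and give `c = L^∞`. -/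
lemma agree_plus_of_lt {L : List ℕ} (hL : L ≠ []) {c y : ℕ → ℕ} (h1 : per L <ₗ c)
    (h2 : ∀ n, shift n c ≤ₗ c) (h3 : c ≤ₗ app (plus L) y) :
    c = app (plus L) (shift L.length c) := by
  have h4 := h1.le
  rw [per_eq] at h4
  rcases eq_app_or_eq_app_plus hL h4 h3 with h | h
  · exfalso
    refine absurd (le_of_leTo fun n => ?_) (not_le.2 h1)
    have key : ∀ k, Agree (k * L.length) c (per L) := by
      intro k
      induction k with
      | zero => intro i hi; omega
      | succ k ih =>
        have h5 : Agree (k * L.length) (shift L.length c) (per L) :=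
          (agree_of_between h.2 (h2 L.length) ih.symm)
        have := h5.app L
        rw [← h.1, ← per_eq] at this
        exact this.mono (by rw [Nat.succ_mul, add_comm])
    exact ((key n).mono (Nat.le_mul_of_pos_right _ (List.length_pos_iff.2 hL))).leTo
  · exact h.1

/-- The witness is `(s0^∞)_β`. To the right of `β_ℓ`, `α(β)` begins with `𝕃(s)⁺ = (a+1)q` while `s =
aq`, so the witness falls short of `1 - 1/β` by a positive tail. It is a parameter because `s0^∞ ≥
Φ_s(01^∞)` and `1^∞` is `inc (01^∞)`. -/
lemma exists_lt_of_mem_outerInterval {s : List ℕ} (hs : ExtShape s) {β : ℝ}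
    (h : β ∈ outerInterval s) (hne : β ≠ betaL s) : ∃ t ∈ zeroDimParams β, t < 1 - 1 / β := by
  have hL := hs.lyndon
  obtain ⟨hβ, h1, h2⟩ := (mem_outerInterval_iff hL).1 h
  have h3 : per (maxRot s) <ₗ alpha β := by
    refine lt_of_le_of_ne h1 fun h0 => hne ?_
    rw [toLex_inj] at h0
    exact alpha_injective hβ (betaL_gt_one hL) (by rw [alpha_betaL hL, h0])
  have h4 := h2
  rw [substSeq_one hL, evPer_eq] at h4
  have h5 := agree_plus_of_lt hL.maxRot_ne h3 (shift_alpha_le hβ) h4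
  obtain ⟨a, q, hs1, hs2⟩ := hs.shape
  have hb : BddDigits (app s fun _ => 0) := by
    refine ⟨s.sum, fun i => ?_⟩
    rw [app]
    split_ifs with hi
    · rw [List.getD_eq_getElem _ _ hi]
      exact List.le_sum_of_mem (List.getElem_mem hi)
    · exact Nat.zero_le _
  have hpos : (app s fun _ => 0) (s.length - 1) ≠ 0 := by
    rw [agree_app_per s _ _ (by have := hL.length_pos; omega)]; exact hL.last
  have hlt : value β (app s fun _ => 0) < 1 - 1 / β := by
    have h6 := value_succ hβ hb
    have h7 := value_succ hβ (alpha_bdd hβ)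
    rw [value_alpha hβ] at h7
    rw [hs2, maxRot_length] at h5
    have h8 : shift 1 (alpha β) = app q (shift s.length (alpha β)) := by
      conv_lhs => rw [h5]
      rw [shift_one_app_cons]
    have h9 : alpha β 0 = a + 1 := by rw [h5]; simp
    have h10 : shift 1 (app s fun _ => 0) = app q fun _ => 0 := by
      rw [hs1, shift_one_app_cons]
    have h11 : (app s fun _ => 0) 0 = a := by rw [hs1]; simp
    have h12 := value_sub hβ (h10 ▸ hb.shift 1) (h8 ▸ (alpha_bdd hβ).shift 1)
      (agree_app q (fun _ => 0) (shift s.length (alpha β)))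
    rw [shift_app, shift_app, value_zero, ← h8, ← h10] at h12
    have h13 := value_shift_alpha_pos hβ s.length
    have h14 : value β (shift 1 (app s fun _ => 0)) < value β (shift 1 (alpha β)) := by
      by_contra hn
      have : 0 ≤ β ^ q.length *
          (value β (shift 1 (app s fun _ => 0)) - value β (shift 1 (alpha β))) :=
        mul_nonneg (by positivity) (by linarith [not_lt.1 hn])
      linarith
    rw [h11] at h6
    rw [h9] at h7
    push_cast at h7
    rw [lt_sub_iff_add_lt, ← lt_sub_iff_add_lt', div_lt_iff₀ (by linarith)]
    nlinarith
  have h1β : 0 < 1 / β := by positivity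
  refine ⟨_, ⟨value_pos hβ hb hpos, by linarith,
    dimH_survivorSet_eq_zero hβ hb h2 (le_antisymm ?_ bot_le)⟩, hlt⟩
  have h6 : substSeq s (app [0] fun _ => 1) ≤ₗ app s fun _ => 0 :=
    ((substSeq_ltTo_per hL (by simp)).congr (fun _ _ => rfl) (agree_app_per s _).symm).lt.le
  refine (seqDim_mono (shiftsBetween_mono h6 le_rfl)).trans ?_
  have h7 := seqDim_renorm_ext hs (c₀ := app [0] fun _ => 1) (c₁ := fun _ => 1) isBin_zero_one
    (fun _ => le_rfl) (by simp) rfl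
  have h8 := seqDim_inc (x := app [0] fun _ => 1)
  rw [inc_zero_ones] at h8
  rwa [h8, ENNReal.zero_div] at h7

end BetaHole

namespace BetaHole
open Set

/-! ### Descent in the Farey tree -/

/-- Maps that preserve the order and common initial words of binary sequences starting with `0`. -/
structure OrderMap (G : (ℕ → ℕ) → ℕ → ℕ) : Prop where
  lt : ∀ c d : ℕ → ℕ, IsBin d → d 0 = 0 → c <ₗ d → G c <ₗ G d
  agree : ∀ c d : ℕ → ℕ, ∀ n, Agree n c d → Agree n (G c) (G d)

lemma orderMap_raise (k : ℕ) : OrderMap fun c => raise k (inc c) :=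
  ⟨fun _ _ _ _ h => raise_lt (inc_lt h), fun _ _ _ h => raise_agree.2 (inc_agree h)⟩

lemma orderMap_substSeq {S : List ℕ} (hS : IsLyndon S) : OrderMap fun c => substSeq S (inc c) :=
  ⟨fun _ _ hd h0 h => substSeq_lt hS (isBin_inc hd h0) (inc_lt h),
    fun _ _ n h => (substSeq_agree (inc_agree h)).mono (Nat.le_mul_of_pos_left n hS.length_pos)⟩

lemma OrderMap.morph {G : (ℕ → ℕ) → ℕ → ℕ} (hG : OrderMap G) (b : Bool) :
    OrderMap fun c => G (morph (letter b) c) :=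
  ⟨fun _ _ hd h0 h => hG.lt _ _ (isBin_morph b _) (morph_head h0) (morph_lt b hd h),
    fun _ _ _ h => hG.agree _ _ _ (morph_agree (letter_ne b) h)⟩

lemma le_zero_ones {c : ℕ → ℕ} (hc : IsBin c) (h0 : c 0 = 0) : c ≤ₗ app [0] fun _ => 1 := by
  rw [← cons_shift c, h0, app_le_app]; exact le_const (hc.shift 1)

lemma isBin_per_zero_one : IsBin (per [0, 1]) := isBin_per (by simp)

lemma per_zero_one_head : per [0, 1] 0 = 0 := rfl

lemma per_zero_one : per [0, 1] = app [0] (app [1] (per [0, 1])) := by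
  conv_lhs => rw [per_eq, app_cons]

lemma per_zero_one_lt : per [0, 1] <ₗ app [0] fun _ => 1 := by
  rw [per_zero_one, app_lt_app]
  conv_rhs => rw [show (fun _ => 1) = app [1] fun _ => 1 from (cons_shift fun _ => 1).symm]
  rw [app_lt_app]; exact lt_of_head_lt (by simp [per_zero_one_head])

lemma zero_lt_left : (fun _ => 0) <ₗ app [0] (per [0, 1]) :=
  lt_of_exists_ne ⟨2, by decide⟩

lemma left_lt : app [0] (per [0, 1]) <ₗ per [0, 1] := by
  conv_rhs => rw [per_zero_one]
  rw [app_lt_app]; exact lt_of_head_lt (by simp [per_zero_one_head])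

lemma lam_zeros : morph (letter false) (fun _ => 0) = fun _ => 0 := by
  rw [← per_singleton 0, morph_per (letter_ne false) (by simp)]; rfl

lemma rho_zeros : morph (letter true) (fun _ => 0) = per [0, 1] := by
  rw [← per_singleton 0, morph_per (letter_ne true) (by simp)]; rfl

/-- The left end point of the interval belonging to a path. -/
abbrev leftEnd (w : List Bool) : ℕ → ℕ := farSeq w (app [0] (per [0, 1]))

/-- The right end point of the interval belonging to a path. -/
abbrev rightEnd (w : List Bool) : ℕ → ℕ := farSeq w (per [0, 1])

lemma isBin_leftEnd (w : List Bool) : IsBin (leftEnd w) := isBin_farSeq w fareyShape_base.isBin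

lemma isBin_rightEnd (w : List Bool) : IsBin (rightEnd w) := isBin_farSeq w isBin_per_zero_one

lemma leftEnd_head (w : List Bool) : leftEnd w 0 = 0 := farSeq_head w (by simp)

lemma rightEnd_head (w : List Bool) : rightEnd w 0 = 0 := farSeq_head w per_zero_one_head

/-- The root interval is `[0(01)^∞, (01)^∞]`. The subtree of `λ` stays to its left because `λ(01^∞)`
is its left end, and that of `ρ` to its right because `ρ(0^∞)` is its right end. -/
lemma rightEnd_false_lt (w : List Bool) : rightEnd (false :: w) <ₗ app [0] (per [0, 1]) := by
  rw [← lam_zero_ones]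
  refine morph_lt false isBin_zero_one ?_
  exact (farSeq_lt w isBin_zero_one per_zero_one_lt).trans_le
    (le_zero_ones (isBin_farSeq w isBin_zero_one) (farSeq_head w (by simp)))

lemma lt_leftEnd_true (w : List Bool) : per [0, 1] <ₗ leftEnd (true :: w) := by
  rw [← rho_zeros]
  exact morph_lt true (isBin_leftEnd w)
    ((zero_le_seq _).trans_lt (farSeq_lt w fareyShape_base.isBin zero_lt_left))

/-- The intervals belonging to different paths are disjoint. -/
lemma path_unique {G : (ℕ → ℕ) → ℕ → ℕ} (hG : OrderMap G) {x : ℕ → ℕ} {w w' : List Bool}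
    (h1 : G (leftEnd w) ≤ₗ x) (h2 : x ≤ₗ G (rightEnd w)) (h3 : G (leftEnd w') ≤ₗ x)
    (h4 : x ≤ₗ G (rightEnd w')) : w = w' := by
  have hne : ∀ u v, rightEnd u <ₗ leftEnd v → ¬ (x ≤ₗ G (rightEnd u) ∧ G (leftEnd v) ≤ₗ x) :=
    fun u v h h' => absurd (h'.2.trans h'.1)
      (not_le.2 (hG.lt _ _ (isBin_leftEnd v) (leftEnd_head v) h))
  induction w generalizing w' G with
  | nil =>
    rcases w' with _ | ⟨b, w'⟩
    · rfl
    · rcases b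
      · exact absurd ⟨h4, h1⟩ (hne _ [] (rightEnd_false_lt w'))
      · exact absurd ⟨h2, h3⟩ (hne [] _ (lt_leftEnd_true w'))
  | cons b w ih =>
    rcases w' with _ | ⟨b', w'⟩
    · rcases b
      · exact absurd ⟨h2, h3⟩ (hne _ [] (rightEnd_false_lt w))
      · exact absurd ⟨h4, h1⟩ (hne [] _ (lt_leftEnd_true w))
    · rcases b <;> rcases b'
      · rw [ih (hG.morph false) h1 h2 h3 h4 fun u v h => hne (false :: u) (false :: v)
          (morph_lt false (isBin_leftEnd v) h)]
      · exact absurd ⟨h2, h3⟩ (hne _ _ ((rightEnd_false_lt w).trans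
          (left_lt.trans (lt_leftEnd_true w'))))
      · exact absurd ⟨h4, h1⟩ (hne _ _ ((rightEnd_false_lt w').trans
          (left_lt.trans (lt_leftEnd_true w))))
      · rw [ih (hG.morph true) h1 h2 h3 h4 fun u v h => hne (true :: u) (true :: v)
          (morph_lt true (isBin_leftEnd v) h)]

/-! ### Sequences in the gaps -/

/-- Every `λ`-image begins with `0`, so one digit is known beyond the images of the common letters.
Consequently the two ends of the gap at depth `n` share `n + 1` digits. -/
lemma lam_agree_succ {c d : ℕ → ℕ} (hc : IsBin c) {n : ℕ} (h : Agree n c d) :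
    Agree (n + 1) (morph (letter false) c) (morph (letter false) d) := by
  induction n generalizing c d with
  | zero =>
    intro i hi
    obtain rfl : i = 0 := by omega
    rw [lam_head, lam_head]
  | succ n ih =>
    have h0 := h 0 n.succ_pos
    have h1 := ih (hc.shift 1) (h.shift 1)
    have h2 := hc 0
    rcases (show c 0 = 0 ∨ c 0 = 1 by omega) with h3 | h3
    · rw [lam_zero h3, lam_zero (c := d) (h0 ▸ h3)]
      exact (h1.app [0]).mono (by rw [List.length_singleton]; omega)
    · rw [lam_one h3, lam_one (c := d) (h0 ▸ h3)]
      exact ((h1.app [1]).app [0]).mono (by simp only [List.length_singleton]; omega)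

lemma morph_agree_succ (b : Bool) {c d : ℕ → ℕ} (hc : IsBin c) (h0 : c 0 = 0) {n : ℕ}
    (h : Agree (n + 1) c d) : Agree (n + 2) (morph (letter b) c) (morph (letter b) d) := by
  rcases b
  · exact lam_agree_succ hc h
  · rw [rho_zero h0, rho_zero (c := d) ((h 0 n.succ_pos) ▸ h0)]
    exact (((morph_agree (letter_ne true) (h.shift 1)).app [1]).app [0]).mono (by simp; omega)

lemma farSeq_agree_length (w : List Bool) :
    Agree (w.length + 1) (farSeq w fun _ => 0) (farSeq w (app [0] fun _ => 1)) := by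
  induction w with
  | nil =>
    intro i hi
    obtain rfl : i = 0 := by simpa using hi
    simp [farSeq_nil]
  | cons b w ih =>
    exact morph_agree_succ b (isBin_farSeq w fun _ => Nat.zero_le _) (farSeq_head w rfl) ih

lemma farSeq_concat (w : List Bool) (b : Bool) (c : ℕ → ℕ) :
    farSeq (w ++ [b]) c = farSeq w (morph (letter b) c) := farSeq_append w [b] c

/-- A sequence in the first gap and in none of the intervals is the image of a limit of left end
points. -/
lemma exists_limit_of_gap {G : (ℕ → ℕ) → ℕ → ℕ} (hG : OrderMap G) {a : ℕ → ℕ}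
    (h0 : G (fun _ => 0) <ₗ a) (h1 : a <ₗ G (app [0] fun _ => 1))
    (hJ : ∀ w, G (leftEnd w) ≤ₗ a → ¬ a ≤ₗ G (rightEnd w)) :
    ∃ x, IsBin x ∧ x 0 = 0 ∧ a = G x ∧
      ∀ N, ∃ w, Agree N (leftEnd w) x ∧ G (leftEnd w) ≤ₗ a := by
  classical
  -- Binary search: `a` is outside the interval of the current node, so it is in the gap to the
  -- right (append `ρ`) or to the left (append `λ`). The gap of a path runs from the image of `0^∞`
  -- to that of `01^∞`.
  set P : ℕ → List Bool := fun n => Nat.rec []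
    (fun _ w => if G (leftEnd w) ≤ₗ a then w ++ [true] else w ++ [false]) n with hPdef
  have hPs : ∀ n, P (n + 1) = if G (leftEnd (P n)) ≤ₗ a then P n ++ [true] else P n ++ [false] :=
    fun n => rfl
  have hlen : ∀ n, (P n).length = n := by
    intro n
    induction n with
    | zero => rfl
    | succ n ih => rw [hPs]; split_ifs <;> simp [ih]
  set lo : ℕ → ℕ → ℕ := fun n => farSeq (P n) fun _ => 0 with hlo
  set hi : ℕ → ℕ → ℕ := fun n => farSeq (P n) (app [0] fun _ => 1) with hhi
  have hlobin : ∀ n, IsBin (lo n) := fun n => isBin_farSeq _ fun _ => Nat.zero_le _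
  have hhibin : ∀ n, IsBin (hi n) := fun n => isBin_farSeq _ isBin_zero_one
  have hlo0 : ∀ n, lo n 0 = 0 := fun n => farSeq_head _ rfl
  have hhi0 : ∀ n, hi n 0 = 0 := fun n => farSeq_head _ (by simp)
  have hgap : ∀ n, G (lo n) <ₗ a ∧ a <ₗ G (hi n) := by
    intro n
    induction n with
    | zero => exact ⟨h0, h1⟩
    | succ n ih =>
      simp only [hlo, hhi, hPs]
      split_ifs with h
      · rw [farSeq_concat, farSeq_concat, rho_zeros, rho_zero_ones]
        exact ⟨not_le.1 (hJ _ h), ih.2⟩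
      · rw [farSeq_concat, farSeq_concat, lam_zeros, lam_zero_ones]
        exact ⟨ih.1, not_le.1 h⟩
  have hmono : ∀ n, lo n ≤ₗ lo (n + 1) ∧ hi (n + 1) ≤ₗ hi n := by
    intro n
    simp only [hlo, hhi, hPs]
    split_ifs
    · rw [farSeq_concat, farSeq_concat, rho_zeros, rho_zero_ones]
      exact ⟨farSeq_le _ isBin_per_zero_one (zero_le_seq _), le_rfl⟩
    · rw [farSeq_concat, farSeq_concat, lam_zeros, lam_zero_ones]
      exact ⟨le_rfl, farSeq_le _ isBin_zero_one
        (le_zero_ones fareyShape_base.isBin (by simp))⟩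
  have hlole : ∀ n k, lo n ≤ₗ lo (n + k) := by
    intro n k
    induction k with
    | zero => exact le_rfl
    | succ k ih => exact ih.trans (hmono _).1
  have hhile : ∀ n k, hi (n + k) ≤ₗ hi n := by
    intro n k
    induction k with
    | zero => exact le_rfl
    | succ k ih => exact (hmono _).2.trans ih
  have hlohi : ∀ n, Agree (n + 1) (lo n) (hi n) := fun n => by
    have := farSeq_agree_length (P n)
    rwa [hlen] at this
  have hlo_lt_hi : ∀ n, lo n ≤ₗ hi n := fun n =>
    farSeq_le _ isBin_zero_one (zero_le_seq _)
  have hcon : ∀ n k, Agree (n + 1) (lo (n + k)) (lo n) := fun n k =>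
    agree_of_between (hlole n k) ((hlo_lt_hi _).trans (hhile n k)) (hlohi n)
  set x : ℕ → ℕ := fun i => lo i i with hx
  have hxlo : ∀ n, Agree (n + 1) x (lo n) := by
    intro n i hi'
    obtain ⟨k, rfl⟩ := Nat.exists_eq_add_of_le (Nat.lt_succ_iff.1 hi')
    exact (hcon i k i i.lt_succ_self).symm
  have hx0 : x 0 = 0 := hlo0 0
  have hax : a = G x := eq_of_agree fun n =>
    (agree_of_between (hgap n).1.le (hgap n).2.le
      ((hG.agree _ _ _ (hlohi n)).mono n.le_succ)).trans
      ((hG.agree _ _ _ (hxlo n).symm).mono n.le_succ)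
  have hleft : ∀ n, Agree (n + 1) (leftEnd (P n)) x := fun n =>
    (agree_of_between (farSeq_le _ fareyShape_base.isBin (zero_le_seq _))
      (farSeq_le _ isBin_zero_one (le_zero_ones fareyShape_base.isBin (by simp)))
      (hlohi n)).trans (hxlo n).symm
  refine ⟨x, fun i => hlobin i i, hx0, hax, fun N => ?_⟩
  -- If left end points below `a` did not approach `x`, the search would turn left from some step
  -- on. The lower ends would then be constant, and `a` would equal the image of a lower end
  -- strictly below it.
  by_contra hcon'
  push Not at hcon'
  have hfalse : ∀ k, ¬ G (leftEnd (P (N + k))) ≤ₗ a := fun k =>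
    not_le.2 (hcon' _ ((hleft _).mono (by omega)))
  have hconst : ∀ k, lo (N + k) = lo N := by
    intro k
    induction k with
    | zero => rfl
    | succ k ih =>
      rw [← ih]
      simp only [hlo, ← add_assoc, hPs, if_neg (hfalse k)]
      rw [farSeq_concat, lam_zeros]
  have hxN : x = lo N := eq_of_agree fun n => by
    have := hxlo (N + n)
    rw [hconst] at this
    exact this.mono (by omega)
  have := (hgap N).1
  rw [hax, hxN] at this
  exact lt_irrefl _ this

/-! ### The intervals of Farey words -/

lemma per_maxRot_farWord (w : List Bool) : per (maxRot (farWord w [0, 1])) = inc (leftEnd w) :=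
  (fareyShape_path w).per_max

lemma substSeq_ones_farWord (w : List Bool) :
    substSeq (farWord w [0, 1]) (fun _ => 1) = inc (rightEnd w) := by
  have hf := fareyShape_path w
  obtain ⟨m, h1, h2⟩ := hf.shape
  rw [substSeq_one hf.lyndon.lyndon, evPer_eq, rightEnd, farSeq_per w (by simp), h2]
  have h3 : plus (1 :: m ++ [0]) = (1 :: m ++ [1]) := by
    simp only [plus, List.dropLast_concat, List.getLastD_concat]
  have h4 : farWord w [0, 1] = 0 :: (m ++ [1]) := by rw [h1]; rfl
  rw [h3]
  conv_rhs => rw [per_eq, h4, inc_app_cons]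
  rw [h4]; rfl

lemma substSeq_one_shiftDigits (k : ℕ) {w : List ℕ} (hw : IsLyndon w) :
    substSeq (shiftDigits k w) (fun _ => 1) = raise k (substSeq w fun _ => 1) := by
  rw [substSeq_one hw, substSeq_one (hw.shiftDigits k), maxRot_shiftDigits k hw.ne,
    plus_shiftDigits k hw.maxRot_ne, evPer_eq, evPer_eq, raise_app, raise_per k hw.ne]

lemma mem_outerInterval_subst {S : List ℕ} (hS : IsLyndon S) {w : List Bool} {β : ℝ} :
    β ∈ outerInterval (subst S (farWord w [0, 1])) ↔ 1 < β ∧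
      substSeq S (inc (leftEnd w)) ≤ₗ alpha β ∧ alpha β ≤ₗ substSeq S (inc (rightEnd w)) := by
  have hf := (fareyShape_path w).lyndon
  rw [mem_outerInterval_iff (subst_lyndon hS hf), maxRot_subst hS hf, ← substSeq_per_maxRot hS hf,
    per_maxRot_farWord, substSeq_subst hS hf fun _ => le_rfl, substSeq_ones_farWord]

lemma mem_outerInterval_shiftDigits {k : ℕ} {w : List Bool} {β : ℝ} :
    β ∈ outerInterval (shiftDigits k (farWord w [0, 1])) ↔ 1 < β ∧
      raise k (inc (leftEnd w)) ≤ₗ alpha β ∧ alpha β ≤ₗ raise k (inc (rightEnd w)) := by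
  have hf := (fareyShape_path w).lyndon.lyndon
  rw [mem_outerInterval_iff (hf.shiftDigits k), maxRot_shiftDigits k hf.ne,
    ← raise_per k hf.maxRot_ne, per_maxRot_farWord, substSeq_one_shiftDigits k hf,
    substSeq_ones_farWord]

lemma mem_outerInterval_digit {k : ℕ} {β : ℝ} :
    β ∈ outerInterval (shiftDigits k [1]) ↔ 1 < β ∧
      (fun _ => k + 1) ≤ₗ alpha β ∧ alpha β ≤ₗ raise k (inc fun _ => 1) := by
  rw [mem_outerInterval_iff (isLyndon_one.shiftDigits k), maxRot_shiftDigits k (by simp),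
    show maxRot [1] = [1] by decide, show shiftDigits k [1] = [k + 1] by simp [shiftDigits, add_comm],
    per_singleton, show ([k + 1] : List ℕ) = shiftDigits k [1] by simp [shiftDigits, add_comm],
    substSeq_one_shiftDigits k isLyndon_one, substSeq_one isLyndon_one, evPer_eq,
    show maxRot [1] = [1] by decide, show plus [1] = [2] by decide, per_singleton]
  have : app [2] (fun _ => 1) = inc fun _ => 1 := by
    conv_rhs => rw [← cons_shift fun _ => 1]
    rw [inc_app_cons]; rfl
  rw [this]

end BetaHole

namespace BetaHole
open Set

/-! ### Classification of the bases -/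

lemma chain_congr {s s' : ℕ → List ℕ} {n : ℕ} (h : ∀ i ≤ n, s i = s' i) : chain s n = chain s' n := by
  induction n with
  | zero => exact h 0 le_rfl
  | succ n ih =>
    rw [chain, chain, ih fun i hi => h i (by omega), h (n + 1) le_rfl]

lemma subst_mem {S r : List ℕ} (hS : S ∈ lambdaExt) (hr : r ∈ farey) : subst S r ∈ lambdaExt := by
  obtain ⟨m, hm, s, hs, rfl⟩ := hS
  have h0 : ∀ i ≤ m - 1, Function.update s m r i = s i := fun i hi =>
    Function.update_of_ne (by omega) _ _
  refine ⟨m + 1, by omega, Function.update s m r, ⟨by rw [h0 0 (by omega)]; exact hs.1,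
    fun k hk => ?_⟩, ?_⟩
  · by_cases h : k = m
    · rw [h, Function.update_self]; exact hr
    · rw [Function.update_of_ne h]; exact hs.2 k hk
  · obtain ⟨n, rfl⟩ := Nat.exists_eq_add_of_le' hm
    simp only [Nat.add_sub_cancel] at h0 ⊢
    rw [chain, chain_congr h0, Function.update_self]

lemma fareyExt_subset {s : List ℕ} (hs : s ∈ fareyExt) : s ∈ lambdaExt := by
  refine ⟨1, le_rfl, fun n => if n = 0 then s else [0, 1], ⟨hs, fun k hk => ?_⟩, rfl⟩
  simp only [if_neg (show ¬ k = 0 by omega)]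
  exact farWord_mem_farey []

lemma outerInterval_subst_subset {S r : List ℕ} (hS : IsLyndon S) (hr : r ∈ farey) :
    outerInterval (subst S r) ⊆ outerInterval S := by
  obtain ⟨w, rfl⟩ := mem_farey_iff.1 hr
  intro β h
  obtain ⟨hβ, h1, h2⟩ := (mem_outerInterval_subst hS).1 h
  refine (mem_outerInterval_iff hS).2 ⟨hβ, ?_, h2.trans ?_⟩
  · exact (per_maxRot_lt_substSeq hS (by rw [inc_zero, leftEnd_head])).le.trans h1
  · exact substSeq_le hS (fun _ => le_rfl)
      (le_const (isBin_inc (isBin_rightEnd w) (rightEnd_head w)))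

lemma outerInterval_subst_unique {S r r' : List ℕ} (hS : IsLyndon S) (hr : r ∈ farey)
    (hr' : r' ∈ farey) {β : ℝ} (h : β ∈ outerInterval (subst S r))
    (h' : β ∈ outerInterval (subst S r')) : r = r' := by
  obtain ⟨w, rfl⟩ := mem_farey_iff.1 hr
  obtain ⟨w', rfl⟩ := mem_farey_iff.1 hr'
  obtain ⟨-, h1, h2⟩ := (mem_outerInterval_subst hS).1 h
  obtain ⟨-, h3, h4⟩ := (mem_outerInterval_subst hS).1 h'
  rw [path_unique (orderMap_substSeq hS) h1 h2 h3 h4]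

lemma raise_const (k a : ℕ) : raise k (fun _ => a) = fun _ => a + k := rfl

lemma raise_inc_zeros (k : ℕ) : raise k (inc fun _ => 0) = app [k + 1] fun _ => k := by
  rw [inc_zeros, raise_app, raise_const]; simp [shiftDigits, add_comm]

lemma raise_inc_zero_ones (k : ℕ) : raise k (inc (app [0] fun _ => 1)) = fun _ => k + 1 := by
  rw [inc_zero_ones]; funext i; simp [raise, add_comm]

lemma raise_inc_ones (k : ℕ) : raise k (inc fun _ => 1) = app [k + 2] fun _ => k + 1 := by
  have : inc (fun _ => 1) = app [2] fun _ => 1 := by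
    conv_lhs => rw [← cons_shift fun _ => 1]
    rw [inc_app_cons]; rfl
  rw [this, raise_app, raise_const]; simp [shiftDigits, add_comm]

lemma zeros_lt_leftEnd (w : List Bool) : (fun _ => 0) <ₗ leftEnd w :=
  (zero_le_seq _).trans_lt (farSeq_lt w fareyShape_base.isBin zero_lt_left)

lemma rightEnd_lt (w : List Bool) : rightEnd w <ₗ app [0] fun _ => 1 :=
  (farSeq_lt w isBin_zero_one per_zero_one_lt).trans_le
    (le_zero_ones (isBin_farSeq w isBin_zero_one) (farSeq_head w (by simp)))

/-- The interval of an extended Farey word determines the first digit of `α`. -/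
lemma mem_outerInterval_ext {s : List ℕ} (hs : s ∈ fareyExt) {β : ℝ} (h : β ∈ outerInterval s) :
    (∃ w, s = shiftDigits (alpha β 0 - 1) (farWord w [0, 1]) ∧
      app [alpha β 0] (fun _ => alpha β 0 - 1) <ₗ alpha β ∧ alpha β <ₗ fun _ => alpha β 0) ∨
    (s = shiftDigits (alpha β 0 - 1) [1] ∧ alpha β = fun _ => alpha β 0) ∨
    (2 ≤ alpha β 0 ∧ s = shiftDigits (alpha β 0 - 2) [1] ∧
      alpha β ≤ₗ app [alpha β 0] fun _ => alpha β 0 - 1) := by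
  obtain ⟨k, v, hv | rfl, rfl⟩ := hs
  · left
    obtain ⟨w, rfl⟩ := mem_farey_iff.1 hv
    obtain ⟨hβ, h1, h2⟩ := mem_outerInterval_shiftDigits.1 h
    have h3 := head_le_of_le h1
    have h4 := head_le_of_le h2
    have h5 : alpha β 0 = k + 1 := by
      simp only [raise, inc_zero, leftEnd_head, rightEnd_head] at h3 h4; omega
    rw [h5]
    simp only [Nat.add_sub_cancel]
    refine ⟨w, rfl, ?_, ?_⟩
    · rw [← raise_inc_zeros]
      exact (raise_lt (inc_lt (zeros_lt_leftEnd w))).trans_le h1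
    · rw [← raise_inc_zero_ones]
      exact h2.trans_lt (raise_lt (inc_lt (rightEnd_lt w)))
  · right
    obtain ⟨hβ, h1, h2⟩ := mem_outerInterval_digit.1 h
    rw [raise_inc_ones] at h2
    have h3 := head_le_of_le h1
    have h4 := head_le_of_le h2
    simp only [app_cons_zero] at h4
    rcases (show alpha β 0 = k + 1 ∨ alpha β 0 = k + 2 by omega) with h5 | h5
    · left
      rw [h5]
      refine ⟨rfl, toLex_inj.1 (le_antisymm ?_ h1)⟩
      refine le_const fun i => ?_
      rw [← h5]; exact bdd_of_shift_le (shift_alpha_le hβ) i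
    · right
      rw [h5]
      exact ⟨by omega, rfl, h2⟩

lemma outerInterval_ext_unique {s s' : List ℕ} (hs : s ∈ fareyExt) (hs' : s' ∈ fareyExt) {β : ℝ}
    (h : β ∈ outerInterval s) (h' : β ∈ outerInterval s') : s = s' := by
  have hlt : 2 ≤ alpha β 0 →
      app [alpha β 0] (fun _ => alpha β 0 - 1) <ₗ fun _ => alpha β 0 := fun h => by
    conv_rhs => rw [← cons_shift fun _ => alpha β 0]
    rw [app_lt_app]
    refine lt_of_head_lt ?_
    simp only [shift_apply]; omega
  rcases mem_outerInterval_ext hs h with ⟨w, rfl, h1, h2⟩ | ⟨rfl, h1⟩ | ⟨h0, rfl, h1⟩ <;>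
  rcases mem_outerInterval_ext hs' h' with ⟨w', rfl, h3, h4⟩ | ⟨rfl, h3⟩ | ⟨h5, rfl, h3⟩
  · obtain ⟨-, h1, h2⟩ := mem_outerInterval_shiftDigits.1 h
    obtain ⟨-, h3, h4⟩ := mem_outerInterval_shiftDigits.1 h'
    rw [path_unique (orderMap_raise _) h1 h2 h3 h4]
  · exact absurd h3 (fun h0 => absurd h2 (not_lt.2 (by conv_rhs => rw [h0])))
  · exact absurd h1 (not_lt.2 h3)
  · exact absurd h1 (fun h0 => absurd h4 (not_lt.2 (by conv_rhs => rw [h0])))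
  · rfl
  · exact absurd (hlt h5) (not_lt.2 (by rw [h1] at h3; simpa using h3))
  · exact absurd h3 (not_lt.2 h1)
  · exact absurd (hlt h0) (not_lt.2 (by rw [h3] at h1; simpa using h1))
  · rfl

/-- With `k + 1` the first digit, the intervals of one-digit words account for `α = (k+1)^∞` and, if
`k > 0`, for `α ≤ (k+1)k^∞`; for `k = 0` the latter is impossible since `α` does not end in zeros.
So `α` is strictly inside the gap and the search in the Farey tree applies. -/
lemma exceptional_limit {β : ℝ} (hβ : β ∈ exceptional) :
    ∃ x, inc x = alpha β ∧ Rich x (alpha β) := by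
  have hβ1 : 1 < β := hβ.1
  have hJ : ∀ s ∈ fareyExt, β ∉ outerInterval s := fun s hs h =>
    hβ.2 (mem_iUnion₂.2 ⟨s, hs, h⟩)
  obtain ⟨k, hk⟩ : ∃ k, alpha β 0 = k + 1 := Nat.exists_eq_add_of_le' (one_le_alpha_zero hβ1)
  have hle : alpha β ≤ₗ fun _ => k + 1 := le_const fun i => by
    rw [← hk]; exact bdd_of_shift_le (shift_alpha_le hβ1) i
  have hhi : alpha β <ₗ fun _ => k + 1 := by
    refine lt_of_le_of_ne hle fun h => hJ (shiftDigits k [1]) ⟨k, _, Or.inr rfl, rfl⟩ ?_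
    refine mem_outerInterval_digit.2 ⟨hβ1, h.ge, hle.trans ?_⟩
    rw [raise_inc_ones]; exact (lt_of_head_lt (by simp)).le
  have hlo : (app [k + 1] fun _ => k) <ₗ alpha β := by
    refine not_le.1 fun h => ?_
    rcases k with _ | k
    · have h1 : alpha β ≤ₗ app [alpha β 0] fun _ => 0 := by rw [hk]; exact h
      conv_lhs at h1 => rw [← cons_shift (alpha β)]
      rw [app_le_app] at h1
      have h2 : shift 1 (alpha β) = fun _ => 0 := toLex_inj.1 (le_antisymm h1 (zero_le_seq _))
      have h3 := value_shift_alpha_pos hβ1 1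
      rw [h2, value_zero] at h3
      exact lt_irrefl _ h3
    · refine hJ (shiftDigits k [1]) ⟨k, _, Or.inr rfl, rfl⟩ (mem_outerInterval_digit.2 ⟨hβ1,
        (lt_of_head_lt ?_).le, ?_⟩)
      · rw [hk]; omega
      · rw [raise_inc_ones]; exact h
  obtain ⟨x, hx, hx0, ha, hlim⟩ := exists_limit_of_gap (orderMap_raise k) (a := alpha β)
    (by rw [raise_inc_zeros]; exact hlo) (by rw [raise_inc_zero_ones]; exact hhi)
    fun w h1 h2 => hJ _ ⟨k, _, Or.inl (farWord_mem_farey w), rfl⟩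
      (mem_outerInterval_shiftDigits.2 ⟨hβ1, h1, h2⟩)
  refine ⟨raise k x, by rw [← raise_inc, ha], Rich.of_approx fun N => ?_⟩
  obtain ⟨w, h1, h2⟩ := hlim N
  exact ⟨raise k (leftEnd w), _, raise_agree.2 h1, h2, by
    rw [raise_inc]; exact (richBin_path w).raise k⟩

lemma isLeast_exceptional {β : ℝ} (hβ : β ∈ exceptional) :
    IsLeast (zeroDimParams β) (1 - 1 / β) := by
  have hβ1 : 1 < β := hβ.1
  obtain ⟨x, hx, hr⟩ := exceptional_limit hβ
  refine ⟨one_sub_inv_mem hβ1, fun t ht => ?_⟩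
  by_contra hlt
  rw [not_le, ← value_dec_first hβ1 hx] at hlt
  refine (dimH_survivorSet_pos hβ1 (bdd_of_inc_eq_alpha hβ1 hx) (fun n => ?_) hr hlt).ne' ht.2.2
  rcases n with _ | n
  · rw [shift_zero, value_dec_first hβ1 hx]
    have : 0 < 1 / β := by positivity
    linarith
  · rw [← shift_shift n 1, ← shift_inc, hx, shift_shift]
    exact value_shift_alpha_le hβ1 _

/-- The sequences `x` for which `α(β) = Φ_S(x⁺)`, with `x⁺` obtained from `x` by raising its
first digit. -/
structure IsLimit (S : List ℕ) (β : ℝ) (x : ℕ → ℕ) : Prop where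
  bin : IsBin x
  head : x 0 = 0
  eq : alpha β = substSeq S (inc x)
  rich : Rich (substSeq S x) (alpha β)
  ge : ∀ n, x ≤ₗ shift n x
  pos : (fun _ => 0) <ₗ x

lemma le_shift_leftEnd (w : List Bool) (n : ℕ) : leftEnd w ≤ₗ shift n (leftEnd w) := by
  have hf := fareyShape_path w
  rw [leftEnd, ← hf.substSeq_zero_eq]
  exact substSeq_ge hf.lyndon.lyndon (fun _ => Nat.zero_le _) n

/-- Leaving out `I^S` makes the lower end of the gap strict, so the search runs inside `J^S`. The
right end point `α(β) = Φ_S(1^∞)` lies outside the open gap and is treated separately, with `x =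
01^∞`. -/
lemma exists_isLimit {S : List ℕ} (hS : IsLyndon S) {β : ℝ} (hβ : β ∈ relExceptional S) :
    ∃ x, IsLimit S β x := by
  obtain ⟨⟨h1, h2⟩, h3⟩ := hβ
  obtain ⟨hβ1, h4, h5⟩ := (mem_outerInterval_iff hS).1 h1
  have hlo : substSeq S (inc fun _ => 0) <ₗ alpha β := by
    rw [inc_zeros]
    exact not_le.1 fun h => h2 ((mem_basicInterval_iff hS).2 ⟨hβ1, h4, h⟩)
  rcases h5.lt_or_eq with h6 | h6
  · obtain ⟨x, hx, hx0, ha, hlim⟩ := exists_limit_of_gap (orderMap_substSeq hS) hlo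
      (by rw [inc_zero_ones]; exact h6) fun w h1 h2 => h3 (mem_iUnion₂.2
        ⟨_, farWord_mem_farey w, (mem_outerInterval_subst hS).2 ⟨hβ1, h1, h2⟩⟩)
    refine ⟨x, hx, hx0, ha, Rich.of_approx fun N => ?_, fun n => le_of_leTo fun N => ?_, ?_⟩
    · obtain ⟨w, h7, h8⟩ := hlim N
      exact ⟨substSeq S (leftEnd w), _,
        (substSeq_agree h7).mono (Nat.le_mul_of_pos_left N hS.length_pos), h8,
        (richBin_path w).substSeq (isBin_leftEnd w) (leftEnd_head w) hS⟩
    · obtain ⟨w, h7, -⟩ := hlim (N + n)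
      exact (leTo_of_le (le_shift_leftEnd w n) N).congr (h7.mono (by omega))
        ((h7.shift n).mono (by omega))
    · refine lt_of_le_of_ne (zero_le_seq x) fun h => ?_
      rw [toLex_inj] at h
      rw [ha, ← h] at hlo
      exact lt_irrefl _ hlo
  · rw [toLex_inj] at h6
    refine ⟨app [0] fun _ => 1, isBin_zero_one, by simp, by rw [inc_zero_ones, h6], ?_,
      fun n => ?_, lt_of_exists_ne ⟨1, by decide⟩⟩
    · rw [h6]
      conv => arg 2; rw [← inc_zero_ones]
      exact richBin_base.substSeq isBin_zero_one (by simp) hS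
    · rcases n with _ | n
      · exact le_rfl
      · rw [← shift_shift n 1, shift_one_app_cons, app_nil]
        exact (lt_of_head_lt (by simp)).le

lemma IsLimit.shift_le {S : List ℕ} {β : ℝ} {x : ℕ → ℕ} (h : IsLimit S β x) (hS : IsLyndon S)
    (hβ : 1 < β) (n : ℕ) : shift n (inc x) ≤ₗ inc x := by
  have hb := isBin_inc h.bin h.head
  refine (mem_shiftsBetween_of_substSeq hS (c₀ := fun _ => 0) (fun _ => Nat.zero_le _) rfl
    (by rw [inc_zero, h.head]) hb (fun i => ⟨substSeq_ge hS hb i, ?_⟩) n).2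
  rw [← h.eq]; exact shift_alpha_le hβ i

lemma IsLimit.admissible {S : List ℕ} {β : ℝ} {x : ℕ → ℕ} (h : IsLimit S β x) (hS : IsLyndon S)
    (hβ : 1 < β) : Admissible (inc x) := by
  refine ⟨h.shift_le hS hβ, infinite_of_shift_pos fun n => ?_⟩
  rcases n with _ | n
  · exact lt_of_head_lt (by rw [shift_zero, inc_zero]; omega)
  · rw [← shift_shift n 1, shift_inc, shift_shift]
    exact h.pos.trans_le (h.ge _)

lemma IsLimit.isLeast {S : List ℕ} {β : ℝ} {x : ℕ → ℕ} (h : IsLimit S β x) (hS : LambdaShape S)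
    (hβ : 1 < β) : IsLeast (zeroDimParams β) (value β (substSeq S x)) := by
  have hL := hS.lyndon
  have h1 : inc x 0 = 1 := by rw [inc_zero, h.head]
  have hb := isBin_inc h.bin h.head
  have hsh : ∀ n, shift n x ≤ₗ inc x := by
    intro n
    rcases n with _ | n
    · exact (lt_inc x).le
    · rw [← shift_shift n 1, ← shift_inc, shift_shift]; exact h.shift_le hL hβ _
  refine isLeast_zeroDimParams hβ (fun n => ?_) ?_ ?_ h.rich (d := substSeq S (inc x)) ?_ ?_
  · rw [h.eq]
    rcases substSeq_upper hL h.bin n with ⟨k, -, hk⟩ | hk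
    · rw [hk]; exact substSeq_le hL hb (hsh k)
    · exact (hk _ h1).lt.le
  · rw [h.eq]; exact substSeq_lt hL hb (lt_inc x)
  · exact exists_ne_of_lt ((substSeq_zero_pos hL).trans_le (substSeq_ge hL h.bin 0))
  · rw [h.eq]
  · have := hS.renorm x (inc x) h.bin hb h.head h1
    rw [seqDim_inc, ENNReal.zero_div] at this
    exact le_antisymm this bot_le

/-! ### Infinitely renormalizable bases -/

lemma two_pow_le_length_chain {s : ℕ → List ℕ} (hs : IsFareySeq s) (n : ℕ) :
    2 ^ n ≤ (chain s n).length := by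
  induction n with
  | zero => exact (extShape_of_mem hs.1).lyndon.length_pos
  | succ n ih =>
    rw [chain, subst_length (lambdaShape_chain hs n).lyndon.ne, pow_succ, mul_comm]
    exact Nat.mul_le_mul (isBinLyndon_of_mem (hs.2 _ (Nat.succ_pos n))).two_le ih

lemma substSeq_zero_agree {S : List ℕ} (hS : IsLyndon S) :
    Agree (S.length - 1) (substSeq S fun _ => 0) (per S) := by
  rw [substSeq_zero hS, evPer_eq]; exact minus_agree hS.ne _

/-- The lower bounds `Φ_{S_n}(0^∞)`, with `S_n = s₁ • ⋯ • s_n`, increase and stabilize digit by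
digit to a sequence `c` that inherits their richness. Renormalization bounds the dimension between
`c` and `α(β)` by that of the full binary shift over `|S_n|`, which tends to zero. -/
lemma IsCoding.isLeast {s : ℕ → List ℕ} {β : ℝ} (h : IsCoding s β) :
    ∃ t, IsLeast (zeroDimParams β) t ∧
      Filter.Tendsto (fun n : ℕ => value β (evPer (chain s n) [0])) Filter.atTop (nhds t) := by
  have hS := lambdaShape_chain h.1
  have hL : ∀ n, IsLyndon (chain s n) := fun n => (hS n).lyndon
  have hJ := fun n => (mem_outerInterval_iff (hL n)).1 (h.2 n)
  have hβ := (hJ 0).1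
  have hlen := two_pow_le_length_chain h.1
  have hlen' : ∀ n, n + 1 ≤ (chain s n).length := fun n => (Nat.lt_two_pow_self).trans_le (hlen n)
  set lo : ℕ → ℕ → ℕ := fun n => substSeq (chain s n) fun _ => 0 with hlo
  have hmono : ∀ n, lo n ≤ₗ lo (n + 1) := by
    intro n
    have hr := isBinLyndon_of_mem (h.1.2 _ (Nat.succ_pos n))
    simp only [hlo, chain]
    rw [substSeq_subst (hL n) hr fun _ => Nat.zero_le _]
    exact substSeq_le (hL n) (isBin_substSeq hr fun _ => Nat.zero_le _) (zero_le_seq _)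
  have hlole : ∀ n k, lo n ≤ₗ lo (n + k) := by
    intro n k
    induction k with
    | zero => exact le_rfl
    | succ k ih => exact ih.trans (hmono _)
  -- Later lower bounds are still `Φ_{S_n}`-images of sequences starting with `0`, hence lie below
  -- `S_n^∞`. Together with monotonicity this fixes all but the last digit of the word `S_n`.
  have hltper : ∀ n k, LtTo (chain s n).length (lo (n + k)) (per (chain s n)) := by
    intro n k
    suffices ∀ c, IsBin c → c 0 = 0 → ∃ c' : ℕ → ℕ, c' 0 = 0 ∧
        substSeq (chain s (n + k)) c = substSeq (chain s n) c' by
      obtain ⟨c, hc0, hc⟩ := this (fun _ => 0) (fun _ => Nat.zero_le _) rfl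
      simp only [hlo, hc]
      exact substSeq_ltTo_per (hL n) hc0
    induction k with
    | zero => exact fun c _ h0 => ⟨c, h0, rfl⟩
    | succ k ih =>
      intro c hc h0
      have hr := isBinLyndon_of_mem (h.1.2 _ (Nat.succ_pos (n + k)))
      rw [← add_assoc, chain, substSeq_subst (hL _) hr hc]
      exact ih _ (isBin_substSeq hr hc) (by rw [substSeq_head hr hc, h0])
  have hag : ∀ n k, Agree ((chain s n).length - 1) (lo (n + k)) (lo n) := fun n k =>
    agree_of_between (hlole n k) (hltper n k).lt.le (substSeq_zero_agree (hL n))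
  -- The words at least double in length at each level, so at level `i + 1` the digit number `i`
  -- precedes the last digit of the word and no longer changes.
  set c : ℕ → ℕ := fun i => lo (i + 1) i with hc
  have hcag : ∀ n, Agree ((chain s n).length - 1) c (lo n) := by
    intro n i hi
    rcases le_total n (i + 1) with h1 | h1
    · obtain ⟨k, hk⟩ := Nat.exists_eq_add_of_le h1
      rw [hc]; simp only [hk]
      exact hag n k i hi
    · obtain ⟨k, rfl⟩ := Nat.exists_eq_add_of_le h1
      refine (hag (i + 1) k i ?_).symm
      have := hlen' (i + 1)
      omega
  have hcag' : ∀ n, Agree n c (lo n) := fun n => (hcag n).mono (by have := hlen' n; omega)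
  have hloc : ∀ n, lo n ≤ₗ c := fun n => le_of_leTo fun N =>
    ((leTo_of_le (hlole n N) N).congr (fun _ _ => rfl)
      (((hcag' (n + N)).mono (by omega)).symm))
  have hca : ∀ n, shift n c ≤ₗ alpha β := fun n => le_of_leTo fun N =>
    (leTo_of_le ((shift_substSeq_zero_le (hL (N + n)) n).trans (hJ (N + n)).2.1) N).congr
      (((hcag' (N + n)).symm.shift n).mono (by omega)) fun _ _ => rfl
  have hrich : Rich c (alpha β) := Rich.of_approx fun N =>
    ⟨lo N, _, (hcag' N).symm, (hJ N).2.1, (hS N).rich⟩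
  have hlt : c <ₗ alpha β := by
    have h1 := (hltper 0 (chain s 0).length).congr
      (by rw [Nat.zero_add]; exact (hcag' _).symm) fun _ _ => rfl
    exact h1.lt.trans_le ((hL 0).le_maxRot.trans (hJ 0).2.1)
  have hdim : seqDim (shiftsBetween c (alpha β)) = 0 := by
    refine le_antisymm (ge_of_tendsto' ENNReal.tendsto_inv_nat_nhds_zero fun n => ?_) bot_le
    calc seqDim (shiftsBetween c (alpha β))
        ≤ seqDim (shiftsBetween (lo n) (substSeq (chain s n) fun _ => 1)) :=
          seqDim_mono (shiftsBetween_mono (hloc n) (hJ n).2.2)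
      _ ≤ seqDim (shiftsBetween (fun _ => 0) fun _ => 1) / (chain s n).length :=
          (hS n).renorm _ _ (fun _ => Nat.zero_le _) (fun _ => le_rfl) rfl rfl
      _ ≤ 1 / n := by
          refine ENNReal.div_le_div (le_trans (seqDim_mono ?_) seqDim_bin_le) ?_
          · exact fun z hz i => shiftsBetween_digit_le hz i
          · exact_mod_cast (Nat.le_succ n).trans (hlen' n)
      _ = (n : ENNReal)⁻¹ := one_div _
  refine ⟨value β c, isLeast_zeroDimParams hβ hca hlt
    (exists_ne_of_lt ((substSeq_zero_pos (hL 0)).trans_le (hloc 0))) hrich le_rfl hdim, ?_⟩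
  rw [tendsto_iff_dist_tendsto_zero]
  refine squeeze_zero (fun _ => dist_nonneg) (fun n => ?_)
    (tendsto_const_nhds.div_atTop (tendsto_pow_atTop_atTop_of_one_lt hβ) :
      Filter.Tendsto (fun n : ℕ => (alpha β 0 : ℝ) / (β - 1) / β ^ n) Filter.atTop (nhds 0))
  rw [Real.dist_eq]
  refine value_sub_le hβ (fun i => ?_) (bdd_of_shift_le hca) ?_
  · rw [evPer_eq]
    by_cases hi : i < (chain s n).length
    · rw [agree_app_per _ _ i hi]
      have h1 := head_le_of_le (shift_per_le_maxRot (chain s n) i)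
      rw [shift_apply, Nat.zero_add] at h1
      exact h1.trans (head_le_of_le (hJ n).2.1)
    · rw [app, if_neg hi, per_singleton]; exact Nat.zero_le _
  · rw [evPer_eq]
    refine ((((agree_app_per (chain s n) (per [0])).mono (Nat.sub_le _ 1)).trans
      (substSeq_zero_agree (hL n)).symm).trans (hcag n).symm).mono ?_
    have := hlen' n
    omega

/-! ### Existence and uniqueness of codings -/

lemma outerInterval_chain_mono {s : ℕ → List ℕ} (hs : IsFareySeq s) {i n : ℕ} (h : i ≤ n) {β : ℝ}
    (hβ : β ∈ outerInterval (chain s n)) : β ∈ outerInterval (chain s i) := by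
  induction n with
  | zero => rwa [Nat.le_zero.1 h]
  | succ n ih =>
    rcases h.lt_or_eq with h | rfl
    · exact ih (by omega) (outerInterval_subst_subset (lambdaShape_chain hs n).lyndon
        (hs.2 _ n.succ_pos) hβ)
    · exact hβ

lemma chain_unique {s s' : ℕ → List ℕ} (hs : IsFareySeq s) (hs' : IsFareySeq s') {n : ℕ} {β : ℝ}
    (h : β ∈ outerInterval (chain s n)) (h' : β ∈ outerInterval (chain s' n)) :
    ∀ i ≤ n, s i = s' i := by
  induction n with
  | zero =>
    intro i hi
    rw [Nat.le_zero.1 hi]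
    exact outerInterval_ext_unique hs.1 hs'.1 h h'
  | succ n ih =>
    have h1 := ih (outerInterval_chain_mono hs n.le_succ h)
      (outerInterval_chain_mono hs' n.le_succ h')
    intro i hi
    rcases hi.lt_or_eq with hi | rfl
    · exact h1 i (by omega)
    · rw [chain, ← chain_congr h1] at h'
      exact outerInterval_subst_unique (lambdaShape_chain hs n).lyndon (hs.2 _ n.succ_pos)
        (hs'.2 _ n.succ_pos) h h'

/-- Membership gives a finite chain at every level separately. The intervals of one level are
disjoint, so these chains are compatible and their diagonal is a coding. -/
lemma exists_coding {β : ℝ} (h : β ∈ infRenorm) : ∃ s, IsCoding s β := by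
  have h1 : ∀ n, ∃ s, IsFareySeq s ∧ β ∈ outerInterval (chain s n) := by
    intro n
    obtain ⟨S, ⟨-, s, hs, rfl⟩, hβ⟩ := mem_iUnion₂.1 (mem_iInter₂.1 h (n + 1) (by simp))
    exact ⟨s, hs, hβ⟩
  choose f hf hβ using h1
  have h2 : ∀ n, ∀ i ≤ n, f i i = f n i := fun n i hi =>
    chain_unique (hf i) (hf n) (hβ i) (outerInterval_chain_mono (hf n) hi (hβ n)) i le_rfl
  refine ⟨fun i => f i i, ⟨(hf 0).1, fun k hk => (hf k).2 k hk⟩, fun n => ?_⟩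
  rw [chain_congr (h2 n)]
  exact hβ n

lemma exists_coding_of_forall {β : ℝ} {s₀ : List ℕ} (hs₀ : s₀ ∈ fareyExt)
    (hβ : β ∈ outerInterval s₀)
    (h : ∀ S ∈ lambdaExt, β ∈ outerInterval S → ∃ r ∈ farey, β ∈ outerInterval (subst S r)) :
    ∃ s, IsCoding s β := by
  choose! r hr hr' using h
  let T : ℕ → List ℕ := fun n => Nat.rec s₀ (fun _ S => subst S (r S)) n
  have hT : ∀ n, T n ∈ lambdaExt ∧ β ∈ outerInterval (T n) := by
    intro n
    induction n with
    | zero => exact ⟨fareyExt_subset hs₀, hβ⟩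
    | succ n ih => exact ⟨subst_mem ih.1 (hr _ ih.1 ih.2), hr' _ ih.1 ih.2⟩
  let s : ℕ → List ℕ := fun n => Nat.casesOn n s₀ fun n => r (T n)
  have hs : ∀ n, chain s n = T n := by
    intro n
    induction n with
    | zero => rfl
    | succ n ih => rw [chain, ih]
  refine ⟨s, ⟨hs₀, fun k hk => ?_⟩, fun n => by rw [hs]; exact (hT n).2⟩
  obtain ⟨n, rfl⟩ := Nat.exists_eq_add_of_le' hk
  exact hr _ (hT n).1 (hT n).2

/-- A base outside `E` lies in the interval of an extended Farey word. If it avoids every `I^S` and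
`E^S`, each interval containing it has a subinterval `J^{S • r}` that does too, and the choices
never end. -/
lemma classification {β : ℝ} (hβ : 1 < β) : β ∈ exceptional ∨
    (∃ S ∈ lambdaExt, β ∈ basicInterval S ∨ β ∈ relExceptional S) ∨ ∃ s, IsCoding s β := by
  by_contra hn
  push Not at hn
  obtain ⟨h1, h2, h3⟩ := hn
  have h4 : ∃ s ∈ fareyExt, β ∈ outerInterval s := by
    by_contra h4
    exact h1 ⟨hβ, fun h => h4 (by simpa using h)⟩
  obtain ⟨s, hs, hβs⟩ := h4
  obtain ⟨s', hs'⟩ := exists_coding_of_forall hs hβs fun S hS hβS => by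
    by_contra h5
    exact (h2 S hS).2 ⟨⟨hβS, (h2 S hS).1⟩, fun h => h5 (by simpa using h)⟩
  exact h3 s' hs'

lemma isLeast_criticalValue {β : ℝ} (hβ : 1 < β) :
    IsLeast (zeroDimParams β) (criticalValue β) := by
  suffices ∃ t, IsLeast (zeroDimParams β) t by
    obtain ⟨t, ht⟩ := this
    rwa [criticalValue, ht.csInf_eq]
  rcases classification hβ with h | ⟨S, hS, h | h⟩ | ⟨s, hs⟩
  · exact ⟨_, isLeast_exceptional h⟩
  · exact ⟨_, isLeast_of_mem_basicInterval (lambdaShape_of_mem hS) h⟩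
  · have hS' := lambdaShape_of_mem hS
    obtain ⟨x, hx⟩ := exists_isLimit hS'.lyndon h
    exact ⟨_, hx.isLeast hS' hβ⟩
  · obtain ⟨t, ht, -⟩ := hs.isLeast
    exact ⟨t, ht⟩

lemma criticalValue_eq_iff {β : ℝ} (hβ : 1 < β) :
    criticalValue β = 1 - 1 / β ↔ β ∈ exceptionalL := by
  constructor
  · intro h
    by_contra hn
    have h1 : β ∉ exceptional := fun h => hn (Or.inl h)
    have h2 : ∃ s ∈ fareyExt, β ∈ outerInterval s := by
      by_contra h4
      exact h1 ⟨hβ, fun h => h4 (by simpa using h)⟩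
    obtain ⟨s, hs, hβs⟩ := h2
    obtain ⟨t, ht, hlt⟩ := exists_lt_of_mem_outerInterval (extShape_of_mem hs) hβs
      fun h3 => hn (Or.inr ⟨s, hs, h3⟩)
    have := criticalValue_le ht
    linarith
  · rintro (h | ⟨s, hs, rfl⟩)
    · exact (isLeast_exceptional h).csInf_eq
    · have hE := extShape_of_mem hs
      have h1 : betaL s ∈ basicInterval s := by
        refine (mem_basicInterval_iff hE.lyndon).2 ⟨hβ, by rw [alpha_betaL hE.lyndon], ?_⟩
        rw [alpha_betaL hE.lyndon]
        exact (per_maxRot_lt_substSeq hE.lyndon (by simp)).le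
      rw [criticalValue, (isLeast_of_mem_basicInterval hE.lambda h1).csInf_eq,
        ← substSeq_zero hE.lyndon]
      exact value_dec_first hβ (by rw [hE.inc_eq, alpha_betaL hE.lyndon])

/-! ### The base belonging to a relative exceptional set -/

lemma alpha_two : alpha 2 = fun _ => 1 := by
  have h : Admissible fun _ => 1 := ⟨fun _ => le_rfl, fun N => ⟨N, le_rfl, one_ne_zero⟩⟩
  refine (h.eq_alpha one_lt_two ?_).symm
  rw [value_const one_lt_two]; norm_num

lemma isBin_alpha_iff {β : ℝ} (hβ : 1 < β) : IsBin (alpha β) ↔ β ≤ 2 := by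
  constructor
  · intro h
    rw [← alpha_le_alpha_iff hβ one_lt_two, alpha_two]
    exact le_const h
  · intro h i
    have h1 : ⌈β⌉₊ ≤ 2 := Nat.ceil_le.2 (by exact_mod_cast h)
    have := alpha_lt hβ i
    omega

/-- `Φ_S` is injective on binary sequences, and `α(β')` is binary exactly for `β' ≤ 2`. Existence
and uniqueness of `β'` thus become those of the base with expansion `inc x`. -/
lemma IsLimit.isPsi_iff {S : List ℕ} {β : ℝ} {x : ℕ → ℕ} (h : IsLimit S β x) (hS : IsLyndon S)
    (hβ : 1 < β) {β' : ℝ} : IsPsi S β' β ↔ 1 < β' ∧ alpha β' = inc x := by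
  have hb := isBin_inc h.bin h.head
  constructor
  · rintro ⟨⟨h1, h2⟩, -, a, ha, hb'⟩
    rw [isQuasiGreedy_iff h1] at ha
    rw [isQuasiGreedy_iff hβ, h.eq] at hb'
    subst ha
    exact ⟨h1, substSeq_injective hS ((isBin_alpha_iff h1).2 h2) hb hb'⟩
  · rintro ⟨h1, h2⟩
    refine ⟨⟨h1, (isBin_alpha_iff h1).1 (by rw [h2]; exact hb)⟩, hβ, inc x, ?_, ?_⟩
    · rw [isQuasiGreedy_iff h1, h2]
    · rw [isQuasiGreedy_iff hβ, h.eq]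

lemma update_inc {x : ℕ → ℕ} (h : x 0 = 0) : Function.update (inc x) 0 0 = x := by
  funext i
  rcases i with _ | i
  · rw [Function.update_self, h]
  · rw [Function.update_of_ne (Nat.succ_ne_zero i), ← shift_apply 1 (inc x) i, shift_inc]; rfl

lemma relExceptional_psi {S : List ℕ} (hS : LambdaShape S) {β : ℝ} (hβ : β ∈ relExceptional S) :
    (∃! β' : ℝ, IsPsi S β' β) ∧
      ∀ (β' : ℝ) (a : ℕ → ℕ), IsPsi S β' β → IsQuasiGreedy β' 1 a →
        criticalValue β = value β (substSeq S (Function.update a 0 0)) := by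
  have hL := hS.lyndon
  have hβ1 : 1 < β := ((mem_outerInterval_iff hL).1 hβ.1.1).1
  obtain ⟨x, hx⟩ := exists_isLimit hL hβ
  obtain ⟨h1, h2⟩ := (hx.admissible hL hβ1).baseOf_spec
  refine ⟨⟨_, (hx.isPsi_iff hL hβ1).2 ⟨h1, h2⟩, fun β' h' => ?_⟩, fun β' a h' ha => ?_⟩
  · obtain ⟨h3, h4⟩ := (hx.isPsi_iff hL hβ1).1 h'
    exact alpha_injective h3 h1 (by rw [h4, h2])
  · obtain ⟨h3, h4⟩ := (hx.isPsi_iff hL hβ1).1 h'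
    rw [(isQuasiGreedy_iff h3).1 ha, h4, update_inc hx.head]
    exact (hx.isLeast hS hβ1).csInf_eq

end BetaHole

theorem theorem3p3 :
    -- the minimum that defines the critical value exists
    (∀ β : ℝ, 1 < β → IsLeast (zeroDimParams β) (criticalValue β)) ∧
    -- (i) basic intervals
    (∀ S ∈ lambdaExt, ∀ β ∈ basicInterval S,
      criticalValue β = value β (evPer (minus S) (maxRot S))) ∧
    -- (ii) the upper bound, and the case of equality
    (∀ β : ℝ, 1 < β → criticalValue β ≤ 1 - 1 / β) ∧
    (∀ β : ℝ, 1 < β → (criticalValue β = 1 - 1 / β ↔ β ∈ exceptionalL)) ∧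
    -- (iii) relative exceptional sets
    (∀ S ∈ lambdaExt, ∀ β ∈ relExceptional S,
      (∃! β' : ℝ, IsPsi S β' β) ∧
      ∀ (β' : ℝ) (a : ℕ → ℕ), IsPsi S β' β → IsQuasiGreedy β' 1 a →
        criticalValue β = value β (substSeq S (Function.update a 0 0))) ∧
    -- (iv) infinitely renormalizable bases
    (∀ β ∈ infRenorm,
      (∃ s, IsCoding s β) ∧
      ∀ s, IsCoding s β →
        Filter.Tendsto (fun n : ℕ => value β (evPer (chain s n) [0])) Filter.atTop
          (nhds (criticalValue β))) := by
  refine ⟨fun β hβ => isLeast_criticalValue hβ, fun S hS β h =>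
    (isLeast_of_mem_basicInterval (lambdaShape_of_mem hS) h).csInf_eq,
    fun β hβ => criticalValue_le (one_sub_inv_mem hβ), fun β hβ => criticalValue_eq_iff hβ,
    fun S hS β h => relExceptional_psi (lambdaShape_of_mem hS) h,
    fun β h => ⟨exists_coding h, fun s hs => ?_⟩⟩
  obtain ⟨t, ht, hlim⟩ := hs.isLeast
  rw [criticalValue, ht.csInf_eq]
  exact hlim
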